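/- All graphs are finite and simple. For a digraph $D$, a spanning subdigraph is eulerian if every vertex has equal in- and out-degree in it; let $EE(D)$ and $EO(D)$ be the numbers of spanning eulerian subdigraphs of $D$ with an even, respectively odd, number of arcs. For $f : V(G) \to \mathbb{N}$, a graph $G$ is $f$-Alon–Tarsi ($f$-AT) if $G$ has an orientation $D$ with $EE(D) \neq EO(D)$ and $f(v) \ge d_D^+(v) + 1$ for every vertex $v$. The Alon–Tarsi number $AT(G)$ is the least $k$ such that $G$ is $f$-AT for the constant function $f = k$. A graph $G$ is $k$-AT-critical if $AT(G) = k$ and $AT(H) < k$ for every proper subgraph $H$ of $G$. Let $d(G)$ denote the average degree of $G$. Let $k \in \{5, 6\}$ and let $G$ be a $k$-AT-critical graph with $G \neq K_k$. Then $$d(G) \ge k - 1 + \frac{(k-3)(2k-5)}{k^3 + 2k^2 - 18k + 15}.$$ -/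

import Mathlib

namespace AlonTarsi

/-- The out-degree of `v` in the digraph `D` (used for finite digraphs). -/
noncomputable def outDegree {V : Type*} (D : Digraph V) (v : V) : ℕ :=
  {w : V | D.Adj v w}.ncard

/-- The in-degree of `v` in the digraph `D` (used for finite digraphs). -/
noncomputable def inDegree {V : Type*} (D : Digraph V) (v : V) : ℕ :=
  {w : V | D.Adj w v}.ncard

/-- The number of arcs of the digraph `D` (used for finite digraphs). -/
noncomputable def numArcs {V : Type*} (D : Digraph V) : ℕ :=
  {e : V × V | D.Adj e.1 e.2}.ncard

/-- A digraph is eulerian if every vertex has equal in- and out-degree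
(connectedness is not required). -/
def IsEulerian {V : Type*} (D : Digraph V) : Prop :=
  ∀ v, outDegree D v = inDegree D v

/-- `EE(D)`: the number of spanning eulerian subdigraphs of `D` with an even number of arcs. -/
noncomputable def EE {V : Type*} (D : Digraph V) : ℕ :=
  {H : Digraph V | H ≤ D ∧ IsEulerian H ∧ Even (numArcs H)}.ncard

/-- `EO(D)`: the number of spanning eulerian subdigraphs of `D` with an odd number of arcs. -/
noncomputable def EO {V : Type*} (D : Digraph V) : ℕ :=
  {H : Digraph V | H ≤ D ∧ IsEulerian H ∧ Odd (numArcs H)}.ncard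

/-- `D` is an orientation of the simple graph `G`: each edge of `G` is an arc of `D` in exactly
one of its two directions, and `D` has no other arcs. -/
def IsOrientation {V : Type*} (D : Digraph V) (G : SimpleGraph V) : Prop :=
  (∀ u v, G.Adj u v ↔ D.Adj u v ∨ D.Adj v u) ∧ ∀ u v, D.Adj u v → ¬ D.Adj v u

/-- `G` is `f`-Alon–Tarsi. -/
def IsAT {V : Type*} (G : SimpleGraph V) (f : V → ℕ) : Prop :=
  ∃ D : Digraph V, IsOrientation D G ∧ EE D ≠ EO D ∧ ∀ v, outDegree D v + 1 ≤ f v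

/-- The Alon–Tarsi number of a finite graph `G`: the least `k` such that `G` is `f`-AT for the
constant function `f = k`. -/
noncomputable def alonTarsiNumber {V : Type*} (G : SimpleGraph V) : ℕ :=
  sInf {k : ℕ | IsAT G fun _ => k}

/-- `G` is `k`-AT-critical: `AT(G) = k`, and `AT(H) < k` for every proper subgraph `H` of `G`. -/
def IsATCritical {V : Type*} (G : SimpleGraph V) (k : ℕ) : Prop :=
  alonTarsiNumber G = k ∧ ∀ H : G.Subgraph, H ≠ ⊤ → alonTarsiNumber H.coe < k

/-- The average degree of a finite graph. -/
noncomputable def averageDegree {V : Type*} [Fintype V] (G : SimpleGraph V)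
    [DecidableRel G.Adj] : ℝ :=
  (∑ v, (G.degree v : ℝ)) / Fintype.card V

end AlonTarsi

set_option linter.unusedSectionVars false
set_option linter.unusedSimpArgs false

/-! ### The arc polynomial and the coefficient form of the Alon–Tarsi condition -/

namespace AlonTarsi

open Finset MvPolynomial

universe u

/-! Put n = k - 1, so n is 4 or 5. The bound proved is d(G) ≥ n + 1/9, and 1/9 exceeds both required
fractions, 1/10 and 7/65. All degrees of G are at least n. Call the vertices of degree n low; the
excess degrees of the other vertices have to pay for them.

The Alon–Tarsi condition is used in polynomial form (`isAT_iff`): EE - EO is the coefficient of the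
out-degree monomial in the product of X u - X v over all arcs. A critical graph has no nonempty
vertex set X carrying a nonzero coefficient that fits the budgets left once all edges leaving X
point outwards (`IsATCritical.not_reducible`). Two kinds of such sets drive the proof.

The first kind is an even cycle with at most one chord on low vertices. Excluding it gives a
Rubin-type block theorem (`NoEven.clique_or_degree_le`): the blocks of the low subgraph are cliques
or cycles. Since G is not complete it has no clique on k vertices, and a weighted sparsity
inequality for low sets follows (`LowSet.weight_le`). It is tight for big cliques (those on n low
vertices) and for tree-like unions of them, the clusters.

The second kind consists of clusters together with vertices of degree n + 1. With the outer
variables regarded as scalars, the polynomial of a cluster has, for any two of its external vertices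
a and b, a coefficient ±(Z a - Z b) (`exists_coeff_clique`, `Separating.union`). So a cluster
charges the outer vertices only for two selected neighbours rather than for all of them, and Hall's
theorem distributes the selections. The outcome is that clusters send at most one edge per cluster
plus three per vertex to the vertices of degree n + 1 (`IsATCritical.card_edges_le`).

Sparsity bounds the number of low vertices by the edges leaving them (`LowSet.card_le_edges`).
Together the two estimates let each remaining vertex pay for its share, and |V| is at most nine
times the total excess (`IsATCritical.card_le_excess`). -/

/-- The product of `X u - X v` over the arcs `(u, v)` of a finite set of arcs. -/
noncomputable def arcPoly {V : Type*} (R : Type*) [CommRing R] (E : Finset (V × V)) :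
    MvPolynomial V R :=
  ∏ e ∈ E, (X e.1 - X e.2)

/-- The out-degree of `v` in a finite set of arcs. -/
def outs {V : Type*} [DecidableEq V] (E : Finset (V × V)) (v : V) : ℕ := #{e ∈ E | e.1 = v}

/-- The in-degree of `v` in a finite set of arcs. -/
def ins {V : Type*} [DecidableEq V] (E : Finset (V × V)) (v : V) : ℕ := #{e ∈ E | e.2 = v}

/-- The out-degree sequence of `E` after reversing the arcs in `S`. -/
noncomputable def arcExp {V : Type*} [DecidableEq V] (E S : Finset (V × V)) : V →₀ ℕ :=
  ∑ e ∈ E \ S, Finsupp.single e.1 1 + ∑ e ∈ S, Finsupp.single e.2 1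

/-- `E` contains each edge of `H` in exactly one direction, and nothing else. -/
def Orients {V : Type*} (E : Finset (V × V)) (H : SimpleGraph V) : Prop :=
  (∀ u v, H.Adj u v ↔ (u, v) ∈ E ∨ (v, u) ∈ E) ∧ ∀ u v, (u, v) ∈ E → (v, u) ∉ E

/-- The result of reversing the arcs in `S`. -/
def rev {V : Type*} [DecidableEq V] (E S : Finset (V × V)) : Finset (V × V) :=
  (E \ S) ∪ S.image Prod.swap

section

variable {V : Type*} [DecidableEq V]

theorem prod_X_eq_monomial {R : Type*} [CommRing R] {ι : Type*} (s : Finset ι) (f : ι → V) :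
    ∏ i ∈ s, (X (f i) : MvPolynomial V R) = monomial (∑ i ∈ s, Finsupp.single (f i) 1) 1 := by
  classical
  induction s using Finset.induction_on with
  | empty => simp
  | insert a s ha ih =>
    rw [prod_insert ha, sum_insert ha, ih, X, monomial_mul, one_mul]

theorem arcPoly_eq_sum (R : Type*) [CommRing R] (E : Finset (V × V)) :
    arcPoly R E = ∑ S ∈ E.powerset, monomial (arcExp E S) ((-1) ^ #S) := by
  rw [arcPoly, prod_sub]
  refine sum_congr rfl fun S _ => ?_
  rw [prod_X_eq_monomial, prod_X_eq_monomial, mul_assoc, monomial_mul, one_mul]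
  have : ((-1 : MvPolynomial V R)) ^ #S = C ((-1) ^ #S) := by simp
  rw [this, C_mul_monomial, mul_one, arcExp]

theorem coeff_arcPoly (R : Type*) [CommRing R] (E : Finset (V × V)) (m : V →₀ ℕ) :
    coeff m (arcPoly R E) = ∑ S ∈ E.powerset with arcExp E S = m, (-1) ^ #S := by
  rw [arcPoly_eq_sum, coeff_sum, sum_filter]
  exact sum_congr rfl fun S _ => by rw [coeff_monomial]

/-- All coefficients come from ℤ, so values computed there carry over to every coefficient ring;
later that ring is itself a polynomial ring. -/
theorem coeff_arcPoly_cast (R : Type*) [CommRing R] (E : Finset (V × V)) (m : V →₀ ℕ) :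
    coeff m (arcPoly R E) = ((coeff m (arcPoly ℤ E) : ℤ) : R) := by
  rw [coeff_arcPoly, coeff_arcPoly]; push_cast; rfl

theorem sum_single_fst_apply (S : Finset (V × V)) (v : V) :
    (∑ e ∈ S, Finsupp.single e.1 1 : V →₀ ℕ) v = outs S v := by
  rw [Finsupp.finsetSum_apply, outs, card_filter]
  exact sum_congr rfl fun e _ => by rw [Finsupp.single_apply]

theorem sum_single_snd_apply (S : Finset (V × V)) (v : V) :
    (∑ e ∈ S, Finsupp.single e.2 1 : V →₀ ℕ) v = ins S v := by
  rw [Finsupp.finsetSum_apply, ins, card_filter]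
  exact sum_congr rfl fun e _ => by rw [Finsupp.single_apply]

theorem arcExp_apply (E S : Finset (V × V)) (v : V) :
    arcExp E S v = outs (E \ S) v + ins S v := by
  rw [arcExp, Finsupp.add_apply, sum_single_fst_apply, sum_single_snd_apply]

theorem outs_sdiff_add {E S : Finset (V × V)} (h : S ⊆ E) (v : V) :
    outs (E \ S) v + outs S v = outs E v := by
  rw [outs, outs, outs, ← card_union_of_disjoint, ← filter_union, sdiff_union_of_subset h]
  exact disjoint_filter_filter sdiff_disjoint

theorem arcExp_add_outs {E S : Finset (V × V)} (h : S ⊆ E) (v : V) :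
    arcExp E S v + outs S v = outs E v + ins S v := by
  rw [arcExp_apply, ← outs_sdiff_add h]; omega

theorem arcExp_empty_apply (E : Finset (V × V)) (v : V) : arcExp E ∅ v = outs E v := by
  simp [arcExp_apply, ins]

/-- Reversal changes the out-degree of `v` by `ins S v - outs S v`. This is the link between
monomials and eulerian subdigraphs. -/
theorem arcExp_eq_empty_iff {E S : Finset (V × V)} (h : S ⊆ E) :
    arcExp E S = arcExp E ∅ ↔ ∀ v, outs S v = ins S v := by
  rw [Finsupp.ext_iff]
  refine forall_congr' fun v => ?_
  have := arcExp_add_outs h v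
  rw [arcExp_empty_apply]
  omega

theorem exists_subset_of_coeff_ne_zero {R : Type*} [CommRing R] {E : Finset (V × V)} {m : V →₀ ℕ}
    (h : coeff m (arcPoly R E) ≠ 0) : ∃ S ⊆ E, arcExp E S = m := by
  rw [coeff_arcPoly] at h
  obtain ⟨S, hS, -⟩ := exists_ne_zero_of_sum_ne_zero h
  rw [mem_filter, mem_powerset] at hS
  exact ⟨S, hS.1, hS.2⟩

theorem mem_rev {E S : Finset (V × V)} {u v : V} :
    (u, v) ∈ rev E S ↔ ((u, v) ∈ E ∧ (u, v) ∉ S) ∨ (v, u) ∈ S := by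
  simp only [rev, mem_union, mem_sdiff, mem_image, Prod.exists, Prod.swap_prod_mk, Prod.mk.injEq]
  constructor
  · rintro (h | ⟨a, b, h, rfl, rfl⟩)
    · exact Or.inl h
    · exact Or.inr h
  · rintro (h | h)
    · exact Or.inl h
    · exact Or.inr ⟨v, u, h, rfl, rfl⟩

theorem Orients.rev {E S : Finset (V × V)} {H : SimpleGraph V} (hE : Orients E H) (hS : S ⊆ E) :
    Orients (rev E S) H := by
  refine ⟨fun u v => ?_, fun u v => ?_⟩
  · rw [hE.1, mem_rev, mem_rev]
    have h1 := @hS (u, v)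
    have h2 := @hS (v, u)
    tauto
  · rw [mem_rev, mem_rev]
    have h1 := @hS (u, v)
    have h2 := @hS (v, u)
    have h3 := hE.2 u v
    have h4 := hE.2 v u
    tauto

theorem disjoint_image_swap {E S : Finset (V × V)} (h : ∀ u v, (u, v) ∈ E → (v, u) ∉ E)
    (hS : S ⊆ E) : Disjoint (E \ S) (S.image Prod.swap) := by
  rw [disjoint_left]
  rintro ⟨a, b⟩ hx hy
  simp only [mem_image, Prod.exists, Prod.swap_prod_mk, Prod.mk.injEq] at hy
  obtain ⟨c, d, hcd, rfl, rfl⟩ := hy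
  exact h _ _ (hS hcd) (mem_sdiff.1 hx).1

theorem arcPoly_rev (R : Type*) [CommRing R] {E S : Finset (V × V)}
    (h : ∀ u v, (u, v) ∈ E → (v, u) ∉ E) (hS : S ⊆ E) :
    arcPoly R (rev E S) = (-1) ^ #S * arcPoly R E := by
  rw [rev, arcPoly, prod_union (disjoint_image_swap h hS), arcPoly, ← prod_sdiff hS,
    prod_image (Prod.swap_injective.injOn)]
  have : ∏ x ∈ S, ((X x.swap.1 : MvPolynomial V R) - X x.swap.2)
      = (-1) ^ #S * ∏ x ∈ S, (X x.1 - X x.2) := by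
    rw [← prod_const, ← prod_mul_distrib]
    exact prod_congr rfl fun x _ => by simp
  rw [this]; ring

theorem outs_rev {E S : Finset (V × V)} (h : ∀ u v, (u, v) ∈ E → (v, u) ∉ E) (hS : S ⊆ E) (v : V) :
    outs (rev E S) v = arcExp E S v := by
  rw [arcExp_apply, rev, outs, filter_union, card_union_of_disjoint]
  · rw [outs, ins, filter_image, card_image_of_injective _ Prod.swap_injective]
    rfl
  · exact disjoint_filter_filter (disjoint_image_swap h hS)

theorem Orients.eq_rev {E E' : Finset (V × V)} {H : SimpleGraph V} (hE : Orients E H)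
    (hE' : Orients E' H) : E' = AlonTarsi.rev E (E \ E') := by
  ext ⟨u, v⟩
  rw [mem_rev, mem_sdiff, mem_sdiff]
  have h1 := hE.1 u v
  have h2 := hE'.1 u v
  have h3 := hE.2 u v
  have h4 := hE'.2 u v
  tauto

/-- Any two orientations differ by a reversal, so up to sign the polynomial depends only on the
graph. The sign is one integer fixed before the ring, so it serves ℤ and polynomial rings at once.
-/
theorem Orients.arcPoly_eq {E E' : Finset (V × V)} {H : SimpleGraph V} (hE : Orients E H)
    (hE' : Orients E' H) : ∃ s : ℤ, (s = 1 ∨ s = -1) ∧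
      ∀ (R : Type u) [CommRing R], arcPoly R E' = C (s : R) * arcPoly R E := by
  refine ⟨(-1) ^ #(E \ E'), neg_one_pow_eq_or ℤ _, fun R _ => ?_⟩
  conv_lhs => rw [hE.eq_rev hE']
  rw [arcPoly_rev R hE.2 sdiff_subset]
  simp

theorem Orients.coeff_ne_zero {E E' : Finset (V × V)} {H : SimpleGraph V} (hE : Orients E H)
    (hE' : Orients E' H) {m : V →₀ ℕ} (h : coeff m (arcPoly ℤ E) ≠ 0) :
    coeff m (arcPoly ℤ E') ≠ 0 := by
  obtain ⟨s, hs, h1⟩ := hE.arcPoly_eq hE'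
  rw [h1, coeff_C_mul]
  refine mul_ne_zero ?_ h
  rcases hs with rfl | rfl <;> simp

/-- The coefficient at the out-degree sequence of an acyclic set of arcs is one. -/
theorem coeff_arcExp_empty_of_rank (R : Type*) [CommRing R] {E : Finset (V × V)} (r : V → ℕ)
    (hr : ∀ e ∈ E, r e.2 < r e.1) : coeff (arcExp E ∅) (arcPoly R E) = 1 := by
  rw [coeff_arcPoly]
  have : (E.powerset.filter fun S => arcExp E S = arcExp E ∅) = {∅} := by
    ext S
    rw [mem_filter, mem_powerset, mem_singleton]
    constructor
    · rintro ⟨hS, h⟩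
      rw [arcExp_eq_empty_iff hS] at h
      by_contra hne
      -- The tail of an arc of `S` with tail of maximal rank also has an in-arc in `S`, and that arc
      -- starts at a still higher rank.
      obtain ⟨e, he, hmax⟩ := exists_max_image S (fun e => r e.1) (nonempty_iff_ne_empty.2 hne)
      have h1 : 0 < outs S e.1 := card_pos.2 ⟨e, mem_filter.2 ⟨he, rfl⟩⟩
      rw [h] at h1
      obtain ⟨e', he'⟩ := card_pos.1 h1
      rw [mem_filter] at he'
      have h2 := hmax e' he'.1
      have h3 := hr e' (hS he'.1)
      rw [he'.2] at h3
      omega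
    · rintro rfl
      exact ⟨empty_subset _, rfl⟩
  rw [this]; simp

/-- The digraph with a given finite set of arcs. -/
def ofArcs (S : Finset (V × V)) : Digraph V := ⟨fun u v => (u, v) ∈ S⟩

theorem ofArcs_injective : Function.Injective (ofArcs : Finset (V × V) → Digraph V) := by
  intro S T h
  ext ⟨u, v⟩
  have : (ofArcs S).Adj u v = (ofArcs T).Adj u v := by rw [h]
  exact iff_of_eq this

theorem numArcs_ofArcs (S : Finset (V × V)) : numArcs (ofArcs S) = #S := by
  rw [numArcs, ← Set.ncard_coe_finset]; rfl

theorem outDegree_ofArcs (S : Finset (V × V)) (v : V) : outDegree (ofArcs S) v = outs S v := by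
  rw [outDegree, outs, ← Set.ncard_coe_finset]
  refine Set.ncard_congr (fun w _ => (v, w)) (fun w hw => ?_) (fun a b _ _ h => (Prod.mk.inj h).2)
    fun e he => ?_
  · exact mem_coe.2 (mem_filter.2 ⟨hw, rfl⟩)
  · obtain ⟨a, b⟩ := e
    simp only [coe_filter, Set.mem_ofPred_eq] at he
    obtain ⟨h1, rfl⟩ := he
    exact ⟨b, h1, rfl⟩

theorem inDegree_ofArcs (S : Finset (V × V)) (v : V) : inDegree (ofArcs S) v = ins S v := by
  rw [inDegree, ins, ← Set.ncard_coe_finset]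
  refine Set.ncard_congr (fun w _ => (w, v)) (fun w hw => ?_) (fun a b _ _ h => (Prod.mk.inj h).1)
    fun e he => ?_
  · exact mem_coe.2 (mem_filter.2 ⟨hw, rfl⟩)
  · obtain ⟨a, b⟩ := e
    simp only [coe_filter, Set.mem_ofPred_eq] at he
    obtain ⟨h1, rfl⟩ := he
    exact ⟨a, h1, rfl⟩

theorem isEulerian_ofArcs (S : Finset (V × V)) :
    IsEulerian (ofArcs S) ↔ ∀ v, outs S v = ins S v := by
  simp only [IsEulerian, outDegree_ofArcs, inDegree_ofArcs]

theorem exists_ofArcs_eq [Fintype V] (D : Digraph V) : ∃ E, ofArcs E = D := by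
  classical
  refine ⟨univ.filter fun e => D.Adj e.1 e.2, ?_⟩
  ext u v
  simp [ofArcs]

theorem ncard_subdigraphs [Fintype V] (E : Finset (V × V)) (p : ℕ → Prop) [DecidablePred p] :
    {H : Digraph V | H ≤ ofArcs E ∧ IsEulerian H ∧ p (numArcs H)}.ncard
      = #{S ∈ E.powerset | arcExp E S = arcExp E ∅ ∧ p #S} := by
  rw [← Set.ncard_coe_finset, ← Set.ncard_image_of_injective _ ofArcs_injective]
  congr 1
  ext H
  obtain ⟨S, rfl⟩ := exists_ofArcs_eq H
  simp only [Set.mem_ofPred_eq, coe_filter, mem_powerset, ofArcs_injective.mem_set_image]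
  have h1 : ofArcs S ≤ ofArcs E ↔ S ⊆ E :=
    ⟨fun h ⟨u, v⟩ he => h he, fun h u v he => h he⟩
  rw [h1, isEulerian_ofArcs, numArcs_ofArcs]
  refine and_congr_right fun h => ?_
  rw [arcExp_eq_empty_iff h]

/-- The subsets contributing to this monomial are the eulerian ones, each with the sign of its
parity. -/
theorem coeff_arcExp_empty [Fintype V] (E : Finset (V × V)) :
    coeff (arcExp E ∅) (arcPoly ℤ E) = (EE (ofArcs E) : ℤ) - EO (ofArcs E) := by
  classical
  rw [EE, EO, ncard_subdigraphs, ncard_subdigraphs, coeff_arcPoly,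
    ← sum_filter_add_sum_filter_not _ (fun S => Even #S)]
  have h1 : ∑ S ∈ (E.powerset.filter fun S => arcExp E S = arcExp E ∅) with Even #S, (-1 : ℤ) ^ #S
      = #{S ∈ E.powerset | arcExp E S = arcExp E ∅ ∧ Even #S} := by
    rw [filter_filter, card_eq_sum_ones, Nat.cast_sum]
    exact sum_congr rfl fun S hS => by simp [(mem_filter.1 hS).2.2.neg_one_pow]
  have h2 : ∑ S ∈ (E.powerset.filter fun S => arcExp E S = arcExp E ∅) with ¬Even #S, (-1 : ℤ) ^ #S
      = -#{S ∈ E.powerset | arcExp E S = arcExp E ∅ ∧ Odd #S} := by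
    rw [filter_filter, card_eq_sum_ones, Nat.cast_sum, ← sum_neg_distrib]
    simp only [Nat.not_even_iff_odd]
    exact sum_congr rfl fun S hS => by simp [(mem_filter.1 hS).2.2.neg_one_pow]
  rw [h1, h2, sub_eq_add_neg]

/-- This frees the orientation from the monomial: a nonzero coefficient at `m` arises from some
reversal, whose out-degrees are then exactly `m`, and changing the orientation costs only a sign. -/
theorem isAT_iff [Fintype V] (G : SimpleGraph V) (f : V → ℕ) :
    IsAT G f ↔ ∃ E, Orients E G ∧ ∃ m, coeff m (arcPoly ℤ E) ≠ 0 ∧ ∀ v, m v < f v := by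
  constructor
  · rintro ⟨D, hD, hne, hf⟩
    obtain ⟨E, rfl⟩ := exists_ofArcs_eq D
    refine ⟨E, hD, arcExp E ∅, ?_, fun v => ?_⟩
    · rw [coeff_arcExp_empty]
      intro h
      apply hne
      omega
    · have := hf v
      rw [outDegree_ofArcs] at this
      rw [arcExp_empty_apply]; omega
  · rintro ⟨E, hE, m, hm, hf⟩
    obtain ⟨S, hS, rfl⟩ := exists_subset_of_coeff_ne_zero hm
    have h1 : arcExp E S = arcExp (rev E S) ∅ := by
      ext v
      rw [arcExp_empty_apply, outs_rev hE.2 hS]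
    refine ⟨ofArcs (rev E S), hE.rev hS, ?_, fun v => ?_⟩
    · intro h
      have h2 := coeff_arcExp_empty (rev E S)
      rw [h, sub_self, ← h1] at h2
      exact hE.coeff_ne_zero (hE.rev hS) hm h2
    · rw [outDegree_ofArcs, outs_rev hE.2 hS]
      exact hf v

end

end AlonTarsi

/-! ### Reducible sets in critical graphs -/

namespace AlonTarsi

open Finset MvPolynomial

universe u

theorem exists_coeff_ne_zero_of_mul {V R : Type*} [CommRing R] {A B : MvPolynomial V R}
    {m : V →₀ ℕ} (h : coeff m (A * B) ≠ 0) :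
    ∃ a b, a + b = m ∧ coeff a A ≠ 0 ∧ coeff b B ≠ 0 := by
  classical
  rw [coeff_mul] at h
  obtain ⟨x, hx, hne⟩ := exists_ne_zero_of_sum_ne_zero h
  exact ⟨x.1, x.2, mem_antidiagonal.1 hx, left_ne_zero_of_mul hne, right_ne_zero_of_mul hne⟩

/-- If a monomial of a product decomposes in only one way, its coefficient is a product. -/
theorem coeff_mul_of_unique {V R : Type*} [CommRing R] {A B : MvPolynomial V R}
    {a b : V →₀ ℕ}
    (h : ∀ a' b', a' + b' = a + b → coeff a' A ≠ 0 → coeff b' B ≠ 0 → a' = a) :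
    coeff (a + b) (A * B) = coeff a A * coeff b B := by
  classical
  rw [coeff_mul, sum_eq_single (a, b)]
  · rintro ⟨x, y⟩ hx hne
    by_contra h0
    have hxy := mem_antidiagonal.1 hx
    have h1 := h x y hxy (left_ne_zero_of_mul h0) (right_ne_zero_of_mul h0)
    subst h1
    exact hne (by rw [show y = b from add_left_cancel hxy])
  · intro h0
    exact absurd (by simp) h0

section

variable {V : Type u} [Fintype V] [DecidableEq V]

theorem sum_outs (E : Finset (V × V)) : ∑ v, outs E v = #E :=
  (card_eq_sum_card_fiberwise (f := Prod.fst) (fun _ _ => mem_coe.2 (mem_univ _))).symm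

theorem sum_ins (E : Finset (V × V)) : ∑ v, ins E v = #E :=
  (card_eq_sum_card_fiberwise (f := Prod.snd) (fun _ _ => mem_coe.2 (mem_univ _))).symm

theorem sum_arcExp {E S : Finset (V × V)} (h : S ⊆ E) : ∑ v, arcExp E S v = #E := by
  simp_rw [arcExp_apply]
  rw [sum_add_distrib, sum_outs, sum_ins, card_sdiff_add_card_eq_card h]

theorem sum_of_coeff_arcPoly_ne_zero {R : Type*} [CommRing R] {E : Finset (V × V)} {m : V →₀ ℕ}
    (h : coeff m (arcPoly R E) ≠ 0) : ∑ v, m v = #E := by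
  obtain ⟨S, hS, rfl⟩ := exists_subset_of_coeff_ne_zero h
  exact sum_arcExp hS

theorem eq_zero_of_coeff_arcPoly_ne_zero {R : Type*} [CommRing R] {E : Finset (V × V)} {m : V →₀ ℕ}
    (h : coeff m (arcPoly R E) ≠ 0) {v : V} (hv : ∀ e ∈ E, e.1 ≠ v ∧ e.2 ≠ v) : m v = 0 := by
  obtain ⟨S, hS, rfl⟩ := exists_subset_of_coeff_ne_zero h
  rw [arcExp_apply, outs, ins, filter_false_of_mem, filter_false_of_mem]
  · simp
  · exact fun e he => (hv e (hS he)).2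
  · exact fun e he => (hv e (mem_sdiff.1 he).1).1

theorem exists_orients (G : SimpleGraph V) : ∃ E, Orients E G := by
  classical
  let f := Fintype.equivFin V
  refine ⟨univ.filter fun e => G.Adj e.1 e.2 ∧ f e.1 < f e.2, fun u v => ?_, fun u v => ?_⟩
  · simp only [mem_filter, mem_univ, true_and]
    constructor
    · intro h
      rcases lt_trichotomy (f u) (f v) with h1 | h1 | h1
      · exact Or.inl ⟨h, h1⟩
      · exact absurd (f.injective h1) h.ne
      · exact Or.inr ⟨h.symm, h1⟩
    · rintro (h | h)
      · exact h.1
      · exact h.1.symm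
  · simp only [mem_filter, mem_univ, true_and]
    rintro h h'
    exact lt_asymm h.2 h'.2

theorem Orients.ne {E : Finset (V × V)} {G : SimpleGraph V} (h : Orients E G) {e : V × V}
    (he : e ∈ E) : e.1 ≠ e.2 :=
  ((h.1 e.1 e.2).2 (Or.inl he)).ne

theorem Orients.adj {E : Finset (V × V)} {G : SimpleGraph V} (h : Orients E G) {e : V × V}
    (he : e ∈ E) : G.Adj e.1 e.2 :=
  (h.1 e.1 e.2).2 (Or.inl he)

theorem arcPoly_ne_zero {R : Type*} [CommRing R] [IsDomain R] {E : Finset (V × V)}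
    (h : ∀ e ∈ E, e.1 ≠ e.2) : arcPoly R E ≠ 0 := by
  rw [arcPoly, prod_ne_zero_iff]
  intro e he h0
  exact h e he (X_injective (sub_eq_zero.1 h0))

theorem arcPoly_union (R : Type*) [CommRing R] {E F : Finset (V × V)} (h : Disjoint E F) :
    arcPoly R (E ∪ F) = arcPoly R E * arcPoly R F := prod_union h

theorem IsAT.mono {G : SimpleGraph V} {f g : V → ℕ} (h : IsAT G f) (hfg : ∀ v, f v ≤ g v) :
    IsAT G g := by
  obtain ⟨D, h1, h2, h3⟩ := h
  exact ⟨D, h1, h2, fun v => (h3 v).trans (hfg v)⟩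

theorem exists_isAT_const (G : SimpleGraph V) : ∃ k, IsAT G fun _ => k := by
  obtain ⟨E, hE⟩ := exists_orients G
  obtain ⟨m, hm⟩ := ne_zero_iff.1 (arcPoly_ne_zero (R := ℤ) fun e he => hE.ne he)
  refine ⟨∑ v, m v + 1, (isAT_iff G _).2 ⟨E, hE, m, hm, fun v => ?_⟩⟩
  exact Nat.lt_succ_of_le (single_le_sum (f := fun v => m v) (fun _ _ => Nat.zero_le _)
    (mem_univ v))

theorem isAT_of_alonTarsiNumber_le {G : SimpleGraph V} {k : ℕ} (h : alonTarsiNumber G ≤ k) :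
    IsAT G fun _ => k := by
  have : alonTarsiNumber G ∈ {k : ℕ | IsAT G fun _ => k} := Nat.sInf_mem (exists_isAT_const G)
  exact IsAT.mono this fun _ => h

/-- The edges of `G` inside `X`, as a graph on the same vertices. -/
def within (G : SimpleGraph V) (X : Finset V) : SimpleGraph V where
  Adj u v := G.Adj u v ∧ u ∈ X ∧ v ∈ X
  symm := ⟨fun _ _ h => ⟨h.1.symm, h.2.2, h.2.1⟩⟩
  loopless := ⟨fun _ h => h.1.ne rfl⟩

/-- The neighbours of `v` in `X`. -/
def nb (G : SimpleGraph V) [DecidableRel G.Adj] (X : Finset V) (v : V) : Finset V :=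
  X.filter fun w => G.Adj v w

/-- Criticality for the subgraph induced on `Y`, transported from the subtype to `V` so that its
polynomial can be multiplied with those of other parts. -/
theorem IsATCritical.exists_coeff_of_ne_top {G : SimpleGraph V} {k : ℕ} (hG : IsATCritical G k)
    {Y : Finset V} (hY : Y ≠ univ) : ∃ E, Orients E (within G Y) ∧
      ∃ m, coeff m (arcPoly ℤ E) ≠ 0 ∧ ∀ v ∈ Y, m v < k - 1 := by
  classical
  let H : G.Subgraph := (⊤ : G.Subgraph).induce (Y : Set V)
  have hH : H ≠ ⊤ := by
    intro h
    apply hY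
    ext v
    have : v ∈ H.verts ↔ v ∈ (⊤ : G.Subgraph).verts := by rw [h]
    simpa [H] using this
  have h1 := hG.2 H hH
  have : Fintype H.verts := Fintype.ofFinite _
  have h2 : IsAT H.coe fun _ => k - 1 := isAT_of_alonTarsiNumber_le (by omega)
  obtain ⟨E, hE, m, hm, hlt⟩ := (isAT_iff _ _).1 h2
  have hinj : Function.Injective (Prod.map Subtype.val Subtype.val : H.verts × H.verts → V × V) :=
    Subtype.val_injective.prodMap Subtype.val_injective
  have hmem : ∀ u v, (u, v) ∈ E.image (Prod.map Subtype.val Subtype.val) ↔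
      ∃ (hu : u ∈ H.verts) (hv : v ∈ H.verts), ((⟨u, hu⟩ : H.verts), (⟨v, hv⟩ : H.verts)) ∈ E := by
    intro u v
    simp only [mem_image, Prod.exists, Prod.map_apply, Prod.mk.injEq]
    constructor
    · rintro ⟨a, b, hab, rfl, rfl⟩
      exact ⟨a.2, b.2, hab⟩
    · rintro ⟨hu, hv, h⟩
      exact ⟨_, _, h, rfl, rfl⟩
  refine ⟨E.image (Prod.map Subtype.val Subtype.val), ⟨fun u v => ?_, fun u v => ?_⟩,
    m.mapDomain Subtype.val, ?_, fun v hv => ?_⟩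
  · rw [hmem, hmem]
    constructor
    · rintro ⟨h, hu, hv⟩
      have h3 : H.coe.Adj ⟨u, by simpa [H] using hu⟩ ⟨v, by simpa [H] using hv⟩ := by
        simp [H, h, hu, hv]
      rcases (hE.1 _ _).1 h3 with h4 | h4
      · exact Or.inl ⟨_, _, h4⟩
      · exact Or.inr ⟨_, _, h4⟩
    · have key : ∀ (u v : V) (hu : u ∈ H.verts) (hv : v ∈ H.verts),
        ((⟨u, hu⟩ : H.verts), (⟨v, hv⟩ : H.verts)) ∈ E → (within G Y).Adj u v := by
        intro u v hu hv h
        have h3 := (hE.1 _ _).2 (Or.inl h)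
        simp only [H, SimpleGraph.Subgraph.coe_adj, SimpleGraph.Subgraph.induce_adj] at h3
        exact ⟨h3.2.2, h3.1, h3.2.1⟩
      rintro (⟨hu, hv, h⟩ | ⟨hu, hv, h⟩)
      · exact key u v hu hv h
      · exact (key v u hu hv h).symm
  · rw [hmem, hmem]
    rintro ⟨hu, hv, h⟩ ⟨_, _, h'⟩
    exact hE.2 _ _ h h'
  · have : arcPoly ℤ (E.image (Prod.map Subtype.val Subtype.val))
        = rename Subtype.val (arcPoly ℤ E) := by
      rw [arcPoly, arcPoly, prod_image hinj.injOn, map_prod]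
      exact prod_congr rfl fun e _ => by simp
    rw [this, coeff_rename_mapDomain _ Subtype.val_injective]
    exact hm
  · have : m.mapDomain Subtype.val v = m ⟨v, by simpa [H] using hv⟩ :=
      Finsupp.mapDomain_apply Subtype.val_injective m ⟨v, by simpa [H] using hv⟩
    rw [this]
    exact hlt _

theorem IsATCritical.not_isAT {G : SimpleGraph V} {k : ℕ} (hG : IsATCritical G k) (hk : 0 < k) :
    ¬ IsAT G fun _ => k - 1 := fun h => by
  have : alonTarsiNumber G ≤ k - 1 := Nat.sInf_le h
  rw [hG.1] at this
  omega

/-- A critical graph has no nonempty vertex set whose induced subgraph is Alon–Tarsi for the bounds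
left by out-arcs towards the remaining vertices. -/
theorem IsATCritical.not_reducible {G : SimpleGraph V} [DecidableRel G.Adj] {k : ℕ}
    (hG : IsATCritical G k) (hk : 0 < k) {X : Finset V} (hX : X.Nonempty) {E : Finset (V × V)}
    (hE : Orients E (within G X)) {m : V →₀ ℕ} (hm : coeff m (arcPoly ℤ E) ≠ 0)
    (h : ∀ v ∈ X, m v + G.degree v + 1 ≤ (k - 1) + #(nb G X v)) : False := by
  obtain ⟨E2, hE2, μ, hμ, hμk⟩ := hG.exists_coeff_of_ne_top (Y := Xᶜ) (by
    intro h0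
    obtain ⟨x, hx⟩ := hX
    exact (mem_compl.1 (h0 ▸ mem_univ x)) hx)
  apply hG.not_isAT hk
  rw [isAT_iff]
  -- All edges between `X` and its complement point out of `X`. They use `G.degree v - #(nb G X v)`
  -- of the budget `k - 1` at a vertex of `X`, and nothing outside `X`.
  set E3 : Finset (V × V) := univ.filter fun e => G.Adj e.1 e.2 ∧ e.1 ∈ X ∧ e.2 ∉ X with hE3
  have mem3 : ∀ u v, (u, v) ∈ E3 ↔ G.Adj u v ∧ u ∈ X ∧ v ∉ X := by simp [hE3]
  have mem1 : ∀ e ∈ E, e.1 ∈ X ∧ e.2 ∈ X := fun e he => (hE.adj he).2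
  have mem2 : ∀ e ∈ E2, e.1 ∉ X ∧ e.2 ∉ X := fun e he => by
    simpa using (hE2.adj he).2
  have d32 : Disjoint E3 E2 := by
    rw [disjoint_left]
    rintro ⟨u, v⟩ h1 h2
    exact (mem2 _ h2).1 ((mem3 u v).1 h1).2.1
  have d1 : Disjoint E (E3 ∪ E2) := by
    rw [disjoint_left]
    rintro ⟨u, v⟩ h1 h2
    rcases mem_union.1 h2 with h2 | h2
    · exact ((mem3 u v).1 h2).2.2 (mem1 _ h1).2
    · exact (mem2 _ h2).1 (mem1 _ h1).1
  have e3out : ∀ v ∈ X, ins E3 v = 0 := by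
    intro v hv
    rw [ins, card_eq_zero, filter_eq_empty_iff]
    rintro ⟨a, b⟩ hab rfl
    exact ((mem3 a b).1 hab).2.2 hv
  have e3in : ∀ v ∉ X, outs E3 v = 0 := by
    intro v hv
    rw [outs, card_eq_zero, filter_eq_empty_iff]
    rintro ⟨a, b⟩ hab rfl
    exact hv ((mem3 a b).1 hab).2.1
  have m1 : ∀ a, coeff a (arcPoly ℤ E) ≠ 0 → ∀ v ∉ X, a v = 0 := fun a ha v hv =>
    eq_zero_of_coeff_arcPoly_ne_zero ha fun e he =>
      ⟨fun h0 => hv (h0 ▸ (mem1 e he).1), fun h0 => hv (h0 ▸ (mem1 e he).2)⟩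
  have m2 : ∀ a, coeff a (arcPoly ℤ E2) ≠ 0 → ∀ v ∈ X, a v = 0 := fun a ha v hv =>
    eq_zero_of_coeff_arcPoly_ne_zero ha fun e he =>
      ⟨fun h0 => (mem2 e he).1 (h0 ▸ hv), fun h0 => (mem2 e he).2 (h0 ▸ hv)⟩
  have m3 : ∀ a, coeff a (arcPoly ℤ E3) ≠ 0 → ∀ v ∈ X, a v ≤ outs E3 v := by
    intro a ha v hv
    obtain ⟨S, hS, rfl⟩ := exists_subset_of_coeff_ne_zero ha
    have h1 := arcExp_add_outs hS v
    have h2 : ins S v ≤ ins E3 v := card_le_card (filter_subset_filter _ hS)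
    have h3 := e3out v hv
    omega
  have key2 : coeff (arcExp E3 ∅ + μ) (arcPoly ℤ E3 * arcPoly ℤ E2) ≠ 0 := by
    rw [coeff_mul_of_unique, coeff_arcExp_empty_of_rank ℤ (r := fun v => if v ∈ X then 1 else 0),
      one_mul]
    · exact hμ
    · rintro ⟨a, b⟩ he
      have := (mem3 a b).1 he
      simp [this.2.1, this.2.2]
    · intro a b hab ha hb
      have hX0 : ∀ v ∈ X, a v = outs E3 v := by
        intro v hv
        have h1 : a v + b v = arcExp E3 ∅ v + μ v := by
          rw [← Finsupp.add_apply, hab, Finsupp.add_apply]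
        rw [m2 b hb v hv, m2 μ hμ v hv, arcExp_empty_apply] at h1
        omega
      -- Both sides have the number of arcs as total, so a pointwise inequality already forces
      -- equality.
      have hle : ∀ v ∈ (univ : Finset V), outs E3 v ≤ a v := by
        intro v _
        by_cases hv : v ∈ X
        · exact (hX0 v hv).ge
        · rw [e3in v hv]; exact Nat.zero_le _
      have hs : ∑ v, outs E3 v = ∑ v, a v := by
        rw [sum_outs, sum_of_coeff_arcPoly_ne_zero ha]
      ext v
      rw [arcExp_empty_apply]
      exact ((sum_eq_sum_iff_of_le hle).1 hs v (mem_univ v)).symm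
  have key1 : coeff (m + (arcExp E3 ∅ + μ)) (arcPoly ℤ E * (arcPoly ℤ E3 * arcPoly ℤ E2)) ≠ 0 := by
    rw [coeff_mul_of_unique]
    · exact mul_ne_zero hm key2
    · intro a b hab ha hb
      obtain ⟨c, d, rfl, hc, hd⟩ := exists_coeff_ne_zero_of_mul hb
      -- On `X` the crossing arcs contribute at most `outs E3 v`, so `a` dominates `m`; equal totals
      -- finish as before.
      have hle : ∀ v ∈ (univ : Finset V), m v ≤ a v := by
        intro v _
        by_cases hv : v ∈ X
        · have h1 : a v + (c v + d v) = m v + (arcExp E3 ∅ v + μ v) := by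
            rw [← Finsupp.add_apply, ← Finsupp.add_apply, hab, Finsupp.add_apply, Finsupp.add_apply]
          rw [m2 d hd v hv, m2 μ hμ v hv, arcExp_empty_apply] at h1
          have := m3 c hc v hv
          omega
        · rw [m1 m hm v hv]; exact Nat.zero_le _
      have hs : ∑ v, m v = ∑ v, a v := by
        rw [sum_of_coeff_arcPoly_ne_zero hm, sum_of_coeff_arcPoly_ne_zero ha]
      ext v
      exact ((sum_eq_sum_iff_of_le hle).1 hs v (mem_univ v)).symm
  refine ⟨E ∪ (E3 ∪ E2), ⟨fun u v => ?_, fun u v => ?_⟩, m + (arcExp E3 ∅ + μ), ?_, fun v => ?_⟩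
  · simp only [mem_union, mem3]
    have h1 : G.Adj u v ∧ u ∈ X ∧ v ∈ X ↔ _ := hE.1 u v
    have h2 : G.Adj u v ∧ u ∈ Xᶜ ∧ v ∈ Xᶜ ↔ _ := hE2.1 u v
    simp only [mem_compl] at h2
    have h3 := G.adj_comm v u
    by_cases hu : u ∈ X <;> by_cases hv : v ∈ X <;>
      simp only [hu, hv, and_true, and_false, not_true, not_false_iff, true_and, false_and,
        or_false, false_or, h3] at h1 h2 ⊢ <;> tauto
  · simp only [mem_union, mem3]
    have h1 := hE.2 u v
    have h2 := hE2.2 u v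
    have h3 := mem1 (u, v)
    have h4 := mem1 (v, u)
    have h5 := mem2 (u, v)
    have h6 := mem2 (v, u)
    by_cases hu : u ∈ X <;> by_cases hv : v ∈ X <;>
      simp only [hu, hv, not_true, not_false_iff, true_and, false_and, and_true,
        and_false, or_false, false_or, imp_false, and_self] at h1 h2 h3 h4 h5 h6 ⊢ <;> tauto
  · rw [arcPoly_union _ d1, arcPoly_union _ d32]
    exact key1
  · rw [Finsupp.add_apply, Finsupp.add_apply, arcExp_empty_apply]
    by_cases hv : v ∈ X
    · rw [m2 μ hμ v hv]
      have h1 := h v hv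
      have h2 : outs E3 v + #(nb G X v) = G.degree v := by
        have h3 := card_filter_add_card_filter_not (s := G.neighborFinset v) (fun w => w ∈ X)
        have h4 : (G.neighborFinset v).filter (fun w => w ∈ X) = nb G X v := by
          ext w; simp [nb, and_comm]
        rw [h4, G.card_neighborFinset_eq_degree] at h3
        suffices h5 : outs E3 v = #((G.neighborFinset v).filter fun w => w ∉ X) by omega
        rw [outs]
        refine card_bij (fun e _ => e.2) ?_ ?_ ?_
        · rintro ⟨a, b⟩ he
          obtain ⟨he1, he2⟩ := mem_filter.1 he
          have he3 := (mem3 a b).1 he1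
          simp only at he2
          subst he2
          simp [he3]
        · rintro ⟨a, b⟩ he ⟨a', b'⟩ he' h0
          have h8 := (mem_filter.1 he).2
          have h9 := (mem_filter.1 he').2
          simp only at h0 h8 h9
          rw [h0, h8, h9]
        · intro w hw
          simp only [mem_filter, SimpleGraph.mem_neighborFinset] at hw
          exact ⟨(v, w), mem_filter.2 ⟨(mem3 v w).2 ⟨hw.1, hv, hw.2⟩, rfl⟩, rfl⟩
      omega
    · rw [m1 m hm v hv, e3in v hv]
      have := hμk v (mem_compl.2 hv)
      omega

end

end AlonTarsi

/-! ### Symmetry between adjacent twins, and the polynomial of a clique -/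

namespace AlonTarsi

open Finset MvPolynomial

universe u

section

variable {V : Type u} [Fintype V] [DecidableEq V]

/-- The arcs with both ends in `X`. -/
def arcsIn (E : Finset (V × V)) (X : Finset V) : Finset (V × V) :=
  E.filter fun e => e.1 ∈ X ∧ e.2 ∈ X

theorem mem_arcsIn {E : Finset (V × V)} {X : Finset V} {e : V × V} :
    e ∈ arcsIn E X ↔ e ∈ E ∧ e.1 ∈ X ∧ e.2 ∈ X := mem_filter

theorem Orients.arcsIn {E : Finset (V × V)} {G : SimpleGraph V} (h : Orients E G) (X : Finset V) :
    Orients (arcsIn E X) (within G X) := by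
  refine ⟨fun u v => ?_, fun u v => ?_⟩
  · simp only [mem_arcsIn, within, h.1]; tauto
  · simp only [mem_arcsIn]
    have := h.2 u v
    tauto

/-- The orientation of `H` in which arcs decrease an injective rank. -/
theorem orients_of_rank (H : SimpleGraph V) [DecidableRel H.Adj] {r : V → ℕ}
    (hr : Function.Injective r) :
    Orients (univ.filter fun e : V × V => H.Adj e.1 e.2 ∧ r e.2 < r e.1) H := by
  refine ⟨fun u v => ?_, fun u v => ?_⟩
  · simp only [mem_filter, mem_univ, true_and]
    constructor
    · intro h
      rcases lt_trichotomy (r v) (r u) with h1 | h1 | h1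
      · exact Or.inl ⟨h, h1⟩
      · exact absurd (hr h1.symm) h.ne
      · exact Or.inr ⟨h.symm, h1⟩
    · rintro (h | h)
      · exact h.1
      · exact h.1.symm
  · simp only [mem_filter, mem_univ, true_and]
    rintro h h'
    omega

theorem exists_rank (a b : V) (hab : a ≠ b) : ∃ r : V → ℕ, Function.Injective r ∧ r b < r a ∧
    ∀ v, v ≠ a → v ≠ b → r v < r b := by
  let f := Fintype.equivFin V
  let N := Fintype.card V
  have hf : ∀ v, (f v : ℕ) < N := fun v => (f v).2
  refine ⟨fun v => if v = a then N + 1 else if v = b then N else f v, ?_, ?_, ?_⟩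
  · intro u v h
    simp only at h
    have h1 := hf u
    have h2 := hf v
    split_ifs at h with h3 h4 h5 h6 h7 h8
    all_goals first
      | (subst_vars; rfl)
      | omega
      | exact f.injective (Fin.ext h)
  · simp [hab.symm]
  · intro v h1 h2
    simp [h1, h2, hab.symm, hf v]

/-- With the twins `a` and `b` on top of the ranking, exchanging them permutes all arcs except `(a,
b)`, which is reversed and produces the sign. -/
theorem swap_arcs {H : SimpleGraph V} [DecidableRel H.Adj] {a b : V} (hab : H.Adj a b)
    (hs : ∀ t, t ≠ a → t ≠ b → (H.Adj a t ↔ H.Adj b t)) {r : V → ℕ} (h1 : r b < r a)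
    (h2 : ∀ v, v ≠ a → v ≠ b → r v < r b) (R : Type*) [CommRing R] :
    rename (Equiv.swap a b) (arcPoly R (univ.filter fun e : V × V => H.Adj e.1 e.2 ∧ r e.2 < r e.1))
      = - arcPoly R (univ.filter fun e : V × V => H.Adj e.1 e.2 ∧ r e.2 < r e.1) := by
  set E := univ.filter fun e : V × V => H.Adj e.1 e.2 ∧ r e.2 < r e.1 with hE
  have mE : ∀ u v, (u, v) ∈ E ↔ H.Adj u v ∧ r v < r u := by simp [hE]
  have habE : (a, b) ∈ E := (mE a b).2 ⟨hab, h1⟩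
  have hanti : ∀ u v, (u, v) ∈ E → (v, u) ∉ E := by
    intro u v h h'
    rw [mE] at h h'
    omega
  have hσ : ∀ u v, (u, v) ∈ E → (u, v) ≠ (a, b) →
      (Equiv.swap a b u, Equiv.swap a b v) ∈ E.erase (a, b) := by
    intro u v h hne
    rw [mE] at h
    rw [mem_erase]
    by_cases hua : u = a
    · subst hua
      have hvb : v ≠ b := fun h0 => hne (by rw [h0])
      have hvu := h.1.ne.symm
      rw [Equiv.swap_apply_left, Equiv.swap_apply_of_ne_of_ne hvu hvb, mE]
      exact ⟨fun h0 => hab.ne (Prod.mk.inj h0).1.symm, (hs v hvu hvb).1 h.1, h2 v hvu hvb⟩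
    by_cases hub : u = b
    · subst hub
      have hvu := h.1.ne.symm
      have hva : v ≠ a := by
        rintro rfl
        omega
      rw [Equiv.swap_apply_right, Equiv.swap_apply_of_ne_of_ne hva hvu, mE]
      exact ⟨fun h0 => hvu (Prod.mk.inj h0).2, (hs v hva hvu).2 h.1, (h2 v hva hvu).trans h1⟩
    · have h3 := h2 u hua hub
      have hva : v ≠ a := by rintro rfl; omega
      have hvb : v ≠ b := by rintro rfl; omega
      rw [Equiv.swap_apply_of_ne_of_ne hua hub, Equiv.swap_apply_of_ne_of_ne hva hvb, mE]
      exact ⟨fun h0 => hua (Prod.mk.inj h0).1, h⟩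
  rw [arcPoly, map_prod, ← mul_prod_erase _ _ habE, ← mul_prod_erase _ _ habE, ← neg_mul]
  congr 1
  · simp
  · refine prod_bij (fun e _ => (Equiv.swap a b e.1, Equiv.swap a b e.2)) ?_ ?_ ?_ ?_
    · rintro ⟨u, v⟩ he
      exact hσ u v (mem_erase.1 he).2 (mem_erase.1 he).1
    · rintro ⟨u, v⟩ _ ⟨u', v'⟩ _ h0
      have h3 := Prod.mk.inj h0
      exact Prod.ext ((Equiv.swap a b).injective h3.1) ((Equiv.swap a b).injective h3.2)
    · rintro ⟨u, v⟩ he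
      refine ⟨(Equiv.swap a b u, Equiv.swap a b v),
        hσ u v (mem_erase.1 he).2 (mem_erase.1 he).1, by simp⟩
    · intro e _
      simp

theorem coeff_swap_eq_neg {H : SimpleGraph V} [DecidableRel H.Adj] {a b : V} (hab : H.Adj a b)
    (hs : ∀ t, t ≠ a → t ≠ b → (H.Adj a t ↔ H.Adj b t)) {E : Finset (V × V)} (hE : Orients E H)
    (m : V →₀ ℕ) :
    coeff (m.mapDomain (Equiv.swap a b)) (arcPoly ℤ E) = - coeff m (arcPoly ℤ E) := by
  obtain ⟨r, hr, h1, h2⟩ := exists_rank a b hab.ne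
  obtain ⟨s, -, h3⟩ := (orients_of_rank H hr).arcPoly_eq hE
  rw [h3 ℤ, coeff_C_mul, coeff_C_mul, ← mul_neg]
  congr 1
  have h4 := coeff_rename_mapDomain (Equiv.swap a b) (Equiv.swap a b).injective
    (arcPoly ℤ (univ.filter fun e : V × V => H.Adj e.1 e.2 ∧ r e.2 < r e.1)) m
  rw [swap_arcs hab hs h1 h2, coeff_neg] at h4
  rw [← h4, neg_neg]

theorem mapDomain_swap_apply (a b : V) (m : V →₀ ℕ) (v : V) :
    m.mapDomain (Equiv.swap a b) v = m (Equiv.swap a b v) := by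
  conv_lhs => rw [← Equiv.swap_apply_self a b v]
  exact Finsupp.mapDomain_apply (Equiv.swap a b).injective m _

/-- By antisymmetry, equal exponents at `a` and `b` would make the coefficient its own negative. -/
theorem ne_of_coeff_ne_zero {H : SimpleGraph V} {a b : V} (hab : H.Adj a b)
    (hs : ∀ t, t ≠ a → t ≠ b → (H.Adj a t ↔ H.Adj b t)) {E : Finset (V × V)} (hE : Orients E H)
    {m : V →₀ ℕ} (hm : coeff m (arcPoly ℤ E) ≠ 0) : m a ≠ m b := by
  classical
  intro h
  have h1 : m.mapDomain (Equiv.swap a b) = m := by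
    ext v
    rw [mapDomain_swap_apply]
    by_cases hva : v = a
    · subst hva; rw [Equiv.swap_apply_left, h]
    by_cases hvb : v = b
    · subst hvb; rw [Equiv.swap_apply_right, h]
    rw [Equiv.swap_apply_of_ne_of_ne hva hvb]
  have h2 := coeff_swap_eq_neg hab hs hE m
  rw [h1] at h2
  omega

theorem within_swap {G : SimpleGraph V} {Q : Finset V} (hQ : G.IsClique (Q : Set V)) {a b : V}
    (ha : a ∈ Q) (hb : b ∈ Q) (t : V) (hta : t ≠ a) (htb : t ≠ b) :
    (within G Q).Adj a t ↔ (within G Q).Adj b t := by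
  constructor
  · rintro ⟨-, -, h⟩
    exact ⟨hQ hb h htb.symm, hb, h⟩
  · rintro ⟨-, -, h⟩
    exact ⟨hQ ha h hta.symm, ha, h⟩

theorem clique_injOn {G : SimpleGraph V} {Q : Finset V} (hQ : G.IsClique (Q : Set V))
    {E : Finset (V × V)} (hE : Orients E (within G Q)) {m : V →₀ ℕ}
    (hm : coeff m (arcPoly ℤ E) ≠ 0) : Set.InjOn m (Q : Set V) := by
  intro a ha b hb h
  by_contra hne
  exact ne_of_coeff_ne_zero (H := within G Q) ⟨hQ ha hb hne, ha, hb⟩ (within_swap hQ ha hb) hE hm h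

/-- Extracting the variables of a clique all of whose vertices have one further neighbour. -/
theorem exists_coeff_clique {G : SimpleGraph V} {Q : Finset V} (hQ : G.IsClique (Q : Set V))
    {E : Finset (V × V)} (hE : Orients E (within G Q)) {a b : V} (ha : a ∈ Q) (hb : b ∈ Q)
    (hab : a ≠ b) : ∃ m : V →₀ ℕ, (∀ v, v ∉ Q → m v = 0) ∧ (∀ v ∈ Q, m v + 1 ≤ #Q) ∧
      ∃ s : ℤ, (s = 1 ∨ s = -1) ∧ ∀ (R : Type u) [CommRing R] (Z : V → R),
        coeff m (arcPoly R E * ∏ v ∈ Q, (X v - C (Z v))) = s * (Z a - Z b) := by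
  classical
  obtain ⟨r, hr, h1, h2⟩ := exists_rank a b hab
  set H := within G Q with hH
  set E' := univ.filter fun e : V × V => H.Adj e.1 e.2 ∧ r e.2 < r e.1 with hE'
  have hor : Orients E' H := orients_of_rank H hr
  have hHab : H.Adj a b := ⟨hQ ha hb hab, ha, hb⟩
  obtain ⟨s, hs, h3⟩ := hor.arcPoly_eq hE
  set μ := arcExp E' ∅ with hμ
  have hμ1 : coeff μ (arcPoly ℤ E') = 1 := coeff_arcExp_empty_of_rank ℤ r (by simp [hE'])
  have hout : ∀ v, μ v = #(Q.filter fun w => H.Adj v w ∧ r w < r v) := by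
    intro v
    rw [hμ, arcExp_empty_apply, outs]
    refine card_bij (fun e _ => e.2) ?_ ?_ ?_
    · rintro ⟨x, y⟩ he
      simp only [hE', mem_filter, mem_univ, true_and] at he
      obtain ⟨he, rfl⟩ := he
      exact mem_filter.2 ⟨he.1.2.2, he⟩
    · rintro ⟨x, y⟩ he ⟨x', y'⟩ he' h0
      have h8 := (mem_filter.1 he).2
      have h9 := (mem_filter.1 he').2
      simp only at h0 h8 h9
      rw [h0, h8, h9]
    · intro w hw
      exact ⟨(v, w), by simpa [hE'] using (mem_filter.1 hw).2, rfl⟩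
  have hadj : ∀ v ∈ Q, ∀ w ∈ Q, v ≠ w → H.Adj v w := fun v hv w hw h => ⟨hQ hv hw h, hv, hw⟩
  have hμa : μ a + 1 = #Q := by
    rw [hout, show (Q.filter fun w => H.Adj a w ∧ r w < r a) = Q.erase a by
      ext w
      simp only [mem_filter, mem_erase]
      constructor
      · rintro ⟨hw, h, -⟩
        exact ⟨h.ne.symm, hw⟩
      · rintro ⟨hne, hw⟩
        refine ⟨hw, hadj a ha w hw hne.symm, ?_⟩
        by_cases hwb : w = b
        · rw [hwb]; exact h1
        · exact (h2 w hne hwb).trans h1, card_erase_add_one ha]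
  have hμb : μ b + 2 = #Q := by
    rw [hout, show (Q.filter fun w => H.Adj b w ∧ r w < r b) = (Q.erase a).erase b by
      ext w
      simp only [mem_filter, mem_erase]
      constructor
      · rintro ⟨hw, h, h'⟩
        refine ⟨h.ne.symm, ?_, hw⟩
        rintro rfl
        omega
      · rintro ⟨hneb, hnea, hw⟩
        exact ⟨hw, hadj b hb w hw hneb.symm, h2 w hnea hneb⟩]
    have := card_erase_add_one ha
    have := card_erase_add_one (mem_erase.2 ⟨hab.symm, hb⟩)
    omega
  have hμo : ∀ v ∈ Q, v ≠ a → v ≠ b → μ v + 3 ≤ #Q := by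
    intro v hv hva hvb
    have h4 : (Q.filter fun w => H.Adj v w ∧ r w < r v) ⊆ ((Q.erase a).erase b).erase v := by
      intro w hw
      obtain ⟨hw, h, h'⟩ := mem_filter.1 hw
      have := h2 v hva hvb
      simp only [mem_erase]
      refine ⟨h.ne.symm, ?_, ?_, hw⟩
      · rintro rfl; omega
      · rintro rfl; omega
    have h5 := card_le_card h4
    rw [← hout] at h5
    have := card_erase_add_one ha
    have := card_erase_add_one (mem_erase.2 ⟨hab.symm, hb⟩)
    have := card_erase_add_one (mem_erase.2 ⟨hvb, mem_erase.2 ⟨hva, hv⟩⟩)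
    omega
  have hμz : ∀ v, v ∉ Q → μ v = 0 := by
    intro v hv
    rw [hout, card_eq_zero, filter_eq_empty_iff]
    rintro w - ⟨h, -⟩
    exact hv h.2.1
  have hone : ∀ (S : Finset V) (v : V), (∑ w ∈ S, Finsupp.single w 1 : V →₀ ℕ) v
      = if v ∈ S then 1 else 0 := by
    intro S v
    rw [Finsupp.finsetSum_apply]
    simp [Finsupp.single_apply]
  have hsum1 : ∀ S : Finset V, ∑ v, (∑ w ∈ S, Finsupp.single w 1 : V →₀ ℕ) v = #S := by
    intro S
    simp_rw [hone]
    simp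
  -- `μ` is the score sequence of a transitive tournament with `a` first and `b` second. Taking the
  -- variable from every factor but that of `a` lifts `b` to the level of `a`, so `m` equals `#Q -
  -- 1` at both and is invariant under exchanging them.
  set m := μ + ∑ w ∈ Q \ {a}, Finsupp.single w 1 with hm
  have hma : ∀ v, m v = μ v + if v ∈ Q \ {a} then 1 else 0 := by
    intro v
    rw [hm, Finsupp.add_apply, hone]
  refine ⟨m, fun v hv => ?_, fun v hv => ?_, -s, by omega, fun R _ Z => ?_⟩
  · rw [hma, hμz v hv, if_neg (fun h => hv (mem_sdiff.1 h).1)]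
  · rw [hma]
    by_cases hva : v = a
    · subst hva; simp [hμa]
    by_cases hvb : v = b
    · subst hvb; simp [hb, hab.symm]; omega
    have := hμo v hv hva hvb
    simp [hv, hva]; omega
  have hterm : ∀ S : Finset V, coeff m (arcPoly R E' * ((-1) ^ #S
      * (∏ v ∈ Q \ S, (X v : MvPolynomial V R)) * ∏ v ∈ S, C (Z v)))
      = if (∑ w ∈ Q \ S, Finsupp.single w 1 : V →₀ ℕ) ≤ m then
          coeff (m - ∑ w ∈ Q \ S, Finsupp.single w 1) (arcPoly R E') * ((-1) ^ #S * ∏ v ∈ S, Z v)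
        else 0 := by
    intro S
    rw [prod_X_eq_monomial, ← map_prod, show ((-1 : MvPolynomial V R)) ^ #S = C ((-1) ^ #S) by simp,
      C_mul_monomial, mul_one, mul_comm _ (C (∏ v ∈ S, Z v)), C_mul_monomial,
      coeff_mul_monomial', mul_comm (∏ v ∈ S, Z v)]
  have hzero : ∀ S ⊆ Q, S ≠ {a} → S ≠ {b} → coeff m (arcPoly R E' * ((-1) ^ #S
      * (∏ v ∈ Q \ S, (X v : MvPolynomial V R)) * ∏ v ∈ S, C (Z v))) = 0 := by
    intro S hS hSa hSb
    rw [hterm]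
    split_ifs with hle
    swap; · rfl
    rw [coeff_arcPoly_cast]
    by_contra hne
    have hne' : coeff (m - ∑ w ∈ Q \ S, Finsupp.single w 1) (arcPoly ℤ E') ≠ 0 := by
      intro h0; rw [h0] at hne; simp at hne
    set ν := m - ∑ w ∈ Q \ S, Finsupp.single w 1 with hν
    have hνm : ν + ∑ w ∈ Q \ S, Finsupp.single w 1 = m := tsub_add_cancel_of_le hle
    have hν' : ∀ v, ν v + (if v ∈ Q \ S then 1 else 0) = μ v + if v ∈ Q \ {a} then 1 else 0 := by
      intro v
      rw [← hma, ← hνm, Finsupp.add_apply, hone]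
    -- Comparison of total degrees: exactly one factor contributes its `Z` term.
    have hcard : #S = 1 := by
      have h5 : ∑ v, (ν v + if v ∈ Q \ S then 1 else 0)
        = ∑ v, (μ v + if v ∈ Q \ {a} then 1 else 0) := sum_congr rfl fun v _ => hν' v
      rw [sum_add_distrib, sum_add_distrib, sum_of_coeff_arcPoly_ne_zero hne',
        sum_of_coeff_arcPoly_ne_zero (by rw [hμ1]; exact one_ne_zero)] at h5
      simp only [sum_ite_mem, univ_inter, sum_const, smul_eq_mul, mul_one] at h5
      have h6 := card_sdiff_add_card_eq_card hS
      have h7 := card_sdiff_add_card_eq_card (singleton_subset_iff.2 ha)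
      rw [card_singleton] at h7
      omega
    obtain ⟨c, rfl⟩ := card_eq_one.1 hcard
    have hcQ : c ∈ Q := hS (mem_singleton_self c)
    have hca : c ≠ a := fun h => hSa (by rw [h])
    have hcb : c ≠ b := fun h => hSb (by rw [h])
    have h5 := hν' a
    have h6 := hν' b
    simp only [mem_sdiff, mem_singleton, ha, hb, hca.symm, hcb.symm, hab.symm, not_true,
      not_false_iff, and_true, and_false, if_true, if_false] at h5 h6
    -- Taking the `Z` term at a third vertex `c` leaves equal exponents at `a` and `b`, impossible
    -- in a clique.
    exact hab (clique_injOn hQ hor hne' ha hb (by omega))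
  have hA : coeff m (arcPoly R E' * ((-1) ^ #({a} : Finset V)
      * (∏ v ∈ Q \ {a}, (X v : MvPolynomial V R)) * ∏ v ∈ ({a} : Finset V), C (Z v))) = - Z a := by
    rw [hterm, if_pos (by rw [hm]; exact le_add_self), hm, add_tsub_cancel_right,
      coeff_arcPoly_cast, hμ1]
    simp
  have hB : coeff m (arcPoly R E' * ((-1) ^ #({b} : Finset V)
      * (∏ v ∈ Q \ {b}, (X v : MvPolynomial V R)) * ∏ v ∈ ({b} : Finset V), C (Z v))) = Z b := by
    -- The same monomial seen from `b`: the tournament with `a` and `b` exchanged, whose coefficient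
    -- is -1.
    have h5 : m = μ.mapDomain (Equiv.swap a b) + ∑ w ∈ Q \ {b}, Finsupp.single w 1 := by
      ext v
      rw [hma, Finsupp.add_apply, hone, mapDomain_swap_apply]
      by_cases hva : v = a
      · subst hva; rw [Equiv.swap_apply_left]; simp [ha, hab]; omega
      by_cases hvb : v = b
      · subst hvb; rw [Equiv.swap_apply_right]; simp [hb, hab.symm]; omega
      rw [Equiv.swap_apply_of_ne_of_ne hva hvb]
      simp [hva, hvb]
    rw [hterm, if_pos (by rw [h5]; exact le_add_self), h5, add_tsub_cancel_right,
      coeff_arcPoly_cast, coeff_swap_eq_neg hHab (within_swap hQ ha hb) hor, hμ1]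
    simp
  rw [h3 R, mul_assoc, coeff_C_mul, prod_sub, mul_sum, coeff_sum, sum_eq_add {a} {b}, hA, hB]
  · push_cast
    ring
  · exact fun h => hab (singleton_injective h)
  · intro S hS hne
    exact hzero S (mem_powerset.1 hS) hne.1 hne.2
  · intro h
    exact absurd (mem_powerset.2 (singleton_subset_iff.2 ha)) h
  · intro h
    exact absurd (mem_powerset.2 (singleton_subset_iff.2 hb)) h

variable {G : SimpleGraph V} [DecidableRel G.Adj] {k : ℕ}

/-- A single vertex of smaller degree is reducible: it has no inner arcs and can send all its edges
outwards. -/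
theorem IsATCritical.le_degree (hG : IsATCritical G k) (hk : 0 < k) (v : V) :
    k - 1 ≤ G.degree v := by
  by_contra h
  have h1 : arcPoly ℤ (∅ : Finset (V × V)) = 1 := prod_empty
  refine hG.not_reducible hk (X := {v}) (singleton_nonempty v) (E := ∅) ⟨fun a b => ?_, by simp⟩
    (m := 0) ?_ ?_
  · simp only [within, mem_singleton, notMem_empty, or_self, iff_false]
    rintro ⟨h', rfl, rfl⟩
    exact h'.ne rfl
  · rw [h1]; simp
  · intro w hw
    rw [mem_singleton] at hw
    subst hw
    simp only [Finsupp.coe_zero, Pi.zero_apply]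
    omega

/-- On a proper subset, k clique vertices would need k distinct exponents below k - 1. A spanning
clique on k vertices makes `G` complete. -/
theorem IsATCritical.card_clique_lt (hG : IsATCritical G k) (hk : 0 < k)
    (hne : ¬ Nonempty (G ≃g (⊤ : SimpleGraph (Fin k)))) {S : Finset V}
    (hS : G.IsClique (S : Set V)) : #S < k := by
  by_contra hcard
  obtain ⟨T, hTS, hT⟩ := exists_subset_card_eq (not_lt.1 hcard)
  have hTc : G.IsClique (T : Set V) := hS.subset (by exact_mod_cast hTS)
  by_cases hU : T = univ
  · apply hne
    rw [hU, card_univ] at hT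
    let f := Fintype.equivFinOfCardEq hT
    refine ⟨⟨f, ?_⟩⟩
    intro a b
    simp only [SimpleGraph.top_adj, ne_eq, EmbeddingLike.apply_eq_iff_eq]
    constructor
    · intro h
      exact hTc (by rw [hU]; exact mem_coe.2 (mem_univ a)) (by rw [hU]; exact mem_coe.2 (mem_univ b)) h
    · exact fun h => h.ne
  · obtain ⟨E, hE, m, hm, hlt⟩ := hG.exists_coeff_of_ne_top hU
    have h1 := clique_injOn hTc hE hm
    have h2 : #(T.image m) = #T := card_image_of_injOn h1
    have h3 : T.image m ⊆ range (k - 1) := by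
      intro x hx
      obtain ⟨v, hv, rfl⟩ := mem_image.1 hx
      exact mem_range.2 (hlt v hv)
    have h4 := card_le_card h3
    rw [card_range] at h4
    omega

end

end AlonTarsi

/-! ### Even cycles with at most one chord on low vertices -/

namespace AlonTarsi

open Finset MvPolynomial

universe u

section

variable {V : Type u} [Fintype V] [DecidableEq V]

theorem outs_add_ins {G : SimpleGraph V} [DecidableRel G.Adj] {X : Finset V} {E : Finset (V × V)}
    (hE : Orients E (within G X)) {v : V} (hv : v ∈ X) : outs E v + ins E v = #(nb G X v) := by
  have h1 : outs E v = #((nb G X v).filter fun w => (v, w) ∈ E) := by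
    refine card_bij (fun e _ => e.2) ?_ ?_ ?_
    · rintro ⟨a, b⟩ he
      obtain ⟨he', h⟩ := mem_filter.1 he
      simp only at h
      subst h
      have := (hE.1 a b).2 (Or.inl he')
      exact mem_filter.2 ⟨mem_filter.2 ⟨this.2.2, this.1⟩, he'⟩
    · rintro ⟨a, b⟩ he ⟨a', b'⟩ he' h0
      have h8 := (mem_filter.1 he).2
      have h9 := (mem_filter.1 he').2
      simp only at h0 h8 h9
      rw [h0, h8, h9]
    · intro w hw
      exact ⟨(v, w), mem_filter.2 ⟨(mem_filter.1 hw).2, rfl⟩, rfl⟩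
  have h2 : ins E v = #((nb G X v).filter fun w => ¬ (v, w) ∈ E) := by
    refine card_bij (fun e _ => e.1) ?_ ?_ ?_
    · rintro ⟨a, b⟩ he
      obtain ⟨he', h⟩ := mem_filter.1 he
      simp only at h
      subst h
      have := (hE.1 a b).2 (Or.inl he')
      exact mem_filter.2 ⟨mem_filter.2 ⟨this.2.1, this.1.symm⟩, hE.2 _ _ he'⟩
    · rintro ⟨a, b⟩ he ⟨a', b'⟩ he' h0
      have h8 := (mem_filter.1 he).2
      have h9 := (mem_filter.1 he').2
      simp only at h0 h8 h9
      rw [h0, h8, h9]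
    · intro w hw
      obtain ⟨hw, hn⟩ := mem_filter.1 hw
      obtain ⟨hw, ha⟩ := mem_filter.1 hw
      exact ⟨(w, v), mem_filter.2 ⟨((hE.1 v w).1 ⟨ha, hv, hw⟩).resolve_left hn, rfl⟩, rfl⟩
  rw [h1, h2, card_filter_add_card_filter_not]

theorem outs_eq_ite {S : Finset (V × V)} {v : V} {a : V × V} (ha : a.1 = v)
    (h : ∀ e ∈ S, e.1 = v → e = a) : outs S v = if a ∈ S then 1 else 0 := by
  split_ifs with h0
  · rw [outs, card_eq_one]
    refine ⟨a, ?_⟩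
    ext e
    rw [mem_filter, mem_singleton]
    exact ⟨fun he => h e he.1 he.2, by rintro rfl; exact ⟨h0, ha⟩⟩
  · rw [outs, card_eq_zero, filter_eq_empty_iff]
    intro e he hv
    exact h0 (h e he hv ▸ he)

theorem ins_eq_ite {S : Finset (V × V)} {v : V} {b c : V × V} (hb : b.2 = v) (hc : c.2 = v)
    (hbc : b ≠ c) (h : ∀ e ∈ S, e.2 = v → e = b ∨ e = c) :
    ins S v = (if b ∈ S then 1 else 0) + if c ∈ S then 1 else 0 := by
  have : {e ∈ S | e.2 = v} = ({b, c} : Finset _).filter fun e => e ∈ S := by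
    ext e
    simp only [mem_filter, mem_insert, mem_singleton]
    constructor
    · rintro ⟨h1, h2⟩
      exact ⟨h e h1 h2, h1⟩
    · rintro ⟨rfl | rfl, h1⟩
      · exact ⟨h1, hb⟩
      · exact ⟨h1, hc⟩
  rw [ins, this, card_filter, sum_pair hbc]

/-- Conservation of flow at a vertex with one possible in-arc; `flow_iff_or` treats two. Both serve
to trace eulerian subsets along a path. -/
theorem flow_iff {S : Finset (V × V)} {v : V} {a b : V × V} (h : outs S v = ins S v)
    (ha : a.1 = v) (hb : b.2 = v) (h1 : ∀ e ∈ S, e.1 = v → e = a)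
    (h2 : ∀ e ∈ S, e.2 = v → e = b) : a ∈ S ↔ b ∈ S := by
  have h3 : ins S v = if b ∈ S then 1 else 0 := by
    split_ifs with h0
    · rw [ins, card_eq_one]
      refine ⟨b, ?_⟩
      ext e
      rw [mem_filter, mem_singleton]
      exact ⟨fun he => h2 e he.1 he.2, by rintro rfl; exact ⟨h0, hb⟩⟩
    · rw [ins, card_eq_zero, filter_eq_empty_iff]
      intro e he hv
      exact h0 (h2 e he hv ▸ he)
  rw [outs_eq_ite ha h1, h3] at h
  split_ifs at h <;> simp_all

theorem flow_iff_or {S : Finset (V × V)} {v : V} {a b c : V × V} (h : outs S v = ins S v)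
    (ha : a.1 = v) (hb : b.2 = v) (hc : c.2 = v) (hbc : b ≠ c) (h1 : ∀ e ∈ S, e.1 = v → e = a)
    (h2 : ∀ e ∈ S, e.2 = v → e = b ∨ e = c) :
    (a ∈ S ↔ b ∈ S ∨ c ∈ S) ∧ ¬ (b ∈ S ∧ c ∈ S) := by
  rw [outs_eq_ite ha h1, ins_eq_ite hb hc hbc h2] at h
  split_ifs at h <;> simp_all

/-- `p 0, …, p m` is an induced path of `G`. -/
def IndPath (G : SimpleGraph V) (p : ℕ → V) (m : ℕ) : Prop :=
  (∀ i ≤ m, ∀ j ≤ m, p i = p j → i = j) ∧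
    ∀ i ≤ m, ∀ j ≤ m, G.Adj (p i) (p j) ↔ i + 1 = j ∨ j + 1 = i

variable {G : SimpleGraph V} [DecidableRel G.Adj] {k : ℕ}

-- The cycle `x, p 0, …, p m` is oriented cyclically and the possible chord from `x` to `p j`.
-- Besides the empty set and the cycle, both even, there is at most one more eulerian subset, the
-- one through the chord, so the signed count is positive. Every vertex has an in-arc, so the
-- out-degrees fit the budgets of low vertices.
set_option maxHeartbeats 1000000 in
theorem IsATCritical.no_even_aux (hG : IsATCritical G k) (hk : 0 < k) {x : V} {p : ℕ → V} {m : ℕ}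
    (hp : IndPath G p m) (hm : Even m) (hm2 : 2 ≤ m) (hx : ∀ i ≤ m, p i ≠ x)
    (h0 : G.Adj x (p 0)) (h1 : G.Adj x (p m)) {j : ℕ} (hj0 : 0 < j) (hjm : j < m)
    (hj : ∀ i, 0 < i → i < m → G.Adj x (p i) → i = j)
    (hlx : G.degree x = k - 1) (hlp : ∀ i ≤ m, G.degree (p i) = k - 1) : False := by
  have inj := hp.1
  have adj := hp.2
  set C : Finset (V × V) := (range m).image (fun i => (p i, p (i + 1))) ∪ {(x, p 0), (p m, x)}
    with hC
  set E : Finset (V × V) := C ∪ if G.Adj x (p j) then {(x, p j)} else ∅ with hE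
  set X : Finset V := insert x ((range (m + 1)).image p) with hX
  have memC : ∀ e, e ∈ C ↔ (∃ i < m, e = (p i, p (i + 1))) ∨ e = (x, p 0) ∨ e = (p m, x) := by
    intro e
    simp only [hC, mem_union, mem_image, mem_range, mem_insert, mem_singleton, eq_comm]
  have memE : ∀ e, e ∈ E ↔ (∃ i < m, e = (p i, p (i + 1))) ∨ e = (x, p 0) ∨ e = (p m, x) ∨
      (e = (x, p j) ∧ G.Adj x (p j)) := by
    intro e
    rw [hE, mem_union, memC, or_assoc, or_assoc]
    split_ifs with h <;> simp [h]
  have memX : ∀ v, v ∈ X ↔ v = x ∨ ∃ i ≤ m, v = p i := by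
    intro v
    simp only [hX, mem_insert, mem_image, mem_range, Nat.lt_succ_iff, eq_comm]
  have out_p : ∀ i < m, ∀ e ∈ E, e.1 = p i → e = (p i, p (i + 1)) := by
    intro i hi e he hv
    rcases (memE e).1 he with ⟨l, hl, rfl⟩ | rfl | rfl | ⟨rfl, -⟩
    · rw [inj l hl.le i hi.le hv]
    · exact absurd hv.symm (hx i hi.le)
    · exact absurd (inj m le_rfl i hi.le hv) hi.ne'
    · exact absurd hv.symm (hx i hi.le)
  have out_m : ∀ e ∈ E, e.1 = p m → e = (p m, x) := by
    intro e he hv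
    rcases (memE e).1 he with ⟨l, hl, rfl⟩ | rfl | rfl | ⟨rfl, -⟩
    · exact absurd (inj l hl.le m le_rfl hv) hl.ne
    · exact absurd hv.symm (hx m le_rfl)
    · rfl
    · exact absurd hv.symm (hx m le_rfl)
  have in_0 : ∀ e ∈ E, e.2 = p 0 → e = (x, p 0) := by
    intro e he hv
    rcases (memE e).1 he with ⟨l, hl, rfl⟩ | rfl | rfl | ⟨rfl, -⟩
    · exact absurd (inj (l + 1) hl 0 (Nat.zero_le _) hv) (Nat.succ_ne_zero l)
    · rfl
    · exact absurd hv.symm (hx 0 (Nat.zero_le _))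
    · exact absurd (inj j hjm.le 0 (Nat.zero_le _) hv) hj0.ne'
  have in_p : ∀ i < m, i + 1 ≠ j → ∀ e ∈ E, e.2 = p (i + 1) → e = (p i, p (i + 1)) := by
    intro i hi hij e he hv
    rcases (memE e).1 he with ⟨l, hl, rfl⟩ | rfl | rfl | ⟨rfl, -⟩
    · have := inj (l + 1) hl (i + 1) hi hv
      rw [Nat.succ_injective this]
    · exact absurd (inj 0 (Nat.zero_le _) (i + 1) hi hv) (Nat.succ_ne_zero i).symm
    · exact absurd hv.symm (hx (i + 1) hi)
    · exact absurd (inj j hjm.le (i + 1) hi hv).symm hij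
  have in_j : ∀ i, i + 1 = j → ∀ e ∈ E, e.2 = p j → e = (p i, p (i + 1)) ∨ e = (x, p j) := by
    intro i hij e he hv
    rcases (memE e).1 he with ⟨l, hl, rfl⟩ | rfl | rfl | ⟨rfl, -⟩
    · have := inj (l + 1) hl j hjm.le hv
      left
      rw [show l = i by omega]
    · exact absurd (inj 0 (Nat.zero_le _) j hjm.le hv) hj0.ne
    · exact absurd hv.symm (hx j hjm.le)
    · exact Or.inr rfl
  have hor : Orients E (within G X) := by
    have hadj : ∀ e ∈ E, (within G X).Adj e.1 e.2 := by
      intro e he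
      rcases (memE e).1 he with ⟨l, hl, rfl⟩ | rfl | rfl | ⟨rfl, h⟩
      · exact ⟨(adj l hl.le (l + 1) hl).2 (Or.inl rfl), (memX _).2 (Or.inr ⟨l, hl.le, rfl⟩),
          (memX _).2 (Or.inr ⟨l + 1, hl, rfl⟩)⟩
      · exact ⟨h0, (memX _).2 (Or.inl rfl), (memX _).2 (Or.inr ⟨0, Nat.zero_le _, rfl⟩)⟩
      · exact ⟨h1.symm, (memX _).2 (Or.inr ⟨m, le_rfl, rfl⟩), (memX _).2 (Or.inl rfl)⟩
      · exact ⟨h, (memX _).2 (Or.inl rfl), (memX _).2 (Or.inr ⟨j, hjm.le, rfl⟩)⟩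
    have hxp : ∀ i ≤ m, G.Adj x (p i) → (x, p i) ∈ E ∨ (p i, x) ∈ E := by
      intro i hi h
      rcases Nat.eq_zero_or_pos i with rfl | hi0
      · exact Or.inl ((memE _).2 (Or.inr (Or.inl rfl)))
      rcases hi.eq_or_lt with rfl | him
      · exact Or.inr ((memE _).2 (Or.inr (Or.inr (Or.inl rfl))))
      · have := hj i hi0 him h
        subst this
        exact Or.inl ((memE _).2 (Or.inr (Or.inr (Or.inr ⟨rfl, h⟩))))
    refine ⟨fun u v => ⟨fun h => ?_, ?_⟩, fun u v h h' => ?_⟩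
    · obtain ⟨h, hu, hv⟩ := h
      rcases (memX u).1 hu with rfl | ⟨i, hi, rfl⟩
      · rcases (memX v).1 hv with rfl | ⟨i, hi, rfl⟩
        · exact absurd rfl h.ne
        · exact hxp i hi h
      · rcases (memX v).1 hv with rfl | ⟨l, hl, rfl⟩
        · exact (hxp i hi h.symm).symm
        · rcases (adj i hi l hl).1 h with rfl | rfl
          · exact Or.inl ((memE _).2 (Or.inl ⟨i, hl, rfl⟩))
          · exact Or.inr ((memE _).2 (Or.inl ⟨l, hi, rfl⟩))
    · rintro (h | h)
      · exact hadj _ h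
      · exact (hadj _ h).symm
    · have key : ∀ i < m, (p (i + 1), p i) ∉ E := by
        intro i hi h
        rcases Nat.lt_or_ge (i + 1) m with h2 | h2
        · have := (Prod.mk.inj (out_p (i + 1) h2 _ h rfl)).2
          have := inj _ hi.le _ (by omega) this
          omega
        · have : i + 1 = m := by omega
          rw [this] at h
          exact hx i hi.le (Prod.mk.inj (out_m _ h rfl)).2
      rcases (memE _).1 h with ⟨l, hl, h2⟩ | h2 | h2 | ⟨h2, -⟩
      · obtain ⟨rfl, rfl⟩ := Prod.mk.inj h2
        exact key l hl h'
      · obtain ⟨rfl, rfl⟩ := Prod.mk.inj h2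
        exact hx 1 (by omega) (Prod.mk.inj (out_p 0 (by omega) _ h' rfl)).2.symm
      · obtain ⟨rfl, rfl⟩ := Prod.mk.inj h2
        rcases (memE _).1 h' with ⟨l, hl, h3⟩ | h3 | h3 | ⟨h3, -⟩
        · exact hx l hl.le (Prod.mk.inj h3).1.symm
        · have := inj _ le_rfl _ (Nat.zero_le _) (Prod.mk.inj h3).2
          omega
        · exact hx m le_rfl (Prod.mk.inj h3).2
        · have := inj _ le_rfl _ hjm.le (Prod.mk.inj h3).2
          omega
      · obtain ⟨rfl, rfl⟩ := Prod.mk.inj h2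
        exact hx (j + 1) (by omega) (Prod.mk.inj (out_p j hjm _ h' rfl)).2.symm
  have hCE : C ⊆ E := subset_union_left
  have hCout : ∀ i < m, (p i, p (i + 1)) ∈ C := fun i hi => (memC _).2 (Or.inl ⟨i, hi, rfl⟩)
  have hC0 : (x, p 0) ∈ C := (memC _).2 (Or.inr (Or.inl rfl))
  have hCm : (p m, x) ∈ C := (memC _).2 (Or.inr (Or.inr rfl))
  -- the structure of eulerian subsets
  have struct : ∀ S ⊆ E, (∀ v, outs S v = ins S v) →
      (¬ ((x, p 0) ∈ S ∧ (x, p j) ∈ S)) ∧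
      ((p m, x) ∈ S ↔ (x, p 0) ∈ S ∨ (x, p j) ∈ S) ∧
      (∀ i < m, (p i, p (i + 1)) ∈ S ↔ (x, p 0) ∈ S ∨ (j ≤ i ∧ (x, p j) ∈ S)) := by
    intro S hS heul
    have A : ∀ i < j, ((p i, p (i + 1)) ∈ S ↔ (x, p 0) ∈ S) := by
      intro i
      induction i with
      | zero =>
        intro _
        exact flow_iff (heul (p 0)) rfl rfl (fun e he => out_p 0 (by omega) e (hS he))
          (fun e he => in_0 e (hS he))
      | succ i ih =>
        intro hi
        rw [← ih (by omega)]
        exact flow_iff (heul (p (i + 1))) rfl rfl (fun e he => out_p (i + 1) (by omega) e (hS he))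
          (fun e he => in_p i (by omega) (by omega) e (hS he))
    obtain ⟨l, rfl⟩ : ∃ l, j = l + 1 := ⟨j - 1, by omega⟩
    have B := flow_iff_or (heul (p (l + 1))) (a := (p (l + 1), p (l + 1 + 1)))
      (b := (p l, p (l + 1))) (c := (x, p (l + 1))) rfl rfl rfl
      (fun h => hx l (by omega) (Prod.mk.inj h).1) (fun e he => out_p (l + 1) hjm e (hS he))
      (fun e he => in_j l rfl e (hS he))
    rw [A l (by omega)] at B
    have D : ∀ i, l + 1 ≤ i → i < m →
        ((p i, p (i + 1)) ∈ S ↔ (x, p 0) ∈ S ∨ (x, p (l + 1)) ∈ S) := by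
      intro i hi
      induction i, hi using Nat.le_induction with
      | base => intro _; exact B.1
      | succ i hi ih =>
        intro him
        rw [← ih (by omega)]
        exact flow_iff (heul (p (i + 1))) rfl rfl (fun e he => out_p (i + 1) (by omega) e (hS he))
          (fun e he => in_p i (by omega) (by omega) e (hS he))
    refine ⟨B.2, ?_, fun i hi => ?_⟩
    · obtain ⟨q, rfl⟩ : ∃ q, m = q + 1 := ⟨m - 1, by omega⟩
      rw [← D q (by omega) (by omega)]
      exact flow_iff (heul (p (q + 1))) rfl rfl (fun e he => out_m e (hS he))
          (fun e he => in_p q (by omega) (by omega) e (hS he))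
    · rcases Nat.lt_or_ge i (l + 1) with h | h
      · rw [A i h]
        constructor
        · exact Or.inl
        · rintro (h' | h')
          · exact h'
          · omega
      · rw [D i h hi]
        simp [h]
  -- the coefficient
  have hcoef : coeff (arcExp E ∅) (arcPoly ℤ E) ≠ 0 := by
    rw [coeff_arcPoly]
    set T := E.powerset.filter fun S => arcExp E S = arcExp E ∅ with hT
    have memT : ∀ S, S ∈ T ↔ S ⊆ E ∧ ∀ v, outs S v = ins S v := by
      intro S
      rw [hT, mem_filter, mem_powerset]
      exact and_congr_right fun h => arcExp_eq_empty_iff h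
    -- An eulerian subset is determined by which of the arcs `(x, p 0)` and `(x, p j)` it contains,
    -- and it cannot contain both.
    have hcard : #T ≤ 3 := by
      have hle : #T ≤ #({(true, false), (false, true), (false, false)} : Finset (Bool × Bool)) := by
        refine card_le_card_of_injOn (fun S => (decide ((x, p 0) ∈ S), decide ((x, p j) ∈ S)))
          ?_ ?_
        · intro S hS
          have h2 := (struct S ((memT S).1 hS).1 ((memT S).1 hS).2).1
          by_cases ha : (x, p 0) ∈ S
          · have hb : (x, p j) ∉ S := fun hb => h2 ⟨ha, hb⟩
            simp [ha, hb]
          · by_cases hb : (x, p j) ∈ S <;> simp [ha, hb]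
        · intro S hS S' hS' h
          simp only [Prod.mk.injEq, decide_eq_decide] at h
          have hS := (memT S).1 hS
          have hS' := (memT S').1 hS'
          have h2 := struct S hS.1 hS.2
          have h3 := struct S' hS'.1 hS'.2
          have key : ∀ e ∈ E, e ∈ S ↔ e ∈ S' := by
            intro e he
            rcases (memE e).1 he with ⟨i, hi, rfl⟩ | rfl | rfl | ⟨rfl, -⟩
            · rw [h2.2.2 i hi, h3.2.2 i hi, h.1, h.2]
            · exact h.1
            · rw [h2.2.1, h3.2.1, h.1, h.2]
            · exact h.2
          ext e
          exact ⟨fun he => (key e (hS.1 he)).1 he, fun he => (key e (hS'.1 he)).2 he⟩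
      exact hle.trans (by decide)
    have hEmp : ∅ ∈ T := (memT _).2 ⟨empty_subset _, fun v => rfl⟩
    have hCT : C ∈ T := by
      refine (memT _).2 ⟨hCE, fun v => ?_⟩
      by_cases hv : v ∈ X
      · rcases (memX v).1 hv with rfl | ⟨i, hi, rfl⟩
        · have e1 : outs C v = 1 := by
            rw [outs_eq_ite (a := (v, p 0)) rfl, if_pos hC0]
            intro e he hv
            rcases (memC e).1 he with ⟨l, hl, rfl⟩ | rfl | rfl
            · exact absurd hv (hx l hl.le)
            · rfl
            · exact absurd hv (hx m le_rfl)
          have e2 : ins C v = 1 := by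
            -- The loop stands in for the second in-arc that the lemma expects; loops are never
            -- arcs.
            rw [ins_eq_ite (b := (p m, v)) (c := (v, v)) rfl rfl
              (fun h => hx m le_rfl (Prod.mk.inj h).1), if_pos hCm, if_neg]
            · exact fun h => hor.ne (hCE h) rfl
            · intro e he hv
              rcases (memC e).1 he with ⟨l, hl, rfl⟩ | rfl | rfl
              · exact absurd hv (hx (l + 1) hl)
              · exact absurd hv (hx 0 (Nat.zero_le _))
              · exact Or.inl rfl
          rw [e1, e2]
        · have e1 : outs C (p i) = 1 := by
            rcases hi.eq_or_lt with rfl | him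
            · rw [outs_eq_ite (a := (p i, x)) rfl (fun e he => out_m e (hCE he)), if_pos hCm]
            · rw [outs_eq_ite (a := (p i, p (i + 1))) rfl (fun e he => out_p i him e (hCE he)),
                if_pos (hCout i him)]
          have e2 : ins C (p i) = 1 := by
            rcases i with _ | i
            · rw [ins_eq_ite (b := (x, p 0)) (c := (p 0, p 0)) rfl rfl
                (fun h => hx 0 (Nat.zero_le _) (Prod.mk.inj h).1.symm), if_pos hC0, if_neg]
              · exact fun h => hor.ne (hCE h) rfl
              · exact fun e he hv => Or.inl (in_0 e (hCE he) hv)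
            · rw [ins_eq_ite (b := (p i, p (i + 1))) (c := (x, p (i + 1))) rfl rfl
                (fun h => hx i (by omega) (Prod.mk.inj h).1), if_pos (hCout i hi), if_neg]
              · intro h
                rcases (memC _).1 h with ⟨l, hl, h2⟩ | h2 | h2
                · exact hx l hl.le (Prod.mk.inj h2).1.symm
                · have := inj _ hi _ (Nat.zero_le _) (Prod.mk.inj h2).2
                  omega
                · exact hx m le_rfl (Prod.mk.inj h2).1.symm
              · intro e he hv
                by_cases hij : i + 1 = j
                · rcases in_j i hij e (hCE he) (by rw [← hij]; exact hv) with h | h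
                  · exact Or.inl h
                  · right; rw [h, hij]
                · exact Or.inl (in_p i hi hij e (hCE he) hv)
          rw [e1, e2]
      · have e1 : outs C v = 0 := by
          rw [outs, card_eq_zero, filter_eq_empty_iff]
          rintro e he rfl
          exact hv (hor.adj (hCE he)).2.1
        have e2 : ins C v = 0 := by
          rw [ins, card_eq_zero, filter_eq_empty_iff]
          rintro e he rfl
          exact hv (hor.adj (hCE he)).2.2
        rw [e1, e2]
    have hCcard : Even #C := by
      have h2 : #((range m).image (fun i => (p i, p (i + 1)))) = m := by
        rw [card_image_of_injOn, card_range]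
        intro a ha b hb h
        have ha := mem_range.1 (mem_coe.1 ha)
        have hb := mem_range.1 (mem_coe.1 hb)
        exact inj a ha.le b hb.le (Prod.mk.inj h).1
      have h3 : #({(x, p 0), (p m, x)} : Finset (V × V)) = 2 :=
        card_pair fun h => hx 0 (Nat.zero_le _) (Prod.mk.inj h).2
      rw [hC, card_union_of_disjoint, h2, h3]
      · exact hm.add even_two
      · rw [disjoint_left]
        intro e he he'
        obtain ⟨i, hi, rfl⟩ := mem_image.1 he
        have hi := mem_range.1 hi
        rw [mem_insert, mem_singleton] at he'
        rcases he' with h | h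
        · exact hx i hi.le (Prod.mk.inj h).1
        · exact hx (i + 1) hi (Prod.mk.inj h).2
    have hCne : C ≠ ∅ := ne_empty_of_mem hC0
    have hCT' : C ∈ T.erase ∅ := mem_erase.2 ⟨hCne, hCT⟩
    rw [← add_sum_erase _ _ hEmp, ← add_sum_erase _ _ hCT', hCcard.neg_one_pow, card_empty, pow_zero]
    have h4 : #((T.erase ∅).erase C) ≤ 1 := by
      rw [card_erase_of_mem hCT', card_erase_of_mem hEmp]
      omega
    have h5 : -1 ≤ ∑ S ∈ (T.erase ∅).erase C, (-1 : ℤ) ^ #S := by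
      have h6 : ∑ S ∈ (T.erase ∅).erase C, (-1 : ℤ) ≤ ∑ S ∈ (T.erase ∅).erase C, (-1 : ℤ) ^ #S :=
        sum_le_sum fun S _ => by rcases neg_one_pow_eq_or ℤ #S with h | h <;> rw [h]; norm_num
      rw [sum_const, smul_neg, nsmul_one] at h6
      have : ((#((T.erase ∅).erase C) : ℕ) : ℤ) ≤ 1 := by exact_mod_cast h4
      omega
    omega
  refine hG.not_reducible hk ⟨x, (memX x).2 (Or.inl rfl)⟩ hor hcoef fun v hv => ?_
  rw [← outs_add_ins hor hv, arcExp_empty_apply]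
  have hd : G.degree v = k - 1 := by
    rcases (memX v).1 hv with rfl | ⟨i, hi, rfl⟩
    · exact hlx
    · exact hlp i hi
  have hin : 0 < ins E v := by
    rw [ins, card_pos]
    rcases (memX v).1 hv with rfl | ⟨i, hi, rfl⟩
    · exact ⟨(p m, v), mem_filter.2 ⟨hCE hCm, rfl⟩⟩
    · rcases i with _ | i
      · exact ⟨(x, p 0), mem_filter.2 ⟨hCE hC0, rfl⟩⟩
      · exact ⟨(p i, p (i + 1)), mem_filter.2 ⟨hCE (hCout i hi), rfl⟩⟩
  omega

/-- In a critical graph there is no induced even cycle with at most one chord on low vertices. -/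
theorem IsATCritical.no_even (hG : IsATCritical G k) (hk : 0 < k) {x : V} {p : ℕ → V} {m : ℕ}
    (hp : IndPath G p m) (hm : Even m) (hm2 : 2 ≤ m) (hx : ∀ i ≤ m, p i ≠ x)
    (h0 : G.Adj x (p 0)) (h1 : G.Adj x (p m)) {j : ℕ}
    (hj : ∀ i, 0 < i → i < m → G.Adj x (p i) → i = j)
    (hlx : G.degree x = k - 1) (hlp : ∀ i ≤ m, G.degree (p i) = k - 1) : False := by
  by_cases h : 0 < j ∧ j < m
  · exact hG.no_even_aux hk hp hm hm2 hx h0 h1 h.1 h.2 hj hlx hlp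
  -- Here `x` has no inner neighbour on the path, so any inner index may serve as `j`.
  · refine hG.no_even_aux hk hp hm hm2 hx h0 h1 (j := 1) one_pos (by omega)
      (fun i hi him hadj => ?_) hlx hlp
    have := hj i hi him hadj
    subst this
    exact absurd ⟨hi, him⟩ h

end

end AlonTarsi

/-! ### Blocks without such even cycles are cliques or odd cycles -/

namespace AlonTarsi

open Finset

universe u

section

variable {V : Type u} [Fintype V] [DecidableEq V] {G : SimpleGraph V} [DecidableRel G.Adj]

/-- Every vertex reachable inside `S` is reachable by an induced path. -/
theorem exists_indPath {S : Finset V} {a b : V} (ha : a ∈ S)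
    (h : Relation.ReflTransGen (fun u v => G.Adj u v ∧ v ∈ S) a b) :
    ∃ p m, IndPath G p m ∧ p 0 = a ∧ p m = b ∧ ∀ i ≤ m, p i ∈ S := by
  classical
  let W : ℕ → Prop := fun n => ∃ p : ℕ → V, p 0 = a ∧ p n = b ∧
    (∀ i < n, G.Adj (p i) (p (i + 1))) ∧ ∀ i ≤ n, p i ∈ S
  have hW : ∃ n, W n := by
    induction h with
    | refl => exact ⟨0, fun _ => a, rfl, rfl, fun i hi => absurd hi (Nat.not_lt_zero i), fun _ _ => ha⟩
    | @tail b c _ hbc ih =>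
      obtain ⟨n, p, h0, hn, hadj, hS⟩ := ih
      refine ⟨n + 1, fun i => if i ≤ n then p i else c, by simp [h0], by simp, fun i hi => ?_,
        fun i hi => ?_⟩
      · by_cases h1 : i + 1 ≤ n
        · simp only [h1, show i ≤ n by omega, if_true]
          exact hadj i h1
        · have : i = n := by omega
          subst this
          simp [hn, hbc.1]
      · by_cases h1 : i ≤ n
        · simp only [h1, if_true]; exact hS i h1
        · simp only [h1, if_false]; exact hbc.2
  -- A shortest walk is an induced path: a chord or a repetition would shorten it.
  set m := Nat.find hW with hm
  obtain ⟨p, h0, hpm, hadj, hS⟩ := Nat.find_spec hW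
  have hmin : ∀ n, n < m → ¬ W n := fun n hn => Nat.find_min hW hn
  have short : ∀ i d, 0 < d → i + 1 + d ≤ m → ¬ G.Adj (p i) (p (i + 1 + d)) := by
    intro i d hd hle hadj'
    refine hmin (m - d) (by omega) ⟨fun t => if t ≤ i then p t else p (t + d), by simp [h0], ?_, ?_, ?_⟩
    · simp only [show ¬ (m - d ≤ i) by omega, if_false, show m - d + d = m by omega, hpm]
      exact hpm
    · intro t ht
      rcases lt_trichotomy t i with h1 | h1 | h1
      · simp only [show t ≤ i by omega, show t + 1 ≤ i by omega, if_true]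
        exact hadj t (by omega)
      · subst h1
        simpa using hadj'
      · simp only [show ¬ t ≤ i by omega, show ¬ t + 1 ≤ i by omega, if_false]
        rw [show t + 1 + d = t + d + 1 by omega]
        exact hadj (t + d) (by omega)
    · intro t ht
      by_cases h1 : t ≤ i
      · simp only [h1, if_true]; exact hS t (by omega)
      · simp only [h1, if_false]; exact hS (t + d) (by omega)
  have inj : ∀ i j, i < j → j ≤ m → p i ≠ p j := by
    intro i j hij hj heq
    rcases hj.eq_or_lt with rfl | hjm
    · exact hmin i hij ⟨p, h0, heq.trans hpm, fun t ht => hadj t (by omega),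
        fun t ht => hS t (by omega)⟩
    · refine short i (j - i) (by omega) (by omega) ?_
      rw [heq, show i + 1 + (j - i) = j + 1 by omega]
      exact hadj j hjm
  refine ⟨p, m, ⟨fun i hi j hj heq => ?_, fun i hi j hj => ⟨fun h1 => ?_, ?_⟩⟩, h0, hpm, hS⟩
  · rcases lt_trichotomy i j with h1 | h1 | h1
    · exact absurd heq (inj i j h1 hj)
    · exact h1
    · exact absurd heq.symm (inj j i h1 hi)
  · by_contra hne
    rcases lt_trichotomy i j with h2 | h2 | h2
    · refine short i (j - i - 1) (by omega) (by omega) ?_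
      rwa [show i + 1 + (j - i - 1) = j by omega]
    · subst h2
      exact h1.ne rfl
    · refine short j (i - j - 1) (by omega) (by omega) ?_
      rw [show j + 1 + (i - j - 1) = i by omega]
      exact h1.symm
  · rintro (rfl | rfl)
    · exact hadj i (by omega)
    · exact (hadj j (by omega)).symm

/-- The induced subgraph on `X` is not a union of two proper parts meeting in at most one vertex. -/
def NoSep (G : SimpleGraph V) (X : Finset V) : Prop :=
  ∀ X1 X2 : Finset V, X1 ∪ X2 = X → #(X1 ∩ X2) ≤ 1 →
    (∀ u ∈ X1, ∀ v ∈ X2, u ∉ X2 → v ∉ X1 → ¬ G.Adj u v) → X1 = X ∨ X2 = X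

/-- The set reached from `a` off `T`, enlarged by `T`, and the complement of the reached set meet
inside `T`; since `#T ≤ 1` they cannot separate `b` from `a`. -/
theorem NoSep.indPath {X T : Finset V} (h : NoSep G X) (hT : T ⊆ X) (hT1 : #T ≤ 1) {a b : V}
    (ha : a ∈ X \ T) (hb : b ∈ X \ T) :
    ∃ p m, IndPath G p m ∧ p 0 = a ∧ p m = b ∧ ∀ i ≤ m, p i ∈ X \ T := by
  classical
  apply exists_indPath ha
  let R := (X \ T).filter fun v => Relation.ReflTransGen (fun u v => G.Adj u v ∧ v ∈ X \ T) a v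
  have hRX : R ⊆ X \ T := filter_subset _ _
  have haR : a ∈ R := mem_filter.2 ⟨ha, Relation.ReflTransGen.refl⟩
  have h1 := h (R ∪ T) (X \ R) (by
      ext v
      have := @hRX v
      have := @hT v
      simp only [mem_union, mem_sdiff] at *
      tauto) (by
      refine (card_le_card ?_).trans hT1
      intro v hv
      simp only [mem_inter, mem_union, mem_sdiff] at hv
      tauto) (by
      intro u hu v hv huX hvR hadj
      simp only [mem_union, mem_sdiff, not_or] at hu hv huX hvR
      have huR : u ∈ R := by
        rcases hu with hu | hu
        · exact hu
        · by_contra h0; exact huX ⟨hT hu, h0⟩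
      have hvS : v ∈ X \ T := mem_sdiff.2 ⟨hv.1, hvR.2⟩
      exact hv.2 (mem_filter.2 ⟨hvS, (mem_filter.1 huR).2.tail ⟨hadj, hvS⟩⟩))
  rcases h1 with h1 | h1
  · have hb1 : b ∈ R ∪ T := by rw [h1]; exact (mem_sdiff.1 hb).1
    rcases mem_union.1 hb1 with h2 | h2
    · exact (mem_filter.1 h2).2
    · exact absurd h2 (mem_sdiff.1 hb).2
  · have : a ∈ X \ R := by rw [h1]; exact (mem_sdiff.1 ha).1
    exact absurd haR (mem_sdiff.1 this).2

/-- No induced even cycle with at most one chord on vertices of `X`. -/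
def NoEven (G : SimpleGraph V) (X : Finset V) : Prop :=
  ∀ (x : V) (p : ℕ → V) (m j : ℕ), IndPath G p m → Even m → 2 ≤ m → (∀ i ≤ m, p i ≠ x) →
    G.Adj x (p 0) → G.Adj x (p m) → (∀ i, 0 < i → i < m → G.Adj x (p i) → i = j) →
    x ∈ X → (∀ i ≤ m, p i ∈ X) → False

theorem NoEven.mono {X Y : Finset V} (h : NoEven G Y) (hXY : X ⊆ Y) : NoEven G X :=
  fun x p m j h1 h2 h3 h4 h5 h6 h7 h8 h9 =>
    h x p m j h1 h2 h3 h4 h5 h6 h7 (hXY h8) fun i hi => hXY (h9 i hi)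

theorem IndPath.shift {p : ℕ → V} {m : ℕ} (hp : IndPath G p m) {a l : ℕ} (h : a + l ≤ m) :
    IndPath G (fun t => p (a + t)) l := by
  refine ⟨fun i hi j hj heq => ?_, fun i hi j hj => ?_⟩
  · have := hp.1 (a + i) (by omega) (a + j) (by omega) heq
    omega
  · rw [hp.2 (a + i) (by omega) (a + j) (by omega)]
    omega

theorem IndPath.append {p q : ℕ → V} {a b : ℕ} (hp : IndPath G p a) (hq : IndPath G q b)
    (hpq : G.Adj (p a) (q 0)) (hne : ∀ i ≤ a, ∀ j ≤ b, p i ≠ q j)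
    (hadj : ∀ i ≤ a, ∀ j ≤ b, G.Adj (p i) (q j) → i = a ∧ j = 0) :
    IndPath G (fun t => if t ≤ a then p t else q (t - a - 1)) (a + b + 1) := by
  refine ⟨fun i hi j hj heq => ?_, fun i hi j hj => ?_⟩
  · by_cases h1 : i ≤ a <;> by_cases h2 : j ≤ a <;> simp only [h1, h2, if_true, if_false] at heq
    · exact hp.1 i h1 j h2 heq
    · exact absurd heq (hne i h1 _ (by omega))
    · exact absurd heq.symm (hne j h2 _ (by omega))
    · have := hq.1 _ (by omega) _ (by omega) heq
      omega
  · by_cases h1 : i ≤ a <;> by_cases h2 : j ≤ a <;> simp only [h1, h2, if_true, if_false]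
    · exact hp.2 i h1 j h2
    · constructor
      · intro h
        have := hadj i h1 _ (by omega) h
        omega
      · intro h
        have h3 : i = a := by omega
        have h4 : j - a - 1 = 0 := by omega
        rw [h3, h4]; exact hpq
    · constructor
      · intro h
        have := hadj j h2 _ (by omega) h.symm
        omega
      · intro h
        have h3 : j = a := by omega
        have h4 : i - a - 1 = 0 := by omega
        rw [h3, h4]; exact hpq.symm
    · rw [hq.2 _ (by omega) _ (by omega)]
      omega

/-- An induced path joining two neighbours of `x` has no inner neighbour of `x`, and odd length. -/
theorem NoEven.odd_path {X : Finset V} (h : NoEven G X) {x : V} {p : ℕ → V} {m : ℕ}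
    (hp : IndPath G p m) (hm : 2 ≤ m) (hx : x ∈ X) (hpX : ∀ i ≤ m, p i ∈ X \ {x})
    (h0 : G.Adj x (p 0)) (h1 : G.Adj x (p m)) :
    (∀ i, 0 < i → i < m → ¬ G.Adj x (p i)) ∧ Odd m := by
  classical
  have hne : ∀ i ≤ m, p i ≠ x := fun i hi => by
    simpa using (mem_sdiff.1 (hpX i hi)).2
  -- Two consecutive neighbours of `x` along the path close up with `x` to a chordless cycle, so
  -- their distance is odd.
  have gap : ∀ a b, a < b → b ≤ m → G.Adj x (p a) → G.Adj x (p b) →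
      (∀ i, a < i → i < b → ¬ G.Adj x (p i)) → Odd (b - a) := by
    intro a b hab hb ha hb' hno
    by_contra hodd
    rw [Nat.not_odd_iff_even] at hodd
    have h2 : 2 ≤ b - a := by
      rcases hodd with ⟨c, hc⟩
      omega
    refine h x (fun t => p (a + t)) (b - a) 0 (hp.shift (by omega)) hodd h2
      (fun i hi => hne _ (by omega)) ha ?_ ?_ hx fun i hi => (mem_sdiff.1 (hpX _ (by omega))).1
    · simp only [show a + (b - a) = b by omega]; exact hb'
    · intro i hi hib hadj
      exact absurd hadj (hno (a + i) (by omega) (by omega))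
  have hno : ∀ i, 0 < i → i < m → ¬ G.Adj x (p i) := by
    by_contra hcon
    push Not at hcon
    obtain ⟨i0, hi0, him0, hadj0⟩ := hcon
    have e1 : ∃ i, 0 < i ∧ G.Adj x (p i) := ⟨i0, hi0, hadj0⟩
    obtain ⟨ha, ha'⟩ := Nat.find_spec e1
    have hamin : ∀ i, i < Nat.find e1 → ¬ (0 < i ∧ G.Adj x (p i)) := fun i hi => Nat.find_min e1 hi
    have hale : Nat.find e1 ≤ i0 := Nat.find_min' e1 ⟨hi0, hadj0⟩
    set a := Nat.find e1
    have e2 : ∃ i, a < i ∧ G.Adj x (p i) := ⟨m, by omega, h1⟩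
    obtain ⟨hb, hb'⟩ := Nat.find_spec e2
    have hbmin : ∀ i, i < Nat.find e2 → ¬ (a < i ∧ G.Adj x (p i)) := fun i hi => Nat.find_min e2 hi
    have hble : Nat.find e2 ≤ m := Nat.find_min' e2 ⟨by omega, h1⟩
    set b := Nat.find e2
    have o1 := gap 0 a ha (by omega) h0 ha' fun i hi hia hadj => hamin i hia ⟨hi, hadj⟩
    have o2 := gap a b hb hble ha' hb' fun i hi hib hadj => hbmin i hib ⟨hi, hadj⟩
    have ev : Even b := by
      have := o1.add_odd o2
      rwa [show a - 0 + (b - a) = b by omega] at this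
    have hps := hp.shift (a := 0) (l := b) (by omega)
    simp only [zero_add] at hps
    -- Two odd gaps add up to an even cycle whose only chord runs from `x` to `p a`.
    refine h x p b a hps ev (by omega) (fun i hi => hne i (by omega)) h0 hb' ?_ hx
      fun i hi => (mem_sdiff.1 (hpX i (by omega))).1
    intro i hi hib hadj
    by_contra hia
    rcases Nat.lt_or_gt_of_ne hia with h3 | h3
    · exact hamin i h3 ⟨hi, hadj⟩
    · exact hbmin i hib ⟨h3, hadj⟩
  exact ⟨hno, by simpa using gap 0 m (by omega) le_rfl h0 h1 hno⟩

/-- `c` is an induced cycle of length `N`. -/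
def IndCycle (G : SimpleGraph V) {N : ℕ} (c : ZMod N → V) : Prop :=
  Function.Injective c ∧ ∀ i j, G.Adj (c i) (c j) ↔ j = i + 1 ∨ i = j + 1

theorem IndCycle.neg {N : ℕ} {c : ZMod N → V} (hc : IndCycle G c) :
    IndCycle G fun i => c (-i) := by
  refine ⟨fun i j h => neg_injective (hc.1 h), fun i j => ?_⟩
  rw [hc.2, or_comm]
  refine or_congr ⟨fun h => ?_, fun h => ?_⟩ ⟨fun h => ?_, fun h => ?_⟩
  · linear_combination h
  · linear_combination h
  · linear_combination h
  · linear_combination h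

theorem zmod_natCast_inj {N a b : ℕ} (ha : a < N) (hb : b < N) :
    (a : ZMod N) = b ↔ a = b := by
  rw [ZMod.natCast_eq_natCast_iff', Nat.mod_eq_of_lt ha, Nat.mod_eq_of_lt hb]

theorem IndCycle.path {N : ℕ} {c : ZMod N → V} (hc : IndCycle G c) (j : ZMod N) {l : ℕ}
    (hl : l + 2 ≤ N) : IndPath G (fun t => c (j - (t : ZMod N))) l := by
  refine ⟨fun a ha b hb h => ?_, fun a ha b hb => ?_⟩
  · have h1 := hc.1 h
    have h2 : (a : ZMod N) = b := by linear_combination -h1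
    exact (zmod_natCast_inj (by omega) (by omega)).1 h2
  · rw [hc.2]
    have e1 : (j - (b : ZMod N) = j - a + 1) ↔ b + 1 = a := by
      rw [← zmod_natCast_inj (N := N) (by omega) (by omega)]
      push_cast
      exact ⟨fun h => by linear_combination -h, fun h => by linear_combination -h⟩
    have e2 : (j - (a : ZMod N) = j - b + 1) ↔ a + 1 = b := by
      rw [← zmod_natCast_inj (N := N) (by omega) (by omega)]
      push_cast
      exact ⟨fun h => by linear_combination -h, fun h => by linear_combination -h⟩
    rw [e1, e2, or_comm]

theorem exists_indCycle {x : V} {q : ℕ → V} {n : ℕ} (hq : IndPath G q n) (hn : 2 ≤ n)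
    (hx : ∀ i ≤ n, q i ≠ x) (h0 : G.Adj x (q 0)) (h1 : G.Adj x (q n))
    (hno : ∀ i, 0 < i → i < n → ¬ G.Adj x (q i)) :
    ∃ c : ZMod (n + 2) → V, IndCycle G c ∧ ∀ i, c i = x ∨ ∃ t ≤ n, c i = q t := by
  have hval : ∀ i : ZMod (n + 2), i.val < n + 2 := fun i => ZMod.val_lt i
  have hxq : ∀ i ≤ n, G.Adj x (q i) ↔ i = 0 ∨ i = n := by
    intro i hi
    constructor
    · intro h
      by_contra hcon
      exact hno i (by omega) (by omega) h
    · rintro (rfl | rfl)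
      · exact h0
      · exact h1
  have hsucc : ∀ i j : ZMod (n + 2), j = i + 1 ↔
      (j.val = i.val + 1 ∨ (j.val = 0 ∧ i.val = n + 1)) := by
    intro i j
    rw [← (ZMod.val_injective (n + 2)).eq_iff, ZMod.val_add, ZMod.val_one_eq_one_mod,
      Nat.mod_eq_of_lt (show 1 < n + 2 by omega)]
    have h2 := hval i
    have h3 := hval j
    by_cases h : i.val = n + 1
    · have h4 : (i.val + 1) % (n + 2) = 0 := by rw [h]; exact Nat.mod_self _
      rw [h4]
      omega
    · rw [Nat.mod_eq_of_lt (by omega)]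
      omega
  refine ⟨fun i => if i.val ≤ n then q i.val else x, ⟨fun i j h => ?_, fun i j => ?_⟩, fun i => ?_⟩
  · have h2 := hval i
    have h3 := hval j
    by_cases hi : i.val ≤ n <;> by_cases hj : j.val ≤ n <;> simp only [hi, hj, if_true, if_false] at h
    · exact ZMod.val_injective _ (hq.1 _ hi _ hj h)
    · exact absurd h (hx _ hi)
    · exact absurd h.symm (hx _ hj)
    · exact ZMod.val_injective _ (by omega)
  · have h2 := hval i
    have h3 := hval j
    rw [hsucc, hsucc]
    by_cases hi : i.val ≤ n <;> by_cases hj : j.val ≤ n <;> simp only [hi, hj, if_true, if_false]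
    · rw [hq.2 _ hi _ hj]; omega
    · rw [G.adj_comm, hxq _ hi]; omega
    · rw [hxq _ hj]; omega
    · constructor
      · intro h; exact absurd rfl h.ne
      · intro h; omega
  · by_cases hi : i.val ≤ n
    · right; exact ⟨_, hi, by simp [hi]⟩
    · left; simp [hi]

section cycle

variable {X : Finset V} {N : ℕ} {c : ZMod N → V}

theorem exists_eq_add_natCast (hN : 0 < N) (i j : ZMod N) : ∃ l < N, j = i + (l : ZMod N) := by
  have : NeZero N := ⟨hN.ne'⟩
  exact ⟨(j - i).val, ZMod.val_lt _, by rw [ZMod.natCast_zmod_val]; ring⟩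

theorem NoEven.odd_arc (h : NoEven G X) (hc : IndCycle G c) (hcX : ∀ i, c i ∈ X) {v : V}
    (hv : v ∈ X) (hvc : ∀ i, c i ≠ v) {i : ZMod N} {l : ℕ} (hl : 2 ≤ l) (hlN : l + 2 ≤ N)
    (h1 : G.Adj v (c i)) (h2 : G.Adj v (c (i + l))) : Odd l := by
  refine (h.odd_path (x := v) (hc.path (i + l) hlN) hl hv
    (fun t _ => mem_sdiff.2 ⟨hcX _, by simpa using hvc _⟩) ?_ ?_).2
  · simpa using h2
  · simpa using h1

/-- Two neighbours of `v` at distance at least two would split the odd cycle into two arcs that must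
both be odd. Two consecutive neighbours allow `v` to be inserted between them, which gives an even
cycle with one chord. -/
theorem NoEven.not_adj_two (h : NoEven G X) (hc : IndCycle G c) (hcX : ∀ i, c i ∈ X)
    (hN : 5 ≤ N) (hodd : Odd N) {v : V} (hv : v ∈ X) (hvc : ∀ i, c i ≠ v) {i j : ZMod N}
    (hi : G.Adj v (c i)) (hj : G.Adj v (c j)) : i = j := by
  have far : ∀ (i : ZMod N) (l : ℕ), 2 ≤ l → l + 2 ≤ N → G.Adj v (c i) →
      G.Adj v (c (i + l)) → False := by
    intro i l hl hlN h1 h2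
    have o1 := h.odd_arc hc hcX hv hvc hl hlN h1 h2
    have o2 := h.odd_arc (c := fun i => c (-i)) hc.neg (fun i => hcX _) hv (fun i => hvc _)
      (i := -i) (l := N - l) (by omega) (by omega) (by simpa using h1) (by
        have : -(-i + ((N - l : ℕ) : ZMod N)) = i + l := by
          rw [Nat.cast_sub (by omega), ZMod.natCast_self]; ring
        simp only [this]; exact h2)
    have := o1.add_odd o2
    rw [show l + (N - l) = N by omega] at this
    exact (Nat.not_even_iff_odd.2 hodd) this
  have near : ∀ i : ZMod N, G.Adj v (c i) → G.Adj v (c (i + 1)) → False := by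
    intro i h1 h2
    have hq := hc.path i (l := N - 2) (by omega)
    have hv0 : IndPath G (fun _ => v) 0 := by
      refine ⟨fun a ha b hb _ => by omega, fun a ha b hb => ?_⟩
      constructor
      · intro h0; exact absurd rfl h0.ne
      · intro h0; omega
    have honly : ∀ t ≤ N - 2, G.Adj v (c (i - (t : ZMod N))) → t = 0 := by
      intro t ht hadj
      by_contra ht0
      rcases Nat.lt_or_ge t 2 with h3 | h3
      · have ht1 : t = 1 := by omega
        subst ht1
        refine far (i - 1) 2 le_rfl (by omega) (by simpa using hadj) ?_
        rw [show i - 1 + ((2 : ℕ) : ZMod N) = i + 1 by push_cast; ring]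
        exact h2
      · refine far (i - t) t h3 (by omega) hadj ?_
        rw [show i - (t : ZMod N) + t = i by ring]
        exact h1
    have happ := hv0.append hq (by simpa using h1) (fun a _ b _ h0 => hvc _ h0.symm)
      (fun a ha b hb hadj => ⟨by omega, honly b hb hadj⟩)
    rw [show 0 + (N - 2) + 1 = N - 1 by omega] at happ
    have hc1 : ∀ t, t ≤ N - 2 → c (i - (t : ZMod N)) ≠ c (i + 1) := by
      intro t ht h0
      have h3 := hc.1 h0
      have h4 : ((t + 1 : ℕ) : ZMod N) = (0 : ℕ) := by push_cast; linear_combination -h3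
      have := (zmod_natCast_inj (N := N) (by omega) (by omega)).1 h4
      omega
    -- The cycle `c (i + 1), v, c i, c (i - 1), …, c (i + 2)` has even length N + 1; its only chord
    -- joins `c (i + 1)` to `c i`, which has index 1 on the path starting at `v`.
    refine h (c (i + 1)) _ (N - 1) 1 happ ?_ (by omega) ?_ ?_ ?_ ?_ (hcX _) ?_
    · obtain ⟨r, hr⟩ := hodd
      exact ⟨r, by omega⟩
    · intro t ht
      by_cases h0 : t ≤ 0
      · simp only [h0, if_true]; exact (hvc _).symm
      · simp only [h0, if_false]; exact hc1 _ (by omega)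
    · simpa using h2.symm
    · simp only [show ¬ (N - 1 ≤ 0) by omega, if_false]
      rw [hc.2]
      left
      rw [show N - 1 - 0 - 1 = N - 2 by omega, Nat.cast_sub (by omega), ZMod.natCast_self]
      push_cast; ring
    · intro t ht0 htN hadj
      simp only [show ¬ (t ≤ 0) by omega, if_false] at hadj
      rw [hc.2] at hadj
      rcases hadj with h3 | h3
      · have h4 : ((t - 0 - 1 + 2 : ℕ) : ZMod N) = (0 : ℕ) := by
          push_cast; linear_combination -h3
        have h5 := (ZMod.natCast_eq_natCast_iff' _ _ _).1 h4
        rw [Nat.mod_eq_of_lt (by omega), Nat.zero_mod] at h5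
        omega
      · have h4 : ((t - 0 - 1 : ℕ) : ZMod N) = (0 : ℕ) := by
          push_cast; linear_combination h3
        have := (zmod_natCast_inj (N := N) (by omega) (by omega)).1 h4
        omega
    · intro t _
      by_cases h0 : t ≤ 0
      · simp only [h0, if_true]; exact hv
      · simp only [h0, if_false]; exact hcX _
  obtain ⟨l, hl, rfl⟩ := exists_eq_add_natCast (by omega) i j
  by_contra hne
  have hl0 : l ≠ 0 := by rintro rfl; exact hne (by simp)
  rcases Nat.lt_or_ge l 2 with h3 | h3
  · have : l = 1 := by omega
    subst this
    exact near i hi (by simpa using hj)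
  · rcases Nat.lt_or_ge (l + 1) N with h4 | h4
    · exact far i l h3 h4 hi hj
    · refine near _ hj ?_
      have h5 : i + (l : ZMod N) + 1 = i := by
        have : ((l + 1 : ℕ) : ZMod N) = 0 := by
          rw [show l + 1 = N by omega, ZMod.natCast_self]
        push_cast at this
        linear_combination this
      rw [h5]; exact hi

/-- The ear followed by the arc from `c (i + l)` down to `c (i + 1)` is an induced path of length e
+ l between two neighbours of `c i`. Applied to both arcs of the cycle, this will contradict that N
is odd. -/
theorem NoEven.odd_ear (h : NoEven G X) (hc : IndCycle G c) (hcX : ∀ i, c i ∈ X)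
    {i : ZMod N} {l : ℕ} (hl : 0 < l) (hlN : l < N) {r : ℕ → V} {e : ℕ} (he : 0 < e)
    (hr : IndPath G r e) (hrX : ∀ t ≤ e, r t ∈ X) (hrc : ∀ t ≤ e, ∀ j, c j ≠ r t)
    (h0 : G.Adj (r 0) (c i)) (h1 : G.Adj (r e) (c (i + l)))
    (hin : ∀ t ≤ e, ∀ j, j ≠ i → G.Adj (r t) (c j) → t = e ∧ j = i + l) : Odd (e + l) := by
  have hq := hc.path (i + l) (l := l - 1) (by omega)
  have hji : ∀ s ≤ l - 1, i + (l : ZMod N) - (s : ZMod N) ≠ i := by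
    intro s hs h3
    have h4 : (l : ZMod N) = s := by linear_combination h3
    have := (zmod_natCast_inj (N := N) (by omega) (by omega)).1 h4
    omega
  have happ := hr.append hq (by simpa using h1) (fun a ha b hb h0 => hrc a ha _ h0.symm)
    (fun a ha b hb hadj => by
      have h3 := hin a ha _ (hji b hb) hadj
      refine ⟨h3.1, ?_⟩
      have h4 : (b : ZMod N) = (0 : ℕ) := by push_cast; linear_combination -h3.2
      exact (zmod_natCast_inj (N := N) (by omega) (by omega)).1 h4)
  rw [show e + (l - 1) + 1 = e + l by omega] at happ
  refine (h.odd_path (x := c i) happ (by omega) (hcX i) ?_ ?_ ?_).2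
  · intro t ht
    rw [mem_sdiff, mem_singleton]
    by_cases h3 : t ≤ e
    · simp only [h3, if_true]
      exact ⟨hrX t h3, fun h4 => hrc t h3 _ h4.symm⟩
    · simp only [h3, if_false]
      exact ⟨hcX _, fun h4 => hji _ (by omega) (hc.1 h4)⟩
  · simpa using h0.symm
  · simp only [show ¬ (e + l ≤ e) by omega, if_false]
    rw [hc.2]
    left
    rw [show e + l - e - 1 = l - 1 by omega, Nat.cast_sub hl]
    push_cast; ring

/-- An induced odd cycle of length at least five exhausts a set without separations. -/
theorem NoEven.cycle_eq (h : NoEven G X) (hs : NoSep G X) (hc : IndCycle G c)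
    (hcX : ∀ i, c i ∈ X) (hN : 5 ≤ N) (hodd : Odd N) : ∀ v ∈ X, ∃ i, c i = v := by
  classical
  by_contra hcon
  push Not at hcon
  obtain ⟨v0, hv0, hv0c⟩ := hcon
  set Cs := X.filter fun v => ∃ i, c i = v with hCs
  have memCs : ∀ v, v ∈ Cs ↔ ∃ i, c i = v := by
    intro v
    rw [hCs, mem_filter]
    exact ⟨fun h => h.2, fun ⟨i, hi⟩ => ⟨hi ▸ hcX i, i, hi⟩⟩
  obtain ⟨v, hv, hvc, i, hvi⟩ : ∃ v ∈ X, (∀ j, c j ≠ v) ∧ ∃ i, G.Adj v (c i) := by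
    by_contra hno
    push Not at hno
    have h1 := hs Cs (X \ Cs) (union_sdiff_of_subset (filter_subset _ _)) (by simp)
      (by
        intro u hu v hv _ hv' hadj
        obtain ⟨i, rfl⟩ := (memCs u).1 hu
        refine hno v (mem_sdiff.1 hv).1 (fun j hj => hv' ((memCs v).2 ⟨j, hj⟩)) i hadj.symm)
    rcases h1 with h1 | h1
    · obtain ⟨i, hi⟩ := (memCs v0).1 (h1 ▸ hv0)
      exact hv0c i hi
    · have h2 : c 0 ∈ X \ Cs := by rw [h1]; exact hcX 0
      exact (mem_sdiff.1 h2).2 ((memCs _).2 ⟨0, rfl⟩)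
  have hii : i + 1 ≠ i := by
    intro h0
    have h2 : ((1 : ℕ) : ZMod N) = (0 : ℕ) := by push_cast; linear_combination h0
    have := (zmod_natCast_inj (N := N) (by omega) (by omega)).1 h2
    omega
  -- Without cut vertices there is a way back to the cycle avoiding `c i`; an ear will be cut out of
  -- it.
  obtain ⟨r, m, hr, hr0, hrm, hrX⟩ := hs.indPath (T := {c i}) (singleton_subset_iff.2 (hcX i))
    (by simp) (a := v) (b := c (i + 1)) (by simp [hv, (hvc i).symm])
    (by simp [hcX, hc.1.eq_iff, hii])
  have hrX' : ∀ t ≤ m, r t ∈ X := fun t ht => (mem_sdiff.1 (hrX t ht)).1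
  have hri : ∀ t ≤ m, r t ≠ c i := fun t ht => by simpa using (mem_sdiff.1 (hrX t ht)).2
  have e1 : ∃ t, t ≤ m ∧ ∃ j, j ≠ i ∧ G.Adj (r t) (c j) ∧ ∀ s ≤ t, ∀ j, c j ≠ r s := by
    have e0 : ∃ t, t ≤ m ∧ ∃ j, c j = r t := ⟨m, le_rfl, i + 1, hrm.symm⟩
    obtain ⟨ha, j, hj⟩ := Nat.find_spec e0
    have hmin : ∀ s, s < Nat.find e0 → ¬ (s ≤ m ∧ ∃ j, c j = r s) := fun s hs => Nat.find_min e0 hs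
    set a := Nat.find e0
    have ha0 : a ≠ 0 := by
      intro h0
      rw [h0, hr0] at hj
      exact hvc j hj
    refine ⟨a - 1, by omega, j, ?_, ?_, ?_⟩
    · rintro rfl
      exact hri a ha hj.symm
    · rw [hj, hr.2 _ (by omega) _ ha]
      omega
    · intro s hs' j' hj'
      exact hmin s (by omega) ⟨by omega, j', hj'⟩
  -- The end of the ear: the first path vertex with a neighbour on the cycle other than `c i`.
  obtain ⟨hb, j, hji, hbj, hbc⟩ := Nat.find_spec e1
  have hbmin : ∀ s, s < Nat.find e1 →
      ¬ (s ≤ m ∧ ∃ j, j ≠ i ∧ G.Adj (r s) (c j) ∧ ∀ s' ≤ s, ∀ j, c j ≠ r s') :=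
    fun s hs => Nat.find_min e1 hs
  set b := Nat.find e1
  have hbi : ¬ G.Adj (r b) (c i) := fun h0 =>
    hji (h.not_adj_two hc hcX hN hodd (hrX' b hb) (hbc b le_rfl) hbj h0)
  -- the last neighbour of `c i` before `b`
  set a := Nat.findGreatest (fun t => G.Adj (r t) (c i)) b with ha
  have ha1 : G.Adj (r a) (c i) :=
    Nat.findGreatest_spec (P := fun t => G.Adj (r t) (c i)) (Nat.zero_le b) (by rw [hr0]; exact hvi)
  have hab : a ≤ b := Nat.findGreatest_le b
  have hab' : a ≠ b := fun h0 => hbi (h0 ▸ ha1)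
  have hafter : ∀ t, a < t → t ≤ b → ¬ G.Adj (r t) (c i) := fun t h1 h2 =>
    Nat.findGreatest_is_greatest h1 h2
  obtain ⟨l, hl, rfl⟩ := exists_eq_add_natCast (by omega) i j
  have hl0 : 0 < l := by
    rcases Nat.eq_zero_or_pos l with rfl | h1
    · exact absurd (by simp) hji
    · exact h1
  have hR := hr.shift (a := a) (l := b - a) (by omega)
  have hin : ∀ t ≤ b - a, ∀ j, j ≠ i → G.Adj (r (a + t)) (c j) → t = b - a ∧ j = i + l := by
    intro t ht j hj hadj
    have h1 : a + t = b := by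
      by_contra h2
      exact hbmin (a + t) (by omega) ⟨by omega, j, hj, hadj, fun s hs => hbc s (by omega)⟩
    rw [h1] at hadj
    exact ⟨by omega, h.not_adj_two hc hcX hN hodd (hrX' b hb) (hbc b le_rfl) hadj hbj⟩
  have hlast : a + (b - a) = b := by omega
  have o1 := h.odd_ear hc hcX hl0 hl (r := fun t => r (a + t)) (e := b - a) (by omega) hR
    (fun t ht => hrX' _ (by omega)) (fun t ht => hbc _ (by omega)) ha1
    (by simp only [hlast]; exact hbj) hin
  have hcast : -(-i + ((N - l : ℕ) : ZMod N)) = i + l := by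
    rw [Nat.cast_sub (by omega), ZMod.natCast_self]; ring
  have o2 := h.odd_ear (c := fun i => c (-i)) hc.neg (fun i => hcX _) (i := -i) (l := N - l)
    (by omega) (by omega) (r := fun t => r (a + t)) (e := b - a) (by omega) hR
    (fun t ht => hrX' _ (by omega)) (fun t ht j => hbc _ (by omega) _)
    (by simpa using ha1)
    (by simp only [hlast, hcast]; exact hbj)
    (fun t ht j hj hadj => by
      have h1 := hin t ht (-j) (fun h0 => hj (by rw [← h0, neg_neg])) hadj
      refine ⟨h1.1, ?_⟩
      rw [← neg_inj, hcast]
      exact h1.2)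
  -- The two odd lengths add up to 2(b - a) + N, which is odd.
  have h3 := o1.add_odd o2
  obtain ⟨y, hy⟩ := h3
  obtain ⟨z, hz⟩ := hodd
  omega

end cycle

/-- A set without separations and without induced even cycles with at most one chord is a clique or
induces a cycle. -/
theorem NoEven.clique_or_degree_le {X : Finset V} (h : NoEven G X) (hs : NoSep G X) :
    G.IsClique (X : Set V) ∨ ∀ v ∈ X, #(nb G X v) ≤ 2 := by
  by_cases hcl : G.IsClique (X : Set V)
  · exact Or.inl hcl
  right
  have : ∃ a ∈ X, ∃ b ∈ X, a ≠ b ∧ ¬ G.Adj a b := by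
    by_contra hcon
    push Not at hcon
    exact hcl fun a ha b hb hab => hcon a ha b hb hab
  obtain ⟨a, ha, b, hb, hab, hnadj⟩ := this
  obtain ⟨p, m, hp, hp0, hpm, hpX⟩ := hs.indPath (T := ∅) (empty_subset _) (by simp) (a := a) (b := b)
    (by simpa using ha) (by simpa using hb)
  rw [sdiff_empty] at hpX
  have hm : 2 ≤ m := by
    rcases Nat.lt_or_ge m 2 with h1 | h1
    · exfalso
      interval_cases m
      · exact hab (hp0.symm.trans hpm)
      · apply hnadj
        rw [← hp0, ← hpm, hp.2 0 (by omega) 1 le_rfl]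
        exact Or.inl rfl
    · exact h1
  have hx : p 1 ∈ X := hpX 1 (by omega)
  have n01 : p 0 ≠ p 1 := fun h0 => by
    have := hp.1 0 (by omega) 1 (by omega) h0
    omega
  have n21 : p 2 ≠ p 1 := fun h0 => by
    have := hp.1 2 (by omega) 1 (by omega) h0
    omega
  -- Rejoining `p 0` and `p 2` without `p 1` yields, with `p 1`, an induced cycle of length n + 2,
  -- which is odd and at least five.
  obtain ⟨q, n, hq, hq0, hqn, hqX⟩ := hs.indPath (T := {p 1}) (singleton_subset_iff.2 hx) (by simp)
    (a := p 0) (b := p 2) (by simp [hpX 0 (by omega), n01]) (by simp [hpX 2 (by omega), n21])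
  have hn : 2 ≤ n := by
    rcases Nat.lt_or_ge n 2 with h1 | h1
    · exfalso
      interval_cases n
      · have := hp.1 0 (by omega) 2 (by omega) (hq0.symm.trans hqn)
        omega
      · have h2 : G.Adj (p 0) (p 2) := by
          rw [← hq0, ← hqn, hq.2 0 (by omega) 1 le_rfl]
          exact Or.inl rfl
        rw [hp.2 0 (by omega) 2 (by omega)] at h2
        omega
    · exact h1
  have a0 : G.Adj (p 1) (q 0) := by
    rw [hq0, hp.2 1 (by omega) 0 (by omega)]; exact Or.inr rfl
  have an : G.Adj (p 1) (q n) := by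
    rw [hqn, hp.2 1 (by omega) 2 (by omega)]; exact Or.inl rfl
  obtain ⟨hno, hodd⟩ := h.odd_path hq hn hx hqX a0 an
  obtain ⟨c, hc, hcv⟩ := exists_indCycle hq hn
    (fun i hi => by simpa using (mem_sdiff.1 (hqX i hi)).2) a0 an hno
  have hcX : ∀ i, c i ∈ X := by
    intro i
    rcases hcv i with h1 | ⟨t, ht, h1⟩
    · rw [h1]; exact hx
    · rw [h1]; exact (mem_sdiff.1 (hqX t ht)).1
  have hodd' : Odd (n + 2) := by
    obtain ⟨r, hr⟩ := hodd
    exact ⟨r + 1, by omega⟩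
  have hall := h.cycle_eq hs hc hcX (by obtain ⟨r, hr⟩ := hodd; omega) hodd'
  intro v hv
  obtain ⟨i, rfl⟩ := hall v hv
  refine (card_le_card (t := {c (i + 1), c (i - 1)}) ?_).trans card_le_two
  intro w hw
  obtain ⟨hwX, hadj⟩ := mem_filter.1 hw
  obtain ⟨j, rfl⟩ := hall w hwX
  rw [mem_insert, mem_singleton]
  rcases (hc.2 i j).1 hadj with h1 | h1
  · left; rw [h1]
  · right; rw [h1]; congr 1; ring

end

end AlonTarsi

/-! ### Weighted sparsity of the low vertices -/

namespace AlonTarsi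

open Finset

universe u

section

variable {V : Type u} [Fintype V] [DecidableEq V] {G : SimpleGraph V} [DecidableRel G.Adj]

theorem mem_nb {X : Finset V} {v w : V} : w ∈ nb G X v ↔ w ∈ X ∧ G.Adj v w := mem_filter

theorem nb_subset (X : Finset V) (v : V) : nb G X v ⊆ X := filter_subset _ _

theorem nb_mono {X Y : Finset V} (h : X ⊆ Y) (v : V) : nb G X v ⊆ nb G Y v :=
  filter_subset_filter _ h

theorem nb_univ (v : V) : nb G univ v = G.neighborFinset v := by
  ext w; simp [mem_nb]

theorem card_nb_univ (v : V) : #(nb G univ v) = G.degree v := by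
  rw [nb_univ, SimpleGraph.card_neighborFinset_eq_degree]

theorem nb_clique {Q : Finset V} (hQ : G.IsClique (Q : Set V)) {v : V} (hv : v ∈ Q) :
    nb G Q v = Q.erase v := by
  ext w
  rw [mem_nb, mem_erase]
  exact ⟨fun h => ⟨h.2.ne.symm, h.1⟩, fun h => ⟨h.2, hQ hv h.2 h.1.symm⟩⟩

theorem card_nb_clique {Q : Finset V} (hQ : G.IsClique (Q : Set V)) {v : V} (hv : v ∈ Q) :
    #(nb G Q v) + 1 = #Q := by
  rw [nb_clique hQ hv, card_erase_add_one hv]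

theorem _root_.SimpleGraph.IsClique.noSep {Q : Finset V} (hQ : G.IsClique (Q : Set V)) :
    NoSep G Q := by
  intro X1 X2 hX _ hno
  by_cases h : X2 ⊆ X1
  · exact Or.inl (by rw [← hX, union_eq_left.2 h])
  · obtain ⟨v, hv, hv1⟩ := not_subset.1 h
    refine Or.inr ?_
    rw [← hX, eq_comm, union_eq_right]
    intro u hu
    by_contra hu2
    refine hno u hu v hv hu2 hv1 (hQ ?_ ?_ ?_)
    · exact mem_coe.2 (hX ▸ mem_union_left _ hu)
    · exact mem_coe.2 (hX ▸ mem_union_right _ hv)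
    · rintro rfl; exact hv1 hu

theorem NoSep.restrict {X Y X1 X2 : Finset V} (h : NoSep G X) (hXY : X ⊆ Y) (hY : X1 ∪ X2 = Y)
    (hc : #(X1 ∩ X2) ≤ 1) (hno : ∀ u ∈ X1, ∀ v ∈ X2, u ∉ X2 → v ∉ X1 → ¬ G.Adj u v) :
    X ⊆ X1 ∨ X ⊆ X2 := by
  have := h (X1 ∩ X) (X2 ∩ X) (by rw [← union_inter_distrib_right, hY, inter_eq_right.2 hXY])
    ((card_le_card (by intro v; simp only [mem_inter]; tauto)).trans hc)
    (fun u hu v hv hu2 hv1 => hno u (mem_inter.1 hu).1 v (mem_inter.1 hv).1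
      (fun h => hu2 (mem_inter.2 ⟨h, (mem_inter.1 hu).2⟩))
      (fun h => hv1 (mem_inter.2 ⟨h, (mem_inter.1 hv).2⟩)))
  exact this.imp inter_eq_right.1 inter_eq_right.1

/-- A separation of the union restricts to both parts, and two common vertices keep them from lying
on different sides. -/
theorem NoSep.union {X Y : Finset V} (hX : NoSep G X) (hY : NoSep G Y) (h : 2 ≤ #(X ∩ Y)) :
    NoSep G (X ∪ Y) := by
  intro X1 X2 hu hc hno
  have key : ∀ A B : Finset V, #(A ∩ B) ≤ 1 → X ⊆ A → Y ⊆ B → False := fun A B hAB hA hB => by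
    have := card_le_card (inter_subset_inter hA hB)
    omega
  have hs1 : X1 ⊆ X ∪ Y := hu ▸ subset_union_left
  have hs2 : X2 ⊆ X ∪ Y := hu ▸ subset_union_right
  rcases hX.restrict subset_union_left hu hc hno with h1 | h1 <;>
    rcases hY.restrict subset_union_right hu hc hno with h2 | h2
  · exact Or.inl (hs1.antisymm (union_subset h1 h2))
  · exact (key _ _ hc h1 h2).elim
  · exact (key _ _ (by rwa [inter_comm]) h1 h2).elim
  · exact Or.inr (hs2.antisymm (union_subset h1 h2))

theorem NoSep.two_le_card_nb {X : Finset V} (h : NoSep G X) (hX : 3 ≤ #X) {v : V} (hv : v ∈ X) :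
    2 ≤ #(nb G X v) := by
  by_contra hlt
  have hi : insert v (nb G X v) ∩ X.erase v ⊆ nb G X v := by
    intro w
    simp only [mem_inter, mem_insert, mem_erase]
    tauto
  rcases h (insert v (nb G X v)) (X.erase v) (by
      ext w
      simp only [mem_union, mem_insert, mem_erase, mem_nb]
      by_cases hw : w = v
      · simp [hw, hv]
      · simp only [hw, false_or, ne_eq, not_false_eq_true, true_and]; tauto)
      ((card_le_card hi).trans (by omega))
      (fun u hu w hw hu2 hw1 hadj => by
        simp only [mem_insert, mem_erase, mem_nb, not_and, not_or] at hu hw hu2 hw1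
        have huv : u = v := by
          by_contra hne
          rcases hu with hu | hu
          · exact hne hu
          · exact hu2 hne hu.1
        subst huv
        exact hw1.2 hw.2 hadj) with h1 | h1
  · have := card_insert_le v (nb G X v)
    rw [h1] at this
    omega
  · have := notMem_erase v X
    rw [h1] at this
    exact this hv

/-- A set of vertices of degree `n ≥ 4` without low even cycles and without cliques on `n + 1`
vertices. -/
structure LowSet (G : SimpleGraph V) [DecidableRel G.Adj] (n : ℕ) (L : Finset V) : Prop where
  four_le : 4 ≤ n
  degree : ∀ v ∈ L, G.degree v = n
  noEven : NoEven G L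
  card_le : ∀ S ⊆ L, G.IsClique (S : Set V) → #S ≤ n

/-- A clique on `n` vertices of `L`. -/
def BigClique (G : SimpleGraph V) (n : ℕ) (L Q : Finset V) : Prop :=
  Q ⊆ L ∧ G.IsClique (Q : Set V) ∧ #Q = n

/-- Two vertices in a common big clique. -/
def SameClique (G : SimpleGraph V) (n : ℕ) (L : Finset V) (u v : V) : Prop :=
  ∃ Q, BigClique G n L Q ∧ u ∈ Q ∧ v ∈ Q

open Classical in
/-- The vertices in big cliques. -/
noncomputable def cliqueVerts (G : SimpleGraph V) (n : ℕ) (L : Finset V) : Finset V :=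
  L.filter fun v => ∃ Q, BigClique G n L Q ∧ v ∈ Q

variable {n : ℕ} {L : Finset V}

theorem mem_cliqueVerts {v : V} :
    v ∈ cliqueVerts G n L ↔ ∃ Q, BigClique G n L Q ∧ v ∈ Q := by
  classical
  rw [cliqueVerts, mem_filter]
  exact ⟨fun h => h.2, fun ⟨Q, hQ, hv⟩ => ⟨hQ.1 hv, Q, hQ, hv⟩⟩

theorem cliqueVerts_subset : cliqueVerts G n L ⊆ L := by
  classical
  exact filter_subset _ _

theorem SameClique.symm {u v : V} (h : SameClique G n L u v) : SameClique G n L v u :=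
  let ⟨Q, hQ, hu, hv⟩ := h
  ⟨Q, hQ, hv, hu⟩

theorem SameClique.mem {u v : V} (h : SameClique G n L u v) : u ∈ cliqueVerts G n L :=
  let ⟨Q, hQ, hu, _⟩ := h
  mem_cliqueVerts.2 ⟨Q, hQ, hu⟩

/-- `X ∪ Q` has no separation either, so it is a clique, hence has at most n vertices and equals
`Q`, or it has degrees at most two. The latter fails in `Q`, where degrees are n - 1 ≥ 3. -/
theorem LowSet.subset_of_noSep (hL : LowSet G n L) {X Q : Finset V} (hQ : BigClique G n L Q)
    (hXL : X ⊆ L) (hX : NoSep G X) (h : 2 ≤ #(X ∩ Q)) : X ⊆ Q := by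
  have h4 := hL.four_le
  have hu := hX.union hQ.2.1.noSep h
  have hsub : X ∪ Q ⊆ L := union_subset hXL hQ.1
  rcases (hL.noEven.mono hsub).clique_or_degree_le hu with hc | hd
  · have hcard := hL.card_le _ hsub hc
    have : Q = X ∪ Q := eq_of_subset_of_card_le subset_union_right (hcard.trans hQ.2.2.ge)
    rw [this]
    exact subset_union_left
  · obtain ⟨v, hv⟩ : Q.Nonempty := card_pos.1 (by have := hQ.2.2; omega)
    have h1 := card_nb_clique hQ.2.1 hv
    have h2 := card_le_card (nb_mono (G := G) (subset_union_right : Q ⊆ X ∪ Q) v)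
    have h3 := hd v (mem_union_right _ hv)
    have := hQ.2.2
    omega

/-- Both cliques lie in the closed neighbourhood of `v`, which has n + 1 vertices, so they share at
least n - 1 ≥ 2 vertices. -/
theorem LowSet.bigClique_eq (hL : LowSet G n L) {Q Q' : Finset V} (hQ : BigClique G n L Q)
    (hQ' : BigClique G n L Q') {v : V} (hv : v ∈ Q) (hv' : v ∈ Q') : Q = Q' := by
  have h4 := hL.four_le
  have hsub : Q ∪ Q' ⊆ insert v (nb G univ v) := by
    intro w hw
    by_cases hwv : w = v
    · simp [hwv]
    · refine mem_insert_of_mem (mem_nb.2 ⟨mem_univ _, ?_⟩)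
      rcases mem_union.1 hw with h | h
      · exact hQ.2.1 hv h (Ne.symm hwv)
      · exact hQ'.2.1 hv' h (Ne.symm hwv)
  have h1 := (card_le_card hsub).trans (card_insert_le _ _)
  rw [card_nb_univ, hL.degree v (hQ.1 hv)] at h1
  have h2 := card_union_add_card_inter Q Q'
  rw [hQ.2.2, hQ'.2.2] at h2
  exact eq_of_subset_of_card_le (hL.subset_of_noSep hQ' hQ.1 hQ.2.1.noSep (by omega))
    (by rw [hQ.2.2, hQ'.2.2])

theorem LowSet.sameClique_iff (hL : LowSet G n L) {Q : Finset V} (hQ : BigClique G n L Q) {v : V}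
    (hv : v ∈ Q) (w : V) : SameClique G n L v w ↔ w ∈ Q := by
  constructor
  · rintro ⟨Q', hQ', h1, h2⟩
    rwa [hL.bigClique_eq hQ hQ' hv h1]
  · exact fun hw => ⟨Q, hQ, hv, hw⟩

theorem LowSet.existsUnique_ext (hL : LowSet G n L) {Q : Finset V} (hQ : BigClique G n L Q) {v : V}
    (hv : v ∈ Q) : ∃ w, ∀ u, G.Adj v u ∧ u ∉ Q ↔ u = w := by
  have h4 := hL.four_le
  have h1 := card_nb_clique hQ.2.1 hv
  have h2 : #(nb G univ v \ nb G Q v) = 1 := by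
    rw [card_sdiff_of_subset (nb_mono (subset_univ Q) v), card_nb_univ, hL.degree v (hQ.1 hv)]
    have := hQ.2.2
    omega
  obtain ⟨w, hw⟩ := card_eq_one.1 h2
  refine ⟨w, fun u => ?_⟩
  rw [← mem_singleton, ← hw, mem_sdiff, mem_nb, mem_nb]
  simp only [mem_univ, true_and]
  tauto

open Classical in
/-- The weight of an ordered pair of vertices. -/
noncomputable def pairWeight (G : SimpleGraph V) (n : ℕ) (L : Finset V) (u v : V) : ℝ :=
  if ¬ G.Adj u v then 0 else
    if SameClique G n L u v then ((n : ℝ) - 1) / n else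
      if u ∈ cliqueVerts G n L ∨ v ∈ cliqueVerts G n L then ((n : ℝ) - 1) / 2 else 1

/-- The total weight of the ordered pairs of vertices in `X`. -/
noncomputable def weight (G : SimpleGraph V) (n : ℕ) (L X : Finset V) : ℝ :=
  ∑ u ∈ X, ∑ v ∈ X, pairWeight G n L u v

theorem pairWeight_of_not_adj {u v : V} (h : ¬ G.Adj u v) : pairWeight G n L u v = 0 := if_pos h

theorem pairWeight_of_sameClique {u v : V} (h : G.Adj u v) (hs : SameClique G n L u v) :
    pairWeight G n L u v = ((n : ℝ) - 1) / n := by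
  rw [pairWeight, if_neg (not_not.2 h), if_pos hs]

theorem pairWeight_of_mem {u v : V} (h : G.Adj u v) (hs : ¬ SameClique G n L u v)
    (hu : u ∈ cliqueVerts G n L ∨ v ∈ cliqueVerts G n L) :
    pairWeight G n L u v = ((n : ℝ) - 1) / 2 := by
  rw [pairWeight, if_neg (not_not.2 h), if_neg hs, if_pos hu]

theorem pairWeight_of_notMem {u v : V} (h : G.Adj u v)
    (hu : u ∉ cliqueVerts G n L) (hv : v ∉ cliqueVerts G n L) :
    pairWeight G n L u v = 1 := by
  rw [pairWeight, if_neg (not_not.2 h), if_neg fun h => hu h.mem, if_neg (by tauto)]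

theorem pairWeight_comm (u v : V) : pairWeight G n L u v = pairWeight G n L v u := by
  have : SameClique G n L u v ↔ SameClique G n L v u := ⟨SameClique.symm, SameClique.symm⟩
  simp only [pairWeight, G.adj_comm u v, or_comm]
  by_cases h : SameClique G n L u v
  · simp only [h, this.1 h]
  · simp only [h, mt this.2 h]

theorem pairWeight_nonneg (hn : 4 ≤ n) (u v : V) : 0 ≤ pairWeight G n L u v := by
  have : (4 : ℝ) ≤ n := by exact_mod_cast hn
  unfold pairWeight
  split_ifs
  · exact div_nonneg (by linarith) (by linarith)
  · linarith
  · exact zero_le_one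
  · exact le_rfl

theorem pairWeight_le (hn : 4 ≤ n) (u v : V) : pairWeight G n L u v ≤ ((n : ℝ) - 1) / 2 := by
  have : (4 : ℝ) ≤ n := by exact_mod_cast hn
  unfold pairWeight
  split_ifs
  · exact div_le_div_of_nonneg_left (by linarith) (by norm_num) (by linarith)
  · exact le_rfl
  · linarith
  · linarith

theorem weight_union {X Y : Finset V} (h : Disjoint X Y) : weight G n L (X ∪ Y) =
    weight G n L X + weight G n L Y + 2 * ∑ u ∈ X, ∑ v ∈ Y, pairWeight G n L u v := by
  have hcomm : ∑ u ∈ Y, ∑ v ∈ X, pairWeight G n L u v = ∑ u ∈ X, ∑ v ∈ Y, pairWeight G n L u v := by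
    rw [sum_comm]
    exact sum_congr rfl fun u _ => sum_congr rfl fun v _ => pairWeight_comm _ _
  simp only [weight, sum_union h, sum_add_distrib, hcomm]
  ring

theorem weight_le_of_sep (hn : 4 ≤ n) {X X1 X2 : Finset V} (hX : X1 ∪ X2 = X)
    (hno : ∀ u ∈ X1, ∀ v ∈ X2, u ∉ X2 → v ∉ X1 → ¬ G.Adj u v) :
    weight G n L X ≤ weight G n L X1 + weight G n L X2 := by
  simp only [weight, ← sum_product']
  have h1 : ∑ p ∈ X ×ˢ X, pairWeight G n L p.1 p.2 =
      ∑ p ∈ X1 ×ˢ X1 ∪ X2 ×ˢ X2, pairWeight G n L p.1 p.2 := by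
    symm
    refine sum_subset ?_ ?_
    · rintro ⟨u, v⟩ h
      simp only [← hX, mem_union, mem_product] at h ⊢
      tauto
    · rintro ⟨u, v⟩ h h'
      simp only [← hX, mem_union, mem_product] at h h'
      refine pairWeight_of_not_adj fun hadj => ?_
      have n1 := hno u
      have n2 := hno v
      by_cases hu1 : u ∈ X1
      · exact n1 hu1 v (by tauto) (by tauto) (by tauto) hadj
      · exact n2 (by tauto) u (by tauto) (by tauto) (by tauto) hadj.symm
  rw [h1, ← sum_union_inter]
  exact le_add_of_nonneg_right (sum_nonneg fun p _ => pairWeight_nonneg hn _ _)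

theorem weight_le_card_mul {X : Finset V} {c d : ℝ} (hc : ∀ u ∈ X, ∀ v ∈ X, G.Adj u v →
    pairWeight G n L u v ≤ c) (hd : ∀ u ∈ X, (#(nb G X u) : ℝ) ≤ d) (h0 : 0 ≤ c) :
    weight G n L X ≤ #X * (d * c) := by
  rw [← nsmul_eq_mul]
  refine sum_le_card_nsmul _ _ _ fun u hu => ?_
  have h1 : ∑ v ∈ X, pairWeight G n L u v = ∑ v ∈ nb G X u, pairWeight G n L u v := by
    symm
    refine sum_subset (nb_subset _ _) fun v hv hv' => pairWeight_of_not_adj fun h => hv' ?_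
    exact mem_nb.2 ⟨hv, h⟩
  rw [h1]
  refine (sum_le_card_nsmul _ _ c fun v hv => ?_).trans ?_
  · exact hc u hu v (mem_nb.1 hv).1 (mem_nb.1 hv).2
  · rw [nsmul_eq_mul]
    exact mul_le_mul_of_nonneg_right (hd u hu) h0

theorem card_nb_add_one_le {X : Finset V} {u : V} (hu : u ∈ X) : #(nb G X u) + 1 ≤ #X := by
  have : nb G X u ⊆ X.erase u := fun w hw =>
    mem_erase.2 ⟨(mem_nb.1 hw).2.ne.symm, (mem_nb.1 hw).1⟩
  have h1 := card_le_card this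
  rw [card_erase_of_mem hu] at h1
  have := card_pos.2 ⟨u, hu⟩
  omega

/-- The weighted sparsity of low sets. -/
theorem LowSet.weight_le (hL : LowSet G n L) {X : Finset V} (hXL : X ⊆ L) (hX : X.Nonempty) :
    weight G n L X ≤ ((n : ℝ) - 1) * (#X - 1) := by
  have hn := hL.four_le
  have hnR : (4 : ℝ) ≤ n := by exact_mod_cast hn
  induction hN : #X using Nat.strong_induction_on generalizing X with
  | _ N ih =>
  subst hN
  have hXpos := card_pos.2 hX
  have hXR : (1 : ℝ) ≤ #X := by exact_mod_cast hXpos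
  have hdeg : ∀ u ∈ X, (#(nb G X u) : ℝ) ≤ #X - 1 := fun u hu => by
    have : ((#(nb G X u) + 1 : ℕ) : ℝ) ≤ #X := by exact_mod_cast card_nb_add_one_le hu
    push_cast at this
    linarith
  by_cases hs : NoSep G X
  -- The weight (n - 1)/2 is chosen so that a single edge leaving a big clique makes the bound
  -- tight.
  · by_cases h3 : #X ≤ 2
    · have h3R : (#X : ℝ) ≤ 2 := by exact_mod_cast h3
      refine (weight_le_card_mul (fun u _ v _ _ => pairWeight_le hn u v) hdeg (by linarith)).trans ?_
      have : 0 ≤ ((#X : ℝ) - 1) * ((n - 1) / 2) * (2 - #X) :=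
        mul_nonneg (mul_nonneg (by linarith) (by linarith)) (by linarith)
      nlinarith
    have hrub := (hL.noEven.mono hXL).clique_or_degree_le hs
    by_cases hW : ∃ v ∈ X, v ∈ cliqueVerts G n L
    · obtain ⟨v, hvX, hvW⟩ := hW
      obtain ⟨Q, hQ, hvQ⟩ := mem_cliqueVerts.1 hvW
      -- Only one neighbour of `v` lies outside `Q`, so `X` shares a second vertex with `Q` and
      -- hence lies in it. The weight (n - 1)/n makes the bound tight for `X = Q`.
      have h2 := hs.two_le_card_nb (by omega) hvX
      obtain ⟨w, hw⟩ := hL.existsUnique_ext hQ hvQ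
      have h5 : 1 ≤ #((nb G X v).erase w) := by
        have := pred_card_le_card_erase (s := nb G X v) (a := w)
        omega
      obtain ⟨u, hu⟩ := card_pos.1 h5
      obtain ⟨huw, hu⟩ := mem_erase.1 hu
      obtain ⟨huX, hvu⟩ := mem_nb.1 hu
      have huQ : u ∈ Q := by
        by_contra hcon
        exact huw ((hw u).1 ⟨hvu, hcon⟩)
      have h6 : 2 ≤ #(X ∩ Q) := by
        have : ({u, v} : Finset V) ⊆ X ∩ Q := by
          intro t ht
          rcases mem_insert.1 ht with rfl | ht
          · exact mem_inter.2 ⟨huX, huQ⟩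
          · rw [mem_singleton.1 ht]; exact mem_inter.2 ⟨hvX, hvQ⟩
        have h7 := card_le_card this
        rwa [card_pair hvu.ne.symm] at h7
      have hXQ := hL.subset_of_noSep hQ hXL hs h6
      have hcard : (#X : ℝ) ≤ n := by exact_mod_cast (card_le_card hXQ).trans hQ.2.2.le
      have hpos : 0 < ((n : ℝ) - 1) / n := div_pos (by linarith) (by linarith)
      refine (weight_le_card_mul (c := ((n : ℝ) - 1) / n) (fun a ha b hb hab =>
        (pairWeight_of_sameClique hab ⟨Q, hQ, hXQ ha, hXQ hb⟩).le) hdeg hpos.le).trans ?_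
      have h8 : (n : ℝ) * (((n : ℝ) - 1) / n) = n - 1 := by field_simp
      calc (#X : ℝ) * ((#X - 1) * (((n : ℝ) - 1) / n))
          ≤ n * ((#X - 1) * (((n : ℝ) - 1) / n)) := by
            apply mul_le_mul_of_nonneg_right hcard
            exact mul_nonneg (by linarith) hpos.le
        _ = n * (((n : ℝ) - 1) / n) * (#X - 1) := by ring
        _ = _ := by rw [h8]
    · push Not at hW
      have hone : ∀ u ∈ X, ∀ v ∈ X, G.Adj u v → pairWeight G n L u v ≤ 1 := fun u hu v hv h =>
        (pairWeight_of_notMem h (hW u hu) (hW v hv)).le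
      -- A clique here has at most n - 1 vertices; if degrees are at most two, then 2 #X ≤ 3 (#X -
      -- 1) because #X ≥ 3.
      rcases hrub with hc | hd
      · have h5 : #X < n := by
          refine lt_of_le_of_ne (hL.card_le X hXL hc) fun heq => ?_
          obtain ⟨v, hv⟩ := hX
          exact hW v hv (mem_cliqueVerts.2 ⟨X, ⟨hXL, hc, heq⟩, hv⟩)
        have h6 : ((#X + 1 : ℕ) : ℝ) ≤ n := by exact_mod_cast h5
        push_cast at h6
        refine (weight_le_card_mul hone hdeg zero_le_one).trans ?_
        nlinarith
      · refine (weight_le_card_mul hone (d := 2) (fun u hu => by exact_mod_cast hd u hu)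
          zero_le_one).trans ?_
        have h5 : (3 : ℝ) ≤ #X := by exact_mod_cast (show 3 ≤ #X by omega)
        nlinarith
  -- Across a separation weights are subadditive, while #X1 + #X2 ≤ #X + 1, so the bounds for the
  -- two sides add up.
  · unfold NoSep at hs
    push Not at hs
    obtain ⟨X1, X2, hu, hc, hno, h1, h2⟩ := hs
    have hs1 : X1 ⊂ X := (hu ▸ subset_union_left : X1 ⊆ X).ssubset_of_ne h1
    have hs2 : X2 ⊂ X := (hu ▸ subset_union_right : X2 ⊆ X).ssubset_of_ne h2
    have hne1 : X1.Nonempty := by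
      rw [nonempty_iff_ne_empty]
      rintro rfl
      exact h2 (by simpa using hu)
    have hne2 : X2.Nonempty := by
      rw [nonempty_iff_ne_empty]
      rintro rfl
      exact h1 (by simpa using hu)
    have b1 := ih _ (card_lt_card hs1) (hs1.1.trans hXL) hne1 rfl
    have b2 := ih _ (card_lt_card hs2) (hs2.1.trans hXL) hne2 rfl
    have b3 := weight_le_of_sep (L := L) hn hu hno
    have b4 : (#X1 : ℝ) + #X2 ≤ #X + 1 := by
      have := card_union_add_card_inter X1 X2
      rw [hu] at this
      exact_mod_cast (show #X1 + #X2 ≤ #X + 1 by omega)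
    nlinarith

end

end AlonTarsi

/-! ### Separating sets: extracting coefficients in stages -/

namespace AlonTarsi

open Finset MvPolynomial

universe u

section

variable {V : Type u} [Fintype V] [DecidableEq V]

/-- Regard the variables outside `U` as coefficients. -/
noncomputable def splitHom (R : Type*) [CommRing R] (U : Finset V) :
    MvPolynomial V R →+* MvPolynomial V (MvPolynomial V R) :=
  eval₂Hom (C.comp C) fun v => if v ∈ U then X v else C (X v)

section splitHom

variable {R : Type*} [CommRing R] {U : Finset V}

theorem splitHom_C (r : R) : splitHom R U (C r) = C (C r) := by
  simp [splitHom]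

theorem splitHom_X_of_mem {v : V} (h : v ∈ U) : splitHom R U (X v) = X v := by
  simp [splitHom, h]

theorem splitHom_X_of_notMem {v : V} (h : v ∉ U) : splitHom R U (X v) = C (X v) := by
  simp [splitHom, h]

theorem splitHom_monomial (d : V →₀ ℕ) (r : R) : splitHom R U (monomial d r) =
    monomial (d.filter (· ∈ U)) (monomial (d.filter (· ∉ U)) r) := by
  have h : splitHom R U (monomial d r) =
      C (C r) * ∏ v, (if v ∈ U then X v else C (X v)) ^ d v := by
    rw [splitHom, coe_eval₂Hom, eval₂_monomial, Finsupp.prod_fintype _ _ (by simp)]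
    rfl
  have h1 : monomial (d.filter (· ∉ U)) r = C r * ∏ v, (if v ∈ U then 1 else X v) ^ d v := by
    rw [monomial_eq, Finsupp.prod_fintype _ _ (by simp)]
    congr 1
    refine prod_congr rfl fun v _ => ?_
    by_cases hv : v ∈ U <;> simp [Finsupp.filter_apply, hv]
  rw [h, h1, monomial_eq, Finsupp.prod_fintype _ _ (by simp), map_mul, map_prod, mul_assoc,
    ← prod_mul_distrib]
  congr 1
  refine prod_congr rfl fun v _ => ?_
  by_cases hv : v ∈ U <;> simp [Finsupp.filter_apply, hv]

/-- Extraction in the variables of `U` and then in the others is one extraction. This is what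
permits treating the variables outside a cluster as scalars. -/
theorem coeff_splitHom {m μ : V →₀ ℕ} (hm : ∀ v, v ∉ U → m v = 0) (hμ : ∀ v ∈ U, μ v = 0)
    (P : MvPolynomial V R) : coeff μ (coeff m (splitHom R U P)) = coeff (m + μ) P := by
  classical
  induction P using MvPolynomial.induction_on' with
  | add p q hp hq => simp only [map_add, coeff_add, hp, hq]
  | monomial d r =>
    rw [splitHom_monomial, coeff_monomial, coeff_monomial]
    by_cases h : d = m + μ
    · subst h
      have h1 : (m + μ).filter (· ∈ U) = m := by
        ext v
        by_cases hv : v ∈ U <;> simp [Finsupp.filter_apply, hv, hμ, hm]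
      have h2 : (m + μ).filter (· ∉ U) = μ := by
        ext v
        by_cases hv : v ∈ U <;> simp [Finsupp.filter_apply, hv, hμ, hm]
      rw [if_pos h1, if_pos rfl, h2, coeff_monomial, if_pos rfl]
    · rw [if_neg h]
      by_cases h1 : d.filter (· ∈ U) = m
      · rw [if_pos h1, coeff_monomial, if_neg]
        intro h2
        exact h (by rw [← h1, ← h2, Finsupp.filter_add_filter_not])
      · rw [if_neg h1, coeff_zero]

theorem splitHom_arcPoly {E : Finset (V × V)} (h : ∀ e ∈ E, e.1 ∈ U ∧ e.2 ∈ U) :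
    splitHom R U (arcPoly R E) = arcPoly (MvPolynomial V R) E := by
  rw [arcPoly, map_prod]
  refine prod_congr rfl fun e he => ?_
  rw [map_sub, splitHom_X_of_mem (h e he).1, splitHom_X_of_mem (h e he).2]

theorem splitHom_arcPoly_of_notMem {E : Finset (V × V)} (h : ∀ e ∈ E, e.1 ∉ U ∧ e.2 ∉ U) :
    splitHom R U (arcPoly R E) = C (arcPoly R E) := by
  rw [arcPoly, map_prod, map_prod]
  refine prod_congr rfl fun e he => ?_
  rw [map_sub, splitHom_X_of_notMem (h e he).1, splitHom_X_of_notMem (h e he).2, map_sub]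

theorem splitHom_prod_sub {S : Finset V} (Z : V → R) (h : S ⊆ U) :
    splitHom R U (∏ v ∈ S, (X v - C (Z v))) = ∏ v ∈ S, (X v - C (C (Z v))) := by
  rw [map_prod]
  refine prod_congr rfl fun v hv => ?_
  rw [map_sub, splitHom_X_of_mem (h hv), splitHom_C]

theorem splitHom_prod_sub_of_notMem {S : Finset V} (Z : V → R) (h : ∀ v ∈ S, v ∉ U) :
    splitHom R U (∏ v ∈ S, (X v - C (Z v))) = C (∏ v ∈ S, (X v - C (Z v))) := by
  rw [map_prod, map_prod]
  refine prod_congr rfl fun v hv => ?_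
  rw [map_sub, splitHom_X_of_notMem (h v hv), splitHom_C, map_sub]

end splitHom

/-- The vertices of `K` sent outside `K` by `z`. -/
def extVerts (z : V → V) (K : Finset V) : Finset V := K.filter fun v => z v ∉ K

theorem mem_extVerts {z : V → V} {K : Finset V} {v : V} : v ∈ extVerts z K ↔ v ∈ K ∧ z v ∉ K :=
  mem_filter

/-- The graph polynomial of `G[K]`, multiplied by `X v - Z v` for all `v` with `z v` outside `K`, has
for any two such vertices `a`, `b` a coefficient `± (Z a - Z b)` at a low monomial. -/
def Separating (G : SimpleGraph V) (z : V → V) (n : ℕ) (K : Finset V) : Prop :=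
  ∃ E, Orients E (within G K) ∧ ∀ a ∈ extVerts z K, ∀ b ∈ extVerts z K, a ≠ b →
    ∃ m : V →₀ ℕ, (∀ v, v ∉ K → m v = 0) ∧ (∀ v ∈ K, m v + 1 ≤ n) ∧
      ∃ s : ℤ, (s = 1 ∨ s = -1) ∧ ∀ (R : Type u) [CommRing R] (Z : V → R),
        coeff m (arcPoly R E * ∏ v ∈ extVerts z K, (X v - C (Z v))) = s * (Z a - Z b)

theorem Orients.mem {G : SimpleGraph V} {K : Finset V} {E : Finset (V × V)}
    (hE : Orients E (within G K)) {e : V × V} (he : e ∈ E) : e.1 ∈ K ∧ e.2 ∈ K :=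
  hE.adj he |>.2

section merge

variable {S1 S2 K1 K2 : Finset V} {E1 E2 : Finset (V × V)} {u1 u2 : V}

/-- The polynomial of two joined clusters, with the variables of the second one as coefficients. -/
theorem splitHom_join {R : Type*} [CommRing R] (hK : Disjoint K1 K2) (hS1 : S1 ⊆ K1) (hS2 : S2 ⊆ K2)
    (hE1 : ∀ e ∈ E1, e.1 ∈ K1 ∧ e.2 ∈ K1) (hE2 : ∀ e ∈ E2, e.1 ∈ K2 ∧ e.2 ∈ K2)
    (hu1 : u1 ∈ S1) (hu2 : u2 ∈ S2) (Z : V → R) :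
    splitHom R K1 (arcPoly R E1 * arcPoly R E2 * (X u1 - X u2) *
      ((∏ v ∈ S1.erase u1, (X v - C (Z v))) * ∏ v ∈ S2.erase u2, (X v - C (Z v)))) =
    arcPoly (MvPolynomial V R) E1 *
      (∏ v ∈ S1, (X v - C (Function.update (fun v => C (Z v)) u1 (X u2) v))) *
      C (arcPoly R E2 * ∏ v ∈ S2.erase u2, (X v - C (Z v))) := by
  have hd : ∀ v ∈ K2, v ∉ K1 := fun v hv hv' => disjoint_left.1 hK hv' hv
  rw [map_mul, map_mul, map_mul, map_mul, map_sub, splitHom_arcPoly hE1,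
    splitHom_arcPoly_of_notMem (fun e he => ⟨hd _ (hE2 e he).1, hd _ (hE2 e he).2⟩),
    splitHom_X_of_mem (hS1 hu1), splitHom_X_of_notMem (hd _ (hS2 hu2)),
    splitHom_prod_sub _ ((erase_subset _ _).trans hS1),
    splitHom_prod_sub_of_notMem _ (fun v hv => hd _ (hS2 (mem_of_mem_erase hv))),
    ← mul_prod_erase S1 _ hu1, Function.update_self, map_mul]
  have : ∏ v ∈ S1.erase u1, (X v - C (Function.update (fun v => C (Z v)) u1 (X u2) v)) =
      ∏ v ∈ S1.erase u1, (X v - C (C (Z v)) : MvPolynomial V (MvPolynomial V R)) :=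
    prod_congr rfl fun v hv => by rw [Function.update_of_ne (ne_of_mem_erase hv)]
  rw [this]
  ring

theorem prod_update {R : Type*} [CommRing R] (hu2 : u2 ∈ S2) (Z : V → R) (t : R) :
    ∏ v ∈ S2, (X v - C (Function.update Z u2 t v)) =
      (X u2 - C t) * ∏ v ∈ S2.erase u2, (X v - C (Z v) : MvPolynomial V R) := by
  rw [← mul_prod_erase S2 _ hu2, Function.update_self]
  congr 1
  exact prod_congr rfl fun v hv => by rw [Function.update_of_ne (ne_of_mem_erase hv)]

/-- The joining edge gives the factor X u1 - X u2, which is the factor the first set expects at `u1`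
once `Z u1` is replaced by the variable of `u2`. -/
theorem coeff_join {m1 m2 : V →₀ ℕ} {R : Type u} [CommRing R] (hK : Disjoint K1 K2) (hS1 : S1 ⊆ K1)
    (hS2 : S2 ⊆ K2) (hE1 : ∀ e ∈ E1, e.1 ∈ K1 ∧ e.2 ∈ K1) (hE2 : ∀ e ∈ E2, e.1 ∈ K2 ∧ e.2 ∈ K2)
    (hu1 : u1 ∈ S1) (hu2 : u2 ∈ S2) (hm1 : ∀ v, v ∉ K1 → m1 v = 0) (hm2 : ∀ v, v ∉ K2 → m2 v = 0)
    {a b : V} {s : ℤ}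
    (h1 : ∀ (R : Type u) [CommRing R] (Z : V → R),
      coeff m1 (arcPoly R E1 * ∏ v ∈ S1, (X v - C (Z v))) = s * (Z a - Z b)) (Z : V → R) :
    coeff (m1 + m2) (arcPoly R E1 * arcPoly R E2 * (X u1 - X u2) *
      ((∏ v ∈ S1.erase u1, (X v - C (Z v))) * ∏ v ∈ S2.erase u2, (X v - C (Z v)))) =
    coeff m2 ((s : MvPolynomial V R) * (Function.update (fun v => C (Z v)) u1 (X u2) a -
      Function.update (fun v => C (Z v)) u1 (X u2) b) *
        (arcPoly R E2 * ∏ v ∈ S2.erase u2, (X v - C (Z v)))) := by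
  rw [← coeff_splitHom hm1 (fun v hv => hm2 v (disjoint_left.1 hK hv)),
    splitHom_join hK hS1 hS2 hE1 hE2 hu1 hu2, mul_comm _ (C _), coeff_C_mul, h1, mul_comm]

/-- The first extraction yields a scalar, and the second product lacks its factor at `u2`. Its
coefficient is the difference of `h2` at `Z u2 = 0` and at `Z u2 = 1`, namely `-t`. -/
theorem coeff_join_of_ne {m1 m2 : V →₀ ℕ} {R : Type u} [CommRing R] (hK : Disjoint K1 K2)
    (hS1 : S1 ⊆ K1)
    (hS2 : S2 ⊆ K2) (hE1 : ∀ e ∈ E1, e.1 ∈ K1 ∧ e.2 ∈ K1) (hE2 : ∀ e ∈ E2, e.1 ∈ K2 ∧ e.2 ∈ K2)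
    (hu1 : u1 ∈ S1) (hu2 : u2 ∈ S2) (hm1 : ∀ v, v ∉ K1 → m1 v = 0) (hm2 : ∀ v, v ∉ K2 → m2 v = 0)
    {a b b' : V} {s t : ℤ} (hau : a ≠ u1) (hbu : b ≠ u1) (hb' : b' ≠ u2)
    (h1 : ∀ (R : Type u) [CommRing R] (Z : V → R),
      coeff m1 (arcPoly R E1 * ∏ v ∈ S1, (X v - C (Z v))) = s * (Z a - Z b))
    (h2 : ∀ (R : Type u) [CommRing R] (Z : V → R),
      coeff m2 (arcPoly R E2 * ∏ v ∈ S2, (X v - C (Z v))) = t * (Z u2 - Z b')) (Z : V → R) :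
    coeff (m1 + m2) (arcPoly R E1 * arcPoly R E2 * (X u1 - X u2) *
      ((∏ v ∈ S1.erase u1, (X v - C (Z v))) * ∏ v ∈ S2.erase u2, (X v - C (Z v)))) =
    ((-(s * t) : ℤ) : R) * (Z a - Z b) := by
  rw [coeff_join hK hS1 hS2 hE1 hE2 hu1 hu2 hm1 hm2 h1, Function.update_of_ne hau,
    Function.update_of_ne hbu]
  have e0 := h2 R (Function.update Z u2 0)
  have e1 := h2 R (Function.update Z u2 1)
  rw [prod_update hu2, Function.update_self, Function.update_of_ne hb'] at e0 e1
  have e2 : coeff m2 (arcPoly R E2 * ∏ v ∈ S2.erase u2, (X v - C (Z v))) = (-t : R) := by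
    have : arcPoly R E2 * ∏ v ∈ S2.erase u2, (X v - C (Z v)) =
        arcPoly R E2 * ((X u2 - C 0) * ∏ v ∈ S2.erase u2, (X v - C (Z v))) -
        arcPoly R E2 * ((X u2 - C 1) * ∏ v ∈ S2.erase u2, (X v - C (Z v))) := by
      rw [map_zero, map_one]; ring
    rw [this, coeff_sub, e0, e1]
    ring
  have e3 : (s : MvPolynomial V R) * (C (Z a) - C (Z b)) = C ((s : R) * (Z a - Z b)) := by
    simp
  rw [e3, coeff_C_mul, e2]
  push_cast
  ring

/-- The first extraction leaves `Z a - X u2`, up to sign the missing factor of the second product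
for `Z u2 = Z a`; thus `Z u2 - Z b` turns into `Z a - Z b`. -/
theorem coeff_join_of_mem {m1 m2 : V →₀ ℕ} {R : Type u} [CommRing R] (hK : Disjoint K1 K2)
    (hS1 : S1 ⊆ K1)
    (hS2 : S2 ⊆ K2) (hE1 : ∀ e ∈ E1, e.1 ∈ K1 ∧ e.2 ∈ K1) (hE2 : ∀ e ∈ E2, e.1 ∈ K2 ∧ e.2 ∈ K2)
    (hu1 : u1 ∈ S1) (hu2 : u2 ∈ S2) (hm1 : ∀ v, v ∉ K1 → m1 v = 0) (hm2 : ∀ v, v ∉ K2 → m2 v = 0)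
    {a b : V} {s t : ℤ} (hau : a ≠ u1) (hb : b ≠ u2)
    (h1 : ∀ (R : Type u) [CommRing R] (Z : V → R),
      coeff m1 (arcPoly R E1 * ∏ v ∈ S1, (X v - C (Z v))) = s * (Z a - Z u1))
    (h2 : ∀ (R : Type u) [CommRing R] (Z : V → R),
      coeff m2 (arcPoly R E2 * ∏ v ∈ S2, (X v - C (Z v))) = t * (Z u2 - Z b)) (Z : V → R) :
    coeff (m1 + m2) (arcPoly R E1 * arcPoly R E2 * (X u1 - X u2) *
      ((∏ v ∈ S1.erase u1, (X v - C (Z v))) * ∏ v ∈ S2.erase u2, (X v - C (Z v)))) =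
    ((-(s * t) : ℤ) : R) * (Z a - Z b) := by
  rw [coeff_join hK hS1 hS2 hE1 hE2 hu1 hu2 hm1 hm2 h1, Function.update_of_ne hau,
    Function.update_self]
  have e0 := h2 R (Function.update Z u2 (Z a))
  rw [prod_update hu2, Function.update_self, Function.update_of_ne hb] at e0
  have e1 : (s : MvPolynomial V R) * (C (Z a) - X u2) *
      (arcPoly R E2 * ∏ v ∈ S2.erase u2, (X v - C (Z v))) = C (-(s : R)) *
      (arcPoly R E2 * ((X u2 - C (Z a)) * ∏ v ∈ S2.erase u2, (X v - C (Z v)))) := by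
    simp only [map_neg, map_intCast]
    ring
  rw [e1, coeff_C_mul, e0]
  push_cast
  ring

end merge

variable {G : SimpleGraph V}

theorem orients_join {K1 K2 : Finset V} {E1 E2 : Finset (V × V)} (hK : Disjoint K1 K2)
    (hE1 : Orients E1 (within G K1)) (hE2 : Orients E2 (within G K2)) {u1 u2 : V} (hu1 : u1 ∈ K1)
    (hu2 : u2 ∈ K2) (hadj : ∀ u ∈ K1, ∀ v ∈ K2, G.Adj u v ↔ u = u1 ∧ v = u2) :
    Orients (insert (u1, u2) (E1 ∪ E2)) (within G (K1 ∪ K2)) := by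
  have hd : ∀ v ∈ K2, v ∉ K1 := fun v hv hv' => disjoint_left.1 hK hv' hv
  refine ⟨fun u v => ?_, fun u v => ?_⟩
  · simp only [mem_insert, mem_union, Prod.mk.injEq]
    constructor
    · rintro ⟨h, hu, hv⟩
      rcases mem_union.1 hu with hu | hu <;> rcases mem_union.1 hv with hv | hv
      · have := (hE1.1 u v).1 ⟨h, hu, hv⟩; tauto
      · have := (hadj u hu v hv).1 h; tauto
      · have := (hadj v hv u hu).1 h.symm; tauto
      · have := (hE2.1 u v).1 ⟨h, hu, hv⟩; tauto
    · have key : ∀ u v, (u = u1 ∧ v = u2) ∨ (u, v) ∈ E1 ∨ (u, v) ∈ E2 →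
          (within G (K1 ∪ K2)).Adj u v := by
        rintro u v (⟨rfl, rfl⟩ | h | h)
        · exact ⟨(hadj _ hu1 _ hu2).2 ⟨rfl, rfl⟩, mem_union_left _ hu1, mem_union_right _ hu2⟩
        · have := hE1.adj h
          exact ⟨this.1, mem_union_left _ this.2.1, mem_union_left _ this.2.2⟩
        · have := hE2.adj h
          exact ⟨this.1, mem_union_right _ this.2.1, mem_union_right _ this.2.2⟩
      rintro (h | h)
      · exact key u v h
      · exact (key v u h).symm
  · simp only [mem_insert, mem_union, Prod.mk.injEq]
    have a1 := hE1.2 u v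
    have a2 := hE2.2 u v
    rintro (⟨rfl, rfl⟩ | h | h) (⟨h1, h2⟩ | h' | h')
    · subst h1
      exact hd _ hu2 hu1
    · exact hd _ hu2 (hE1.mem h').1
    · exact hd _ (hE2.mem h').2 hu1
    · subst h1 h2
      exact hd _ hu2 (hE1.mem h).1
    · exact a1 h h'
    · exact hd _ (hE2.mem h').1 (hE1.mem h).2
    · subst h1 h2
      exact hd _ (hE2.mem h).2 hu1
    · exact hd _ (hE2.mem h).1 (hE1.mem h').2
    · exact a2 h h'

/-- Vertices on different sides are handled by `coeff_join_of_mem`. Vertices on the same side need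
`coeff_join_of_ne` with an auxiliary external vertex on the other side, hence the two external
vertices required of each part. -/
theorem Separating.union {z : V → V} {n : ℕ} {K1 K2 : Finset V} (h1 : Separating G z n K1)
    (h2 : Separating G z n K2) (hK : Disjoint K1 K2) {u1 u2 : V}
    (hadj : ∀ u ∈ K1, ∀ v ∈ K2, G.Adj u v ↔ u = u1 ∧ v = u2)
    (hu1 : u1 ∈ extVerts z K1) (hu2 : u2 ∈ extVerts z K2)
    (hc1 : 2 ≤ #(extVerts z K1)) (hc2 : 2 ≤ #(extVerts z K2))
    (hext : extVerts z (K1 ∪ K2) = (extVerts z K1).erase u1 ∪ (extVerts z K2).erase u2) :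
    Separating G z n (K1 ∪ K2) := by
  obtain ⟨E1, hE1, h1⟩ := h1
  obtain ⟨E2, hE2, h2⟩ := h2
  have hS1 : extVerts z K1 ⊆ K1 := filter_subset _ _
  have hS2 : extVerts z K2 ⊆ K2 := filter_subset _ _
  have hd : ∀ v ∈ K2, v ∉ K1 := fun v hv hv' => disjoint_left.1 hK hv' hv
  refine ⟨_, orients_join hK hE1 hE2 (hS1 hu1) (hS2 hu2) hadj, ?_⟩
  have hpoly : ∀ (R : Type u) [CommRing R] (Z : V → R),
      arcPoly R (insert (u1, u2) (E1 ∪ E2)) * ∏ v ∈ extVerts z (K1 ∪ K2), (X v - C (Z v)) =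
      arcPoly R E1 * arcPoly R E2 * (X u1 - X u2) * ((∏ v ∈ (extVerts z K1).erase u1, (X v - C (Z v)))
        * ∏ v ∈ (extVerts z K2).erase u2, (X v - C (Z v))) := by
    intro R _ Z
    have hdE : Disjoint E1 E2 := disjoint_left.2 fun e he he' => hd _ (hE2.mem he').1 (hE1.mem he).1
    have hno : (u1, u2) ∉ E1 ∪ E2 := by
      rw [mem_union]
      rintro (h | h)
      · exact hd _ (hS2 hu2) (hE1.mem h).2
      · exact hd _ (hE2.mem h).1 (hS1 hu1)
    rw [hext, prod_union (disjoint_left.2 fun v hv hv' =>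
      hd _ (hS2 (mem_of_mem_erase hv')) (hS1 (mem_of_mem_erase hv))), ← arcPoly_union R hdE]
    conv_lhs => rw [arcPoly, prod_insert hno]
    rw [arcPoly]
    ring
  have hpoly' : ∀ (R : Type u) [CommRing R] (Z : V → R),
      arcPoly R (insert (u1, u2) (E1 ∪ E2)) * ∏ v ∈ extVerts z (K1 ∪ K2), (X v - C (Z v)) =
      C (-1) * (arcPoly R E2 * arcPoly R E1 * (X u2 - X u1) *
        ((∏ v ∈ (extVerts z K2).erase u2, (X v - C (Z v)))
        * ∏ v ∈ (extVerts z K1).erase u1, (X v - C (Z v)))) := by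
    intro R _ Z
    rw [hpoly, map_neg, map_one]
    ring
  have hsign : ∀ {s t : ℤ}, s = 1 ∨ s = -1 → t = 1 ∨ t = -1 → -(s * t) = 1 ∨ -(s * t) = -1 := by
    rintro s t (rfl | rfl) (rfl | rfl) <;> simp
  have hm0 : ∀ {m1 m2 : V →₀ ℕ}, (∀ v, v ∉ K1 → m1 v = 0) → (∀ v, v ∉ K2 → m2 v = 0) →
      ∀ v, v ∉ K1 ∪ K2 → (m1 + m2) v = 0 := by
    intro m1 m2 hm1 hm2 v hv
    rw [mem_union, not_or] at hv
    simp [hm1 v hv.1, hm2 v hv.2]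
  have hmn : ∀ {m1 m2 : V →₀ ℕ}, (∀ v, v ∉ K1 → m1 v = 0) → (∀ v, v ∉ K2 → m2 v = 0) →
      (∀ v ∈ K1, m1 v + 1 ≤ n) → (∀ v ∈ K2, m2 v + 1 ≤ n) →
      ∀ v ∈ K1 ∪ K2, (m1 + m2) v + 1 ≤ n := by
    intro m1 m2 hm1 hm2 hn1 hn2 v hv
    rcases mem_union.1 hv with h | h
    · simpa [hm2 v (disjoint_left.1 hK h)] using hn1 v h
    · simpa [hm1 v (hd v h)] using hn2 v h
  have mixed : ∀ a ∈ (extVerts z K1).erase u1, ∀ b ∈ (extVerts z K2).erase u2,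
      ∃ m : V →₀ ℕ, (∀ v, v ∉ K1 ∪ K2 → m v = 0) ∧ (∀ v ∈ K1 ∪ K2, m v + 1 ≤ n) ∧
      ∃ s : ℤ, (s = 1 ∨ s = -1) ∧ ∀ (R : Type u) [CommRing R] (Z : V → R),
        coeff m (arcPoly R (insert (u1, u2) (E1 ∪ E2)) *
          ∏ v ∈ extVerts z (K1 ∪ K2), (X v - C (Z v))) = s * (Z a - Z b) := by
    intro a ha b hb
    obtain ⟨hau, ha⟩ := mem_erase.1 ha
    obtain ⟨hbu, hb⟩ := mem_erase.1 hb
    obtain ⟨m1, hm1, hn1, s, hs, h1⟩ := h1 a ha u1 hu1 hau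
    obtain ⟨m2, hm2, hn2, t, ht, h2⟩ := h2 u2 hu2 b hb hbu.symm
    refine ⟨m1 + m2, hm0 hm1 hm2, hmn hm1 hm2 hn1 hn2, -(s * t), hsign hs ht, fun R _ Z => ?_⟩
    rw [hpoly]
    exact coeff_join_of_mem hK hS1 hS2 (fun e => hE1.mem) (fun e => hE2.mem) hu1 hu2 hm1 hm2 hau hbu
      h1 h2 Z
  intro a ha b hb hab
  rw [hext, mem_union] at ha hb
  rcases ha with ha | ha <;> rcases hb with hb | hb
  · obtain ⟨hau, ha⟩ := mem_erase.1 ha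
    obtain ⟨hbu, hb⟩ := mem_erase.1 hb
    obtain ⟨b', hb', hbu'⟩ := exists_mem_ne (by omega : 1 < #(extVerts z K2)) u2
    obtain ⟨m1, hm1, hn1, s, hs, h1⟩ := h1 a ha b hb hab
    obtain ⟨m2, hm2, hn2, t, ht, h2⟩ := h2 u2 hu2 b' hb' hbu'.symm
    refine ⟨m1 + m2, hm0 hm1 hm2, hmn hm1 hm2 hn1 hn2, -(s * t), hsign hs ht, fun R _ Z => ?_⟩
    rw [hpoly]
    exact coeff_join_of_ne hK hS1 hS2 (fun e => hE1.mem) (fun e => hE2.mem) hu1 hu2 hm1 hm2 hau hbu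
      hbu' h1 h2 Z
  · exact mixed a ha b hb
  · obtain ⟨m, hm, hn, s, hs, h⟩ := mixed b hb a ha
    refine ⟨m, hm, hn, -s, by omega, fun R _ Z => ?_⟩
    rw [h]
    push_cast
    ring
  · obtain ⟨hau, ha⟩ := mem_erase.1 ha
    obtain ⟨hbu, hb⟩ := mem_erase.1 hb
    obtain ⟨b', hb', hbu'⟩ := exists_mem_ne (by omega : 1 < #(extVerts z K1)) u1
    obtain ⟨m1, hm1, hn1, s, hs, h1⟩ := h1 u1 hu1 b' hb' hbu'.symm
    obtain ⟨m2, hm2, hn2, t, ht, h2⟩ := h2 a ha b hb hab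
    refine ⟨m1 + m2, hm0 hm1 hm2, hmn hm1 hm2 hn1 hn2, t * s, ?_, fun R _ Z => ?_⟩
    · rcases hs with rfl | rfl <;> rcases ht with rfl | rfl <;> simp
    rw [hpoly', coeff_C_mul, add_comm m1 m2, coeff_join_of_ne hK.symm hS2 hS1 (fun e => hE2.mem)
      (fun e => hE1.mem) hu2 hu1 hm2 hm1 hau hbu hbu' h2 h1 Z]
    push_cast
    ring

end

end AlonTarsi

/-! ### Clusters of big cliques -/

namespace AlonTarsi

open Finset MvPolynomial

universe u

section

variable {V : Type u} [Fintype V] [DecidableEq V] {G : SimpleGraph V} [DecidableRel G.Adj]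
  {n : ℕ} {L : Finset V}

open Classical in
/-- A neighbour of `v` outside the big clique of `v`. -/
noncomputable def extNb (G : SimpleGraph V) (n : ℕ) (L : Finset V) (v : V) : V :=
  if h : ∃ w, G.Adj v w ∧ ¬ SameClique G n L v w then h.choose else v

theorem LowSet.eq_extNb_iff (hL : LowSet G n L) {v : V} (hv : v ∈ cliqueVerts G n L) (u : V) :
    G.Adj v u ∧ ¬ SameClique G n L v u ↔ u = extNb G n L v := by
  obtain ⟨Q, hQ, hvQ⟩ := mem_cliqueVerts.1 hv
  obtain ⟨w, hw⟩ := hL.existsUnique_ext hQ hvQ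
  have hw' : ∀ u, G.Adj v u ∧ ¬ SameClique G n L v u ↔ u = w := fun u => by
    rw [hL.sameClique_iff hQ hvQ, hw]
  have hex : ∃ w, G.Adj v w ∧ ¬ SameClique G n L v w := ⟨w, (hw' w).2 rfl⟩
  have : extNb G n L v = w := by
    rw [extNb, dif_pos hex]
    exact (hw' _).1 hex.choose_spec
  rw [hw', this]

theorem LowSet.adj_extNb (hL : LowSet G n L) {v : V} (hv : v ∈ cliqueVerts G n L) :
    G.Adj v (extNb G n L v) := ((hL.eq_extNb_iff hv _).2 rfl).1

theorem LowSet.not_sameClique_extNb (hL : LowSet G n L) {v : V} (hv : v ∈ cliqueVerts G n L) :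
    ¬ SameClique G n L v (extNb G n L v) := ((hL.eq_extNb_iff hv _).2 rfl).2

theorem LowSet.sum_pairWeight (hL : LowSet G n L) {Q Y : Finset V} (hQ : BigClique G n L Q)
    (hQY : Q ⊆ Y) {v : V} (hv : v ∈ Q) : ∑ u ∈ Y, pairWeight G n L v u =
      ((n : ℝ) - 1) ^ 2 / n + if extNb G n L v ∈ Y then ((n : ℝ) - 1) / 2 else 0 := by
  have hvW : v ∈ cliqueVerts G n L := mem_cliqueVerts.2 ⟨Q, hQ, hv⟩
  have hn : (4 : ℝ) ≤ n := by exact_mod_cast hL.four_le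
  rw [← sum_sdiff hQY, add_comm]
  congr 1
  · rw [← add_sum_erase _ _ hv, pairWeight_of_not_adj (G.irrefl), zero_add,
      sum_congr rfl fun u hu => pairWeight_of_sameClique
        (hQ.2.1 hv (mem_of_mem_erase hu) (ne_of_mem_erase hu).symm)
        ⟨Q, hQ, hv, mem_of_mem_erase hu⟩, sum_const, nsmul_eq_mul, card_erase_of_mem hv, hQ.2.2,
      Nat.cast_sub (by have := hL.four_le; omega)]
    push_cast
    ring
  · have h1 : ∀ u ∈ Y \ Q, pairWeight G n L v u =
        if extNb G n L v = u then ((n : ℝ) - 1) / 2 else 0 := by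
      intro u hu
      have hns : ¬ SameClique G n L v u := by
        rw [hL.sameClique_iff hQ hv]
        exact (mem_sdiff.1 hu).2
      by_cases hadj : G.Adj v u
      · rw [pairWeight_of_mem hadj hns (Or.inl hvW), if_pos ((hL.eq_extNb_iff hvW u).1 ⟨hadj, hns⟩).symm]
      · rw [pairWeight_of_not_adj hadj, if_neg]
        rintro rfl
        exact hadj (hL.adj_extNb hvW)
    rw [sum_congr rfl h1, sum_ite_eq]
    have h2 : extNb G n L v ∉ Q := by
      rw [← hL.sameClique_iff hQ hv]
      exact hL.not_sameClique_extNb hvW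
    simp only [mem_sdiff, h2, not_false_eq_true, and_true]

/-- A union of big cliques. -/
def CliqueClosed (G : SimpleGraph V) (n : ℕ) (L K : Finset V) : Prop :=
  K ⊆ cliqueVerts G n L ∧ ∀ u ∈ K, ∀ v, SameClique G n L u v → v ∈ K

theorem CliqueClosed.exists_subset {K : Finset V} (hK : CliqueClosed G n L K) {v : V} (hv : v ∈ K) :
    ∃ Q, BigClique G n L Q ∧ v ∈ Q ∧ Q ⊆ K := by
  obtain ⟨Q, hQ, hvQ⟩ := mem_cliqueVerts.1 (hK.1 hv)
  exact ⟨Q, hQ, hvQ, fun w hw => hK.2 v hv w ⟨Q, hQ, hvQ, hw⟩⟩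

theorem LowSet.weight_cliqueClosed (hL : LowSet G n L) {K : Finset V} (hK : CliqueClosed G n L K) :
    weight G n L K = #K * (((n : ℝ) - 1) ^ 2 / n) +
      (#K - #(extVerts (extNb G n L) K)) * (((n : ℝ) - 1) / 2) := by
  have h1 : ∀ v ∈ K, ∑ u ∈ K, pairWeight G n L v u =
      ((n : ℝ) - 1) ^ 2 / n + if extNb G n L v ∈ K then ((n : ℝ) - 1) / 2 else 0 := by
    intro v hv
    obtain ⟨Q, hQ, hvQ, hQK⟩ := hK.exists_subset hv
    exact hL.sum_pairWeight hQ hQK hvQ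
  have h2 : (#(K.filter fun v => extNb G n L v ∈ K) : ℝ) =
      #K - #(extVerts (extNb G n L) K) := by
    have := card_filter_add_card_filter_not (s := K) (fun v => extNb G n L v ∈ K)
    rw [eq_sub_iff_add_eq]
    exact_mod_cast this
  rw [weight, sum_congr rfl h1, sum_add_distrib, sum_const, ← sum_filter, sum_const, nsmul_eq_mul,
    nsmul_eq_mul, h2]

/-- Connected unions of big cliques, up to the properties that are used. -/
structure Cluster (G : SimpleGraph V) (n : ℕ) (L K : Finset V) : Prop where
  closed : CliqueClosed G n L K
  nonempty : K.Nonempty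
  weight_eq : weight G n L K = ((n : ℝ) - 1) * (#K - 1)
  separating : Separating G (extNb G n L) n K

/-- Tightness fixes the number of external vertices as for a tree of q cliques: nq vertices, of
which each of the q - 1 joining edges makes two internal. -/
theorem Cluster.card_ext (hL : LowSet G n L) {K : Finset V} (hK : Cluster G n L K) :
    n * (#(extVerts (extNb G n L) K) : ℝ) = (n - 2) * #K + 2 * n := by
  have hn : (4 : ℝ) ≤ n := by exact_mod_cast hL.four_le
  have h1 := hK.weight_eq
  rw [hL.weight_cliqueClosed hK.closed] at h1
  have h2 : ((n : ℝ) - 1) * (n * (#(extVerts (extNb G n L) K) : ℝ)) =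
      (n - 1) * ((n - 2) * #K + 2 * n) := by
    field_simp at h1
    linear_combination -h1
  exact mul_left_cancel₀ (by linarith) h2

theorem Cluster.le_card (hK : Cluster G n L K) : n ≤ #K := by
  obtain ⟨v, hv⟩ := hK.nonempty
  obtain ⟨Q, hQ, -, hQK⟩ := hK.closed.exists_subset hv
  exact hQ.2.2.symm.le.trans (card_le_card hQK)

theorem Cluster.four_le_card_ext (hL : LowSet G n L) {K : Finset V} (hK : Cluster G n L K) :
    4 ≤ #(extVerts (extNb G n L) K) := by
  have hn : (4 : ℝ) ≤ n := by exact_mod_cast hL.four_le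
  have h1 := hK.card_ext hL
  have h2 : (n : ℝ) ≤ #K := by exact_mod_cast hK.le_card
  have h3 : (n : ℝ) ≤ #(extVerts (extNb G n L) K) := by
    have : 0 ≤ ((n : ℝ) - 2) * (#K - n) := mul_nonneg (by linarith) (by linarith)
    refine le_of_mul_le_mul_left (?_ : (n : ℝ) * n ≤ _) (by linarith : (0 : ℝ) < n)
    linarith
  have h4 : n ≤ #(extVerts (extNb G n L) K) := by exact_mod_cast h3
  have := hL.four_le
  omega

theorem LowSet.cluster_bigClique (hL : LowSet G n L) {Q : Finset V} (hQ : BigClique G n L Q) :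
    Cluster G n L Q := by
  have hn : (4 : ℝ) ≤ n := by exact_mod_cast hL.four_le
  have hcl : CliqueClosed G n L Q := ⟨fun v hv => mem_cliqueVerts.2 ⟨Q, hQ, hv⟩,
    fun u hu v h => (hL.sameClique_iff hQ hu v).1 h⟩
  have hext : extVerts (extNb G n L) Q = Q := by
    refine filter_true_of_mem fun v hv => ?_
    rw [← hL.sameClique_iff hQ hv]
    exact hL.not_sameClique_extNb (hcl.1 hv)
  refine ⟨hcl, card_pos.1 (by have := hL.four_le; have := hQ.2.2; omega), ?_, ?_⟩
  · rw [hL.weight_cliqueClosed hcl, hext, hQ.2.2]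
    field_simp
    ring
  · obtain ⟨E, hE⟩ := exists_orients G
    refine ⟨_, hE.arcsIn Q, fun a ha b hb hab => ?_⟩
    rw [hext] at ha hb ⊢
    have := exists_coeff_clique hQ.2.1 (hE.arcsIn Q) ha hb hab
    rwa [hQ.2.2] at this

/-- Both parts are tight, so sparsity of the union leaves room for a cross weight of (n - 1)/2 only,
that of one edge. Hence `u1` and `u2` span the only edge between the parts and the union is tight
again. -/
theorem Cluster.union (hL : LowSet G n L) {K1 K2 : Finset V} (h1 : Cluster G n L K1)
    (h2 : Cluster G n L K2) (hK : Disjoint K1 K2) {u1 u2 : V} (hu1 : u1 ∈ K1) (hu2 : u2 ∈ K2)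
    (hadj : G.Adj u1 u2) : Cluster G n L (K1 ∪ K2) := by
  have hn : (4 : ℝ) ≤ n := by exact_mod_cast hL.four_le
  have hd : ∀ v ∈ K2, v ∉ K1 := fun v hv hv' => disjoint_left.1 hK hv' hv
  have hW1 := h1.closed.1
  have hW2 := h2.closed.1
  have hns : ∀ u ∈ K1, ∀ v ∈ K2, ¬ SameClique G n L u v := fun u hu v hv h =>
    hd v hv (h1.closed.2 u hu v h)
  have hpw : ∀ u ∈ K1, ∀ v ∈ K2, G.Adj u v → pairWeight G n L u v = ((n : ℝ) - 1) / 2 :=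
    fun u hu v hv h => pairWeight_of_mem h (hns u hu v hv) (Or.inl (hW1 hu))
  have hwu := weight_union (G := G) (n := n) (L := L) hK
  rw [h1.weight_eq, h2.weight_eq] at hwu
  have hle := hL.weight_le (X := K1 ∪ K2)
    (union_subset (hW1.trans cliqueVerts_subset) (hW2.trans cliqueVerts_subset))
    (h1.nonempty.mono subset_union_left)
  have hcard : (#(K1 ∪ K2) : ℝ) = #K1 + #K2 := by exact_mod_cast card_union_of_disjoint hK
  have hsum : ∑ u ∈ K1, ∑ v ∈ K2, pairWeight G n L u v ≤ ((n : ℝ) - 1) / 2 := by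
    rw [hwu, hcard] at hle
    linarith
  rw [← sum_product'] at hsum
  have hnn : ∀ p ∈ K1 ×ˢ K2, 0 ≤ pairWeight G n L p.1 p.2 := fun p _ =>
    pairWeight_nonneg hL.four_le _ _
  have hmem : (u1, u2) ∈ K1 ×ˢ K2 := mem_product.2 ⟨hu1, hu2⟩
  have hone := single_le_sum hnn hmem
  simp only [hpw u1 hu1 u2 hu2 hadj] at hone
  have huniq : ∀ u ∈ K1, ∀ v ∈ K2, G.Adj u v ↔ u = u1 ∧ v = u2 := by
    intro u hu v hv
    constructor
    · intro h
      by_contra hne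
      have hne' : (u, v) ≠ (u1, u2) := by simpa only [ne_eq, Prod.mk.injEq] using hne
      have hsub : ({(u, v), (u1, u2)} : Finset (V × V)) ⊆ K1 ×ˢ K2 := by
        intro p hp
        rcases mem_insert.1 hp with rfl | hp
        · exact mem_product.2 ⟨hu, hv⟩
        · rw [mem_singleton.1 hp]; exact hmem
      have := sum_le_sum_of_subset_of_nonneg hsub fun p hp _ => hnn p hp
      rw [sum_pair hne', hpw u hu v hv h, hpw u1 hu1 u2 hu2 hadj] at this
      linarith
    · rintro ⟨rfl, rfl⟩
      exact hadj
  have hz1 : extNb G n L u1 = u2 :=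
    ((hL.eq_extNb_iff (hW1 hu1) u2).1 ⟨hadj, hns _ hu1 _ hu2⟩).symm
  have hz2 : extNb G n L u2 = u1 :=
    ((hL.eq_extNb_iff (hW2 hu2) u1).1 ⟨hadj.symm, fun h => hns _ hu1 _ hu2 h.symm⟩).symm
  refine ⟨⟨union_subset hW1 hW2, fun u hu v h => ?_⟩, h1.nonempty.mono subset_union_left, ?_, ?_⟩
  · rcases mem_union.1 hu with hu | hu
    · exact mem_union_left _ (h1.closed.2 u hu v h)
    · exact mem_union_right _ (h2.closed.2 u hu v h)
  · rw [hwu, ← sum_product', le_antisymm hsum hone, hcard]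
    ring
  · refine h1.separating.union h2.separating hK huniq
      (mem_extVerts.2 ⟨hu1, hz1 ▸ hd _ hu2⟩)
      (mem_extVerts.2 ⟨hu2, hz2 ▸ disjoint_left.1 hK hu1⟩)
      ((by norm_num : 2 ≤ 4).trans (h1.four_le_card_ext hL))
      ((by norm_num : 2 ≤ 4).trans (h2.four_le_card_ext hL)) ?_
    ext v
    simp only [mem_extVerts, mem_union, mem_erase, not_or]
    constructor
    · rintro ⟨h | h, hz⟩
      · refine Or.inl ⟨?_, h, hz.1⟩
        rintro rfl
        exact hz.2 (hz1 ▸ hu2)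
      · refine Or.inr ⟨?_, h, hz.2⟩
        rintro rfl
        exact hz.1 (hz2 ▸ hu1)
    · rintro (⟨hne, h, hz⟩ | ⟨hne, h, hz⟩)
      · exact ⟨Or.inl h, hz, fun hz' => hne ((huniq v h _ hz').1 (hL.adj_extNb (hW1 h))).1⟩
      · exact ⟨Or.inr h, fun hz' => hne ((huniq _ hz' v h).1 (hL.adj_extNb (hW2 h)).symm).2, hz⟩

/-- The vertices in big cliques split into pairwise nonadjacent clusters. -/
theorem LowSet.exists_clusters (hL : LowSet G n L) : ∃ 𝒦 : Finset (Finset V),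
    (∀ K ∈ 𝒦, Cluster G n L K) ∧ (∀ K ∈ 𝒦, ∀ K' ∈ 𝒦, K ≠ K' → Disjoint K K') ∧
    𝒦.biUnion id = cliqueVerts G n L ∧
    ∀ K ∈ 𝒦, ∀ K' ∈ 𝒦, K ≠ K' → ∀ u ∈ K, ∀ v ∈ K', ¬ G.Adj u v := by
  classical
  let S := (univ : Finset (Finset (Finset V))).filter fun 𝒦 => (∀ K ∈ 𝒦, Cluster G n L K) ∧
    (∀ K ∈ 𝒦, ∀ K' ∈ 𝒦, K ≠ K' → Disjoint K K') ∧ 𝒦.biUnion id = cliqueVerts G n L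
  have hS : S.Nonempty := by
    refine ⟨univ.filter fun Q => BigClique G n L Q, mem_filter.2 ⟨mem_univ _, ?_, ?_, ?_⟩⟩
    · exact fun K hK => hL.cluster_bigClique (mem_filter.1 hK).2
    · intro K hK K' hK' hne
      refine disjoint_left.2 fun v hv hv' => hne ?_
      exact hL.bigClique_eq (mem_filter.1 hK).2 (mem_filter.1 hK').2 hv hv'
    · ext v
      simp only [mem_biUnion, mem_filter, mem_univ, true_and, id, mem_cliqueVerts]
  -- A partition into the fewest clusters: two adjacent ones could be merged.
  obtain ⟨𝒦, h𝒦, hmin⟩ := exists_min_image S card hS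
  obtain ⟨-, hcl, hdis, hun⟩ := mem_filter.1 h𝒦
  refine ⟨𝒦, hcl, hdis, hun, fun K hK K' hK' hne u hu v hv hadj => ?_⟩
  have hnew := (hcl K hK).union hL (hcl K' hK') (hdis K hK K' hK' hne) hu hv hadj
  have hK'e : K' ∈ 𝒦.erase K := mem_erase.2 ⟨hne.symm, hK'⟩
  have := hmin (insert (K ∪ K') ((𝒦.erase K).erase K')) (mem_filter.2 ⟨mem_univ _, ?_, ?_, ?_⟩)
  · have h1 := card_insert_le (K ∪ K') ((𝒦.erase K).erase K')
    have h2 := card_erase_add_one hK'e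
    have h3 := card_erase_add_one hK
    omega
  · intro M hM
    rcases mem_insert.1 hM with rfl | hM
    · exact hnew
    · exact hcl M (mem_of_mem_erase (mem_of_mem_erase hM))
  · have key : ∀ M ∈ (𝒦.erase K).erase K', Disjoint (K ∪ K') M := by
      intro M hM
      obtain ⟨hM1, hM⟩ := mem_erase.1 hM
      obtain ⟨hM2, hM⟩ := mem_erase.1 hM
      exact disjoint_union_left.2 ⟨hdis _ hK _ hM (Ne.symm hM2), hdis _ hK' _ hM (Ne.symm hM1)⟩
    intro M hM M' hM' hne'
    rcases mem_insert.1 hM with rfl | hM <;> rcases mem_insert.1 hM' with rfl | hM'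
    · exact absurd rfl hne'
    · exact key _ hM'
    · exact (key _ hM).symm
    · exact hdis M (mem_of_mem_erase (mem_of_mem_erase hM)) M' (mem_of_mem_erase (mem_of_mem_erase hM'))
        hne'
  · rw [← hun]
    conv_rhs => rw [← insert_erase hK, ← insert_erase hK'e]
    simp only [biUnion_insert, id, union_assoc]

end

end AlonTarsi

/-! ### Coefficients obtained by selecting two outer neighbours per cluster -/

namespace AlonTarsi

open Finset MvPolynomial

universe u

section

variable {V : Type u} [Fintype V] [DecidableEq V]

theorem eq_zero_of_mem_supported {R : Type*} [CommRing R] {S : Set V} {F : MvPolynomial V R}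
    (hF : F ∈ supported R S) {m : V →₀ ℕ} (hm : coeff m F ≠ 0) {v : V} (hv : v ∉ S) : m v = 0 :=
  mem_support_notMem_vars_zero (mem_support_iff.2 hm) fun h => hv (mem_supported.1 hF h)

theorem arcPoly_mem_supported {R : Type*} [CommRing R] [Nontrivial R] {S : Set V}
    {E : Finset (V × V)} (h : ∀ e ∈ E, e.1 ∈ S ∧ e.2 ∈ S) : arcPoly R E ∈ supported R S :=
  Subalgebra.prod_mem _ fun e he =>
    Subalgebra.sub_mem _ (X_mem_supported.2 (h e he).1) (X_mem_supported.2 (h e he).2)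

theorem prod_sub_mem_supported {R : Type*} [CommRing R] [Nontrivial R] {S : Set V} {T : Finset V}
    (h : ∀ v ∈ T, v ∈ S) (Z : V → R) : ∏ v ∈ T, (X v - C (Z v)) ∈ supported R S :=
  Subalgebra.prod_mem _ fun v hv =>
    Subalgebra.sub_mem _ (X_mem_supported.2 (h v hv)) (Subalgebra.algebraMap_mem _ (Z v))

theorem coeff_prod_of_disjoint {R : Type*} [CommRing R] {ι : Type*} [DecidableEq ι] (𝒜 : Finset ι)
    (S : ι → Finset V) (F : ι → MvPolynomial V R) (m : ι → V →₀ ℕ)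
    (hd : ∀ i ∈ 𝒜, ∀ j ∈ 𝒜, i ≠ j → Disjoint (S i) (S j))
    (hF : ∀ i ∈ 𝒜, F i ∈ supported R (S i : Set V)) (hm : ∀ i ∈ 𝒜, ∀ v, v ∉ S i → m i v = 0) :
    coeff (∑ i ∈ 𝒜, m i) (∏ i ∈ 𝒜, F i) = ∏ i ∈ 𝒜, coeff (m i) (F i) := by
  induction 𝒜 using Finset.induction_on with
  | empty => simp
  | insert i 𝒜 hi ih =>
    have ih := ih (fun a ha b hb => hd a (mem_insert_of_mem ha) b (mem_insert_of_mem hb))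
      (fun a ha => hF a (mem_insert_of_mem ha)) (fun a ha => hm a (mem_insert_of_mem ha))
    rw [sum_insert hi, prod_insert hi, prod_insert hi, ← ih]
    apply coeff_mul_of_unique
    intro a b hab ha hb
    have hprod : ∏ j ∈ 𝒜, F j ∈ supported R ((S i : Set V)ᶜ) := by
      refine Subalgebra.prod_mem _ fun j hj => supported_mono ?_ (hF j (mem_insert_of_mem hj))
      intro v hv hv'
      refine disjoint_left.1 (hd i (mem_insert_self _ _) j (mem_insert_of_mem hj) ?_) hv' hv
      rintro rfl
      exact hi hj
    ext v
    by_cases hv : v ∈ S i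
    · have h1 : b v = 0 := eq_zero_of_mem_supported hprod hb (by simpa using hv)
      have h2 : (∑ j ∈ 𝒜, m j) v = 0 := by
        rw [Finsupp.finsetSum_apply]
        refine sum_eq_zero fun j hj => hm j (mem_insert_of_mem hj) v fun hv' => ?_
        refine disjoint_left.1 (hd i (mem_insert_self _ _) j (mem_insert_of_mem hj) ?_) hv hv'
        rintro rfl
        exact hi hj
      have h3 := DFunLike.congr_fun hab v
      rw [Finsupp.add_apply, Finsupp.add_apply, h1, h2] at h3
      exact h3
    · rw [eq_zero_of_mem_supported (hF i (mem_insert_self _ _)) ha hv,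
        hm i (mem_insert_self _ _) v hv]

/-- The variable of `z v` if `z v ∈ B`, and zero otherwise. -/
noncomputable def extVar (z : V → V) (B : Finset V) (v : V) : MvPolynomial V ℤ :=
  if z v ∈ B then X (z v) else 0

theorem degreeOf_extVar (z : V → V) (B : Finset V) (v y : V) :
    degreeOf y (extVar z B v) ≤ if z v = y then 1 else 0 := by
  unfold extVar
  by_cases h : z v ∈ B
  · rw [if_pos h, degreeOf_X]
    simp only [eq_comm, le_refl]
  · rw [if_neg h]
    simp

theorem extVar_mem_supported (z : V → V) (B : Finset V) (v : V) :
    extVar z B v ∈ supported ℤ (B : Set V) := by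
  unfold extVar
  split_ifs with h
  · exact X_mem_supported.2 h
  · exact Subalgebra.zero_mem _

theorem extVar_sub_ne_zero {z : V → V} {B : Finset V} {a b : V} (ha : z a ∈ B) (hab : z b ≠ z a) :
    extVar z B a - extVar z B b ≠ 0 := by
  unfold extVar
  rw [if_pos ha]
  split_ifs with h
  · exact sub_ne_zero.2 fun he => hab (X_injective he).symm
  · rw [sub_zero]
    exact X_ne_zero _

/-- The arcs of several clusters together with a set `B` of outer vertices. -/
def clusterArcs (𝒜 : Finset (Finset V)) (E : Finset V → Finset (V × V)) (z : V → V) (B : Finset V)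
    (EB : Finset (V × V)) : Finset (V × V) :=
  𝒜.biUnion E ∪ EB ∪ ((𝒜.biUnion id).filter fun v => z v ∈ B).image fun v => (v, z v)

section

variable {G : SimpleGraph V} {𝒜 : Finset (Finset V)} {E : Finset V → Finset (V × V)} {z : V → V}
  {B : Finset V} {EB : Finset (V × V)}

theorem mem_clusterArcs {u v : V} : (u, v) ∈ clusterArcs 𝒜 E z B EB ↔
    (∃ K ∈ 𝒜, (u, v) ∈ E K) ∨ (u, v) ∈ EB ∨ ((∃ K ∈ 𝒜, u ∈ K) ∧ z u = v ∧ v ∈ B) := by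
  simp only [clusterArcs, mem_union, mem_biUnion, mem_image, mem_filter, id, Prod.mk.injEq, or_assoc]
  refine or_congr Iff.rfl (or_congr Iff.rfl ⟨?_, ?_⟩)
  · rintro ⟨w, ⟨h1, h2⟩, rfl, rfl⟩
    exact ⟨h1, rfl, h2⟩
  · rintro ⟨h1, rfl, h2⟩
    exact ⟨u, ⟨h1, h2⟩, rfl, rfl⟩

theorem orients_clusterArcs (hd : ∀ K ∈ 𝒜, ∀ K' ∈ 𝒜, K ≠ K' → Disjoint K K')
    (hno : ∀ K ∈ 𝒜, ∀ K' ∈ 𝒜, K ≠ K' → ∀ u ∈ K, ∀ v ∈ K', ¬ G.Adj u v)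
    (hUB : ∀ K ∈ 𝒜, ∀ v ∈ K, v ∉ B) (hz : ∀ K ∈ 𝒜, ∀ v ∈ K, ∀ y ∈ B, G.Adj v y ↔ z v = y)
    (hE : ∀ K ∈ 𝒜, Orients (E K) (within G K)) (hEB : Orients EB (within G B)) :
    Orients (clusterArcs 𝒜 E z B EB) (within G (𝒜.biUnion id ∪ B)) := by
  have hEm : ∀ {K}, K ∈ 𝒜 → ∀ {u v}, (u, v) ∈ E K → u ∈ K ∧ v ∈ K := fun hK _ _ h => (hE _ hK).mem h
  have hEBm : ∀ {u v}, (u, v) ∈ EB → u ∈ B ∧ v ∈ B := fun h => hEB.mem h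
  refine ⟨fun u v => ?_, fun u v => ?_⟩
  · rw [mem_clusterArcs, mem_clusterArcs]
    constructor
    · rintro ⟨h, hu, hv⟩
      simp only [mem_union, mem_biUnion, id] at hu hv
      rcases hu with ⟨K, hK, hu⟩ | hu <;> rcases hv with ⟨K', hK', hv⟩ | hv
      · have hKK : K = K' := by
          by_contra hne
          exact hno K hK K' hK' hne u hu v hv h
        subst hKK
        exact (((hE K hK).1 u v).1 ⟨h, hu, hv⟩).imp (fun h => Or.inl ⟨K, hK, h⟩)
          (fun h => Or.inl ⟨K, hK, h⟩)
      · exact Or.inl (Or.inr (Or.inr ⟨⟨K, hK, hu⟩, (hz K hK u hu v hv).1 h, hv⟩))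
      · exact Or.inr (Or.inr (Or.inr ⟨⟨K', hK', hv⟩, (hz K' hK' v hv u hu).1 h.symm, hu⟩))
      · exact ((hEB.1 u v).1 ⟨h, hu, hv⟩).imp (fun h => Or.inr (Or.inl h)) (fun h => Or.inr (Or.inl h))
    · have key : ∀ u v, ((∃ K ∈ 𝒜, (u, v) ∈ E K) ∨ (u, v) ∈ EB ∨
          ((∃ K ∈ 𝒜, u ∈ K) ∧ z u = v ∧ v ∈ B)) → (within G (𝒜.biUnion id ∪ B)).Adj u v := by
        rintro u v (⟨K, hK, h⟩ | h | ⟨⟨K, hK, h⟩, hzu, hv⟩)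
        · have := (hE K hK).adj h
          exact ⟨this.1, mem_union_left _ (mem_biUnion.2 ⟨K, hK, this.2.1⟩),
            mem_union_left _ (mem_biUnion.2 ⟨K, hK, this.2.2⟩)⟩
        · have := hEB.adj h
          exact ⟨this.1, mem_union_right _ this.2.1, mem_union_right _ this.2.2⟩
        · exact ⟨(hz K hK u h v hv).2 hzu, mem_union_left _ (mem_biUnion.2 ⟨K, hK, h⟩),
            mem_union_right _ hv⟩
      rintro (h | h)
      · exact key u v h
      · exact (key v u h).symm
  · rw [mem_clusterArcs, mem_clusterArcs]
    rintro (⟨K, hK, h⟩ | h | ⟨⟨K, hK, h⟩, hzu, hv⟩) (⟨K', hK', h'⟩ | h' | ⟨⟨K', hK', h'⟩, hzu', hv'⟩)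
    · have hKK : K = K' := by
        by_contra hne
        exact disjoint_left.1 (hd K hK K' hK' hne) (hEm hK h).1 (hEm hK' h').2
      subst hKK
      exact (hE K hK).2 _ _ h h'
    · exact hUB K hK _ (hEm hK h).1 (hEBm h').2
    · exact hUB K hK _ (hEm hK h).1 hv'
    · exact hUB K' hK' _ (hEm hK' h').1 (hEBm h).2
    · exact hEB.2 _ _ h h'
    · exact hUB K' hK' _ h' (hEBm h).2
    · exact hUB K' hK' _ (hEm hK' h').1 hv
    · exact hUB K hK _ h (hEBm h').2
    · exact hUB K hK _ h hv'

theorem arcPoly_clusterArcs (hd : ∀ K ∈ 𝒜, ∀ K' ∈ 𝒜, K ≠ K' → Disjoint K K')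
    (hUB : ∀ K ∈ 𝒜, ∀ v ∈ K, v ∉ B)
    (hE : ∀ K ∈ 𝒜, ∀ e ∈ E K, e.1 ∈ K ∧ e.2 ∈ K) (hEB : ∀ e ∈ EB, e.1 ∈ B ∧ e.2 ∈ B) :
    arcPoly ℤ (clusterArcs 𝒜 E z B EB) =
      (∏ K ∈ 𝒜, arcPoly ℤ (E K)) * arcPoly ℤ EB *
        ∏ v ∈ (𝒜.biUnion id).filter fun v => z v ∈ B, (X v - X (z v)) := by
  rw [clusterArcs, arcPoly_union, arcPoly_union]
  · congr 1
    · congr 1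
      rw [arcPoly, prod_biUnion]
      · rfl
      · intro K hK K' hK' hne
        refine disjoint_left.2 fun e he he' => ?_
        exact disjoint_left.1 (hd K hK K' hK' hne) (hE K hK e he).1 (hE K' hK' e he').1
    · rw [arcPoly, prod_image fun v _ w _ h => (Prod.mk.inj h).1]
  · refine disjoint_left.2 fun e he he' => ?_
    obtain ⟨K, hK, he⟩ := mem_biUnion.1 he
    exact hUB K hK _ (hE K hK e he).1 (hEB e he').1
  · refine disjoint_left.2 fun e he he' => ?_
    obtain ⟨v, hv, rfl⟩ := mem_image.1 he'
    obtain ⟨hv, hzv⟩ := mem_filter.1 hv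
    obtain ⟨K, hK, hvK⟩ := mem_biUnion.1 hv
    rcases mem_union.1 he with he | he
    · obtain ⟨K', hK', he⟩ := mem_biUnion.1 he
      exact hUB K' hK' _ (hE K' hK' _ he).2 hzv
    · exact hUB K hK _ hvK (hEB _ he).1

/-- An external vertex `v` attached outside `B` has no factor for its outer edge; supplying X v is
the case Z v = 0. Dividing these variables out again leaves one unit of slack at such vertices. -/
theorem arcPoly_clusterArcs_mul (hd : ∀ K ∈ 𝒜, ∀ K' ∈ 𝒜, K ≠ K' → Disjoint K K')
    (hUB : ∀ K ∈ 𝒜, ∀ v ∈ K, v ∉ B)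
    (hE : ∀ K ∈ 𝒜, ∀ e ∈ E K, e.1 ∈ K ∧ e.2 ∈ K) (hEB : ∀ e ∈ EB, e.1 ∈ B ∧ e.2 ∈ B) :
    arcPoly ℤ (clusterArcs 𝒜 E z B EB) *
      ∏ v ∈ (𝒜.biUnion (extVerts z)).filter fun v => z v ∉ B, X v =
      (∏ K ∈ 𝒜, (arcPoly ℤ (E K) * ∏ v ∈ extVerts z K, (X v - extVar z B v))) * arcPoly ℤ EB := by
  have h1 : (𝒜.biUnion id).filter (fun v => z v ∈ B) =
      (𝒜.biUnion (extVerts z)).filter fun v => z v ∈ B := by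
    ext v
    simp only [mem_filter, mem_biUnion, id, mem_extVerts]
    constructor
    · rintro ⟨⟨K, hK, hv⟩, hz⟩
      exact ⟨⟨K, hK, hv, fun h => hUB K hK _ h hz⟩, hz⟩
    · rintro ⟨⟨K, hK, hv, -⟩, hz⟩
      exact ⟨⟨K, hK, hv⟩, hz⟩
  have h2 : ∏ K ∈ 𝒜, ∏ v ∈ extVerts z K, (X v - extVar z B v) =
      ∏ v ∈ 𝒜.biUnion (extVerts z), (X v - extVar z B v) := by
    rw [prod_biUnion]
    intro K hK K' hK' hne
    exact disjoint_of_subset_left (filter_subset _ _)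
      (disjoint_of_subset_right (filter_subset _ _) (hd K hK K' hK' hne))
  have h3 : ∏ v ∈ (𝒜.biUnion (extVerts z)).filter (fun v => z v ∈ B), (X v - extVar z B v) =
      ∏ v ∈ (𝒜.biUnion (extVerts z)).filter (fun v => z v ∈ B), (X v - X (z v)) :=
    prod_congr rfl fun v hv => by rw [extVar, if_pos (mem_filter.1 hv).2]
  have h4 : ∏ v ∈ (𝒜.biUnion (extVerts z)).filter (fun v => ¬ z v ∈ B), (X v - extVar z B v) =
      ∏ v ∈ (𝒜.biUnion (extVerts z)).filter (fun v => z v ∉ B), X v :=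
    prod_congr rfl fun v hv => by rw [extVar, if_neg (mem_filter.1 hv).2, sub_zero]
  rw [arcPoly_clusterArcs hd hUB hE hEB, h1, prod_mul_distrib, h2,
    ← prod_filter_mul_prod_filter_not (𝒜.biUnion (extVerts z)) (fun v => z v ∈ B)
      (fun v => X v - extVar z B v), h3, h4]
  ring

theorem splitHom_clusters {U : Finset V} (hKU : ∀ K ∈ 𝒜, K ⊆ U) (hUB : ∀ v ∈ U, v ∉ B)
    (hE : ∀ K ∈ 𝒜, ∀ e ∈ E K, e.1 ∈ K ∧ e.2 ∈ K) (hEB : ∀ e ∈ EB, e.1 ∈ B ∧ e.2 ∈ B) :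
    splitHom ℤ U ((∏ K ∈ 𝒜, (arcPoly ℤ (E K) * ∏ v ∈ extVerts z K, (X v - extVar z B v))) *
      arcPoly ℤ EB) =
    (∏ K ∈ 𝒜, (arcPoly (MvPolynomial V ℤ) (E K) *
      ∏ v ∈ extVerts z K, (X v - C (extVar z B v)))) * C (arcPoly ℤ EB) := by
  have hB : ∀ v ∈ B, v ∉ U := fun v hv hv' => hUB v hv' hv
  rw [map_mul, splitHom_arcPoly_of_notMem fun e he => ⟨hB _ (hEB e he).1, hB _ (hEB e he).2⟩, map_prod]
  congr 1
  refine prod_congr rfl fun K hK => ?_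
  rw [map_mul, splitHom_arcPoly fun e he => ⟨hKU K hK (hE K hK e he).1, hKU K hK (hE K hK e he).2⟩,
    map_prod]
  congr 1
  refine prod_congr rfl fun v hv => ?_
  rw [map_sub, splitHom_X_of_mem (hKU K hK (mem_filter.1 hv).1), extVar]
  congr 1
  split_ifs with h
  · rw [splitHom_X_of_notMem (hB _ h)]
  · rw [map_zero, map_zero]

end

theorem coeff_arcPoly_le {G : SimpleGraph V} [DecidableRel G.Adj] {B : Finset V}
    {E : Finset (V × V)} (hE : Orients E (within G B)) {m : V →₀ ℕ}
    (hm : coeff m (arcPoly ℤ E) ≠ 0) {y : V} (hy : y ∈ B) : m y ≤ #(nb G B y) := by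
  obtain ⟨S, hS, rfl⟩ := exists_subset_of_coeff_ne_zero hm
  rw [arcExp_apply, ← outs_add_ins hE hy]
  exact add_le_add (card_le_card (filter_subset_filter _ sdiff_subset))
    (card_le_card (filter_subset_filter _ hS))

theorem sum_single_apply' (S : Finset V) (w : V) :
    (∑ v ∈ S, Finsupp.single v 1 : V →₀ ℕ) w = if w ∈ S then 1 else 0 := by
  rw [Finsupp.finsetSum_apply]
  simp [Finsupp.single_apply]

/-- The coefficient produced by a selection of two outer neighbours in each cluster. -/
theorem exists_coeff_of_selection {G : SimpleGraph V} [DecidableRel G.Adj] {n : ℕ} {z : V → V}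
    {𝒜 : Finset (Finset V)} {B : Finset V}
    (hd : ∀ K ∈ 𝒜, ∀ K' ∈ 𝒜, K ≠ K' → Disjoint K K')
    (hno : ∀ K ∈ 𝒜, ∀ K' ∈ 𝒜, K ≠ K' → ∀ u ∈ K, ∀ v ∈ K', ¬ G.Adj u v)
    (hUB : ∀ K ∈ 𝒜, ∀ v ∈ K, v ∉ B) (hz : ∀ K ∈ 𝒜, ∀ v ∈ K, ∀ y ∈ B, G.Adj v y ↔ z v = y)
    (hsep : ∀ K ∈ 𝒜, Separating G z n K) (a b : Finset V → V)
    (ha : ∀ K ∈ 𝒜, a K ∈ extVerts z K) (haB : ∀ K ∈ 𝒜, z (a K) ∈ B)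
    (hb : ∀ K ∈ 𝒜, b K ∈ extVerts z K) (hab : ∀ K ∈ 𝒜, z (b K) ≠ z (a K)) :
    ∃ E, Orients E (within G (𝒜.biUnion id ∪ B)) ∧ ∃ m : V →₀ ℕ, coeff m (arcPoly ℤ E) ≠ 0 ∧
      (∀ K ∈ 𝒜, ∀ v ∈ K, m v + 1 ≤ n ∧ (v ∈ extVerts z K → z v ∉ B → m v + 2 ≤ n)) ∧
      ∀ y ∈ B, m y ≤ #(𝒜.filter fun K => z (a K) = y) + #(𝒜.filter fun K => z (b K) = y) +
        #(nb G B y) := by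
  obtain ⟨E0, hE0⟩ := exists_orients G
  have hEB := hE0.arcsIn B
  set EB := arcsIn E0 B
  choose! E hE hsep using hsep
  have hne : ∀ K ∈ 𝒜, a K ≠ b K := fun K hK h => hab K hK (by rw [h])
  have hsep' := fun K hK => hsep K hK (a K) (ha K hK) (b K) (hb K hK) (hne K hK)
  choose! m hm0 hmn s hs hcoeff using hsep'
  have hEm : ∀ K ∈ 𝒜, ∀ e ∈ E K, e.1 ∈ K ∧ e.2 ∈ K := fun K hK e he => (hE K hK).mem he
  have hEBm : ∀ e ∈ EB, e.1 ∈ B ∧ e.2 ∈ B := fun e he => hEB.mem he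
  refine ⟨_, orients_clusterArcs hd hno hUB hz hE hEB, ?_⟩
  set U := 𝒜.biUnion id with hU
  have hKU : ∀ K ∈ 𝒜, K ⊆ U := fun K hK v hv => mem_biUnion.2 ⟨K, hK, hv⟩
  have hUB' : ∀ v ∈ U, v ∉ B := fun v hv => by
    obtain ⟨K, hK, hv⟩ := mem_biUnion.1 hv
    exact hUB K hK v hv
  set Fr := (𝒜.biUnion (extVerts z)).filter fun v => z v ∉ B with hFr
  set M := ∑ K ∈ 𝒜, m K with hM
  have hMv : ∀ K ∈ 𝒜, ∀ v ∈ K, M v = m K v := by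
    intro K hK v hv
    rw [hM, Finsupp.finsetSum_apply]
    refine sum_eq_single_of_mem K hK fun K' hK' hne => hm0 K' hK' v fun hv' => ?_
    exact disjoint_left.1 (hd K' hK' K hK hne) hv' hv
  have hM0 : ∀ v, v ∉ U → M v = 0 := by
    intro v hv
    rw [hM, Finsupp.finsetSum_apply]
    exact sum_eq_zero fun K hK => hm0 K hK v fun hv' => hv (hKU K hK hv')
  set F := ∏ K ∈ 𝒜, ((s K : MvPolynomial V ℤ) * (extVar z B (a K) - extVar z B (b K))) with hF
  -- Fixing the monomial `M` in the cluster variables leaves a product of differences in the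
  -- variables of `B`, times the polynomial of G[B]. It is nonzero, being a product of nonzero
  -- factors in a domain, so some monomial `μ` survives.
  have hT : coeff M (splitHom ℤ U ((∏ K ∈ 𝒜, (arcPoly ℤ (E K) * ∏ v ∈ extVerts z K,
      (X v - extVar z B v))) * arcPoly ℤ EB)) = F * arcPoly ℤ EB := by
    rw [splitHom_clusters hKU hUB' hEm hEBm, mul_comm _ (C _), coeff_C_mul, mul_comm,
      coeff_prod_of_disjoint 𝒜 id _ m hd (fun K hK => ?_) hm0]
    · congr 1
      exact prod_congr rfl fun K hK => hcoeff K hK _ _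
    · exact Subalgebra.mul_mem _ (arcPoly_mem_supported (hEm K hK))
        (prod_sub_mem_supported (fun v hv => (mem_filter.1 hv).1) _)
  have hF0 : F ≠ 0 := by
    refine prod_ne_zero_iff.2 fun K hK => mul_ne_zero ?_ (extVar_sub_ne_zero (haB K hK) (hab K hK))
    rcases hs K hK with h | h <;> simp [h]
  obtain ⟨μ, hμ⟩ := MvPolynomial.ne_zero_iff.1
    (mul_ne_zero hF0 (arcPoly_ne_zero (R := ℤ) fun e he => hEB.ne he))
  obtain ⟨μ1, μ2, hμs, hμ1, hμ2⟩ := exists_coeff_ne_zero_of_mul hμ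
  have hμB : ∀ v, v ∉ B → μ v = 0 := by
    intro v hv
    have h1 : F ∈ supported ℤ (B : Set V) := Subalgebra.prod_mem _ fun K _ =>
      Subalgebra.mul_mem _ (intCast_mem _ _) (Subalgebra.sub_mem _ (extVar_mem_supported _ _ _)
        (extVar_mem_supported _ _ _))
    rw [← hμs, Finsupp.add_apply, eq_zero_of_mem_supported h1 hμ1 hv,
      eq_zero_of_mem_supported (arcPoly_mem_supported hEBm) hμ2 hv]
  rw [← hT, coeff_splitHom hM0 (fun v hv => hμB v (hUB' v hv)),
    ← arcPoly_clusterArcs_mul hd hUB hEm hEBm, ← hFr, prod_X_eq_monomial Fr fun v => v, coeff_mul_monomial'] at hμ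
  have hle : ∑ v ∈ Fr, Finsupp.single v 1 ≤ M + μ := by
    by_contra h
    rw [if_neg h] at hμ
    exact hμ rfl
  rw [if_pos hle, mul_one] at hμ
  refine ⟨_, hμ, fun K hK v hv => ?_, fun y hy => ?_⟩
  · have h1 := hmn K hK v hv
    have h2 := hle v
    rw [Finsupp.tsub_apply]
    rw [sum_single_apply'] at h2 ⊢
    rw [Finsupp.add_apply, hμB v (hUB K hK v hv), hMv K hK v hv] at h2 ⊢
    refine ⟨by omega, fun he hz' => ?_⟩
    have : v ∈ Fr := mem_filter.2 ⟨mem_biUnion.2 ⟨K, hK, he⟩, hz'⟩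
    rw [if_pos this] at h2 ⊢
    omega
  -- A cluster raises the exponent of `y` by at most one, and only if a selected vertex is attached
  -- to `y`, however many of its vertices are.
  · have h1 : μ1 y ≤ #(𝒜.filter fun K => z (a K) = y) + #(𝒜.filter fun K => z (b K) = y) := by
      refine (monomial_le_degreeOf y (mem_support_iff.2 hμ1)).trans
        ((degreeOf_prod_le y 𝒜 _).trans ?_)
      rw [card_filter, card_filter, ← sum_add_distrib]
      refine sum_le_sum fun K _ => ?_
      rw [← map_intCast (C : ℤ →+* MvPolynomial V ℤ)]
      refine (degreeOf_C_mul_le _ _ _).trans ((degreeOf_sub_le _ _ _).trans ?_)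
      have h3 := degreeOf_extVar z B (a K) y
      have h4 := degreeOf_extVar z B (b K) y
      omega
    have h2 := coeff_arcPoly_le hEB hμ2 hy
    have h3 : M y = 0 := hM0 y fun h => hUB' y h hy
    rw [Finsupp.tsub_apply, Finsupp.add_apply, h3, ← hμs, Finsupp.add_apply]
    omega

variable {G : SimpleGraph V} [DecidableRel G.Adj] {n : ℕ} {L : Finset V}

/-- Otherwise the clusters of `𝒜` together with `B` would be reducible. Since `y ∈ B` has degree n +
1, its exponent must stay two below its number of neighbours in this set, which is what `hch`
secures. -/
theorem IsATCritical.no_selection (hG : IsATCritical G (n + 1)) (hL : LowSet G n L)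
    {𝒜 : Finset (Finset V)} (h𝒜 : 𝒜.Nonempty) (hcl : ∀ K ∈ 𝒜, Cluster G n L K)
    (hd : ∀ K ∈ 𝒜, ∀ K' ∈ 𝒜, K ≠ K' → Disjoint K K')
    (hno : ∀ K ∈ 𝒜, ∀ K' ∈ 𝒜, K ≠ K' → ∀ u ∈ K, ∀ v ∈ K', ¬ G.Adj u v)
    {B : Finset V} (hB : ∀ y ∈ B, G.degree y = n + 1) (a b : Finset V → V)
    (ha : ∀ K ∈ 𝒜, a K ∈ extVerts (extNb G n L) K) (haB : ∀ K ∈ 𝒜, extNb G n L (a K) ∈ B)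
    (hb : ∀ K ∈ 𝒜, b K ∈ extVerts (extNb G n L) K)
    (hab : ∀ K ∈ 𝒜, extNb G n L (b K) ≠ extNb G n L (a K))
    (hch : ∀ y ∈ B, #(𝒜.filter fun K => extNb G n L (a K) = y) +
      #(𝒜.filter fun K => extNb G n L (b K) = y) + 2 ≤
      #((𝒜.biUnion id).filter fun v => extNb G n L v = y)) : False := by
  have hKL : ∀ K ∈ 𝒜, K ⊆ L := fun K hK => (hcl K hK).closed.1.trans cliqueVerts_subset
  have hLB : ∀ v ∈ L, v ∉ B := fun v hv hvB => by
    have h1 := hL.degree v hv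
    have h2 := hB v hvB
    omega
  have hUB : ∀ K ∈ 𝒜, ∀ v ∈ K, v ∉ B := fun K hK v hv => hLB v (hKL K hK hv)
  have hz : ∀ K ∈ 𝒜, ∀ v ∈ K, ∀ y ∈ B, G.Adj v y ↔ extNb G n L v = y := by
    intro K hK v hv y hy
    have hvW := (hcl K hK).closed.1 hv
    rw [eq_comm, ← hL.eq_extNb_iff hvW]
    exact ⟨fun h => ⟨h, fun hs => hLB y (cliqueVerts_subset hs.symm.mem) hy⟩, fun h => h.1⟩
  obtain ⟨E, hE, m, hm, h1, h2⟩ := exists_coeff_of_selection hd hno hUB hz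
    (fun K hK => (hcl K hK).separating) a b ha haB hb hab
  obtain ⟨K0, hK0⟩ := h𝒜
  refine hG.not_reducible (Nat.succ_pos n) (X := 𝒜.biUnion id ∪ B) ?_ hE hm fun v hv => ?_
  · exact (hcl K0 hK0).nonempty.mono fun v hv => mem_union_left _ (mem_biUnion.2 ⟨K0, hK0, hv⟩)
  rw [Nat.add_sub_cancel]
  rcases mem_union.1 hv with hv | hv
  · obtain ⟨K, hK, hvK⟩ := mem_biUnion.1 hv
    simp only [id] at hvK
    have hvW := (hcl K hK).closed.1 hvK
    obtain ⟨h3, h4⟩ := h1 K hK v hvK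
    rw [hL.degree v (hKL K hK hvK)]
    -- A vertex attached outside `B` may lose one neighbour, and its exponent is one smaller in
    -- return.
    by_cases hfree : v ∈ extVerts (extNb G n L) K ∧ extNb G n L v ∉ B
    · obtain ⟨Q, hQ, hvQ, hQK⟩ := (hcl K hK).closed.exists_subset hvK
      have h5 := card_nb_clique hQ.2.1 hvQ
      have h6 := card_le_card (nb_mono (G := G) (hQK.trans fun w hw =>
        mem_union_left B (mem_biUnion.2 ⟨K, hK, hw⟩ : w ∈ 𝒜.biUnion id)) v)
      have h7 := h4 hfree.1 hfree.2
      have h8 := hQ.2.2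
      omega
    · have h5 : nb G univ v ⊆ nb G (𝒜.biUnion id ∪ B) v := by
        intro w hw
        have hadj := (mem_nb.1 hw).2
        refine mem_nb.2 ⟨?_, hadj⟩
        by_cases hs : SameClique G n L v w
        · exact mem_union_left _ (mem_biUnion.2 ⟨K, hK, (hcl K hK).closed.2 v hvK w hs⟩)
        · have hw' := (hL.eq_extNb_iff hvW w).1 ⟨hadj, hs⟩
          by_cases hwK : w ∈ K
          · exact mem_union_left _ (mem_biUnion.2 ⟨K, hK, hwK⟩)
          · refine mem_union_right _ ?_
            by_contra hwB
            exact hfree ⟨mem_extVerts.2 ⟨hvK, hw' ▸ hwK⟩, hw' ▸ hwB⟩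
      have h6 := card_le_card h5
      rw [card_nb_univ, hL.degree v (hKL K hK hvK)] at h6
      omega
  · rw [hB v hv]
    have h3 := h2 v hv
    have h4 := hch v hv
    have h5 : nb G B v ∪ ((𝒜.biUnion id).filter fun w => extNb G n L w = v) ⊆
        nb G (𝒜.biUnion id ∪ B) v := by
      refine union_subset (nb_mono subset_union_right v) fun w hw => ?_
      obtain ⟨hw, hzw⟩ := mem_filter.1 hw
      obtain ⟨K, hK, hwK⟩ := mem_biUnion.1 hw
      exact mem_nb.2 ⟨mem_union_left _ hw, ((hz K hK w hwK v hv).2 hzw).symm⟩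
    have h6 := card_le_card h5
    rw [card_union_of_disjoint (disjoint_left.2 fun w hw hw' => by
      obtain ⟨K, hK, hwK⟩ := mem_biUnion.1 (mem_filter.1 hw').1
      exact hUB K hK w hwK (nb_subset _ _ hw))] at h6
    omega

end

end AlonTarsi

/-! ### Hall's theorem and the edges from clusters to vertices of degree k -/

namespace AlonTarsi

open Finset

universe u

section

variable {V : Type u} [Fintype V] [DecidableEq V]

/-- Each of some disjoint sets of at least two elements selects an element such that every large
fibre of `z` keeps two unselected elements. -/
theorem exists_selection {ι : Type u} [Fintype ι] [DecidableEq ι] (A : ι → Finset V) (U : Finset V)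
    (z : V → V) (hd : ∀ i j, i ≠ j → Disjoint (A i) (A j)) (hAU : ∀ i, A i ⊆ U)
    (hA : ∀ i, 2 ≤ #(A i)) (h4 : ∀ i, ∀ v ∈ A i, 4 ≤ #(U.filter fun w => z w = z v)) :
    ∃ p : ι → V, (∀ i, p i ∈ A i) ∧ ∀ y, 4 ≤ #(U.filter fun w => z w = y) →
      #(univ.filter fun i => z (p i) = y) + 2 ≤ #(U.filter fun w => z w = y) := by
  set d : V → ℕ := fun y => #(U.filter fun w => z w = y) with hdy
  -- The fibre over `y` offers d y - 2 places, at least half its size when d y ≥ 4. As every group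
  -- has two elements or more, Hall's condition holds, and distinct places leave two elements of
  -- each fibre to spare.
  let t : ι → Finset (Σ _ : V, ℕ) := fun i => ((A i).image z).sigma fun y => range (d y - 2)
  have hall : ∀ s : Finset ι, #s ≤ #(s.biUnion t) := by
    intro s
    have h1 : s.biUnion t = (s.biUnion fun i => (A i).image z).sigma fun y => range (d y - 2) := by
      ext ⟨y, j⟩
      simp only [t, mem_biUnion, mem_sigma]
      constructor
      · rintro ⟨i, hi, h1, h2⟩; exact ⟨⟨i, hi, h1⟩, h2⟩
      · rintro ⟨⟨i, hi, h1⟩, h2⟩; exact ⟨i, hi, h1, h2⟩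
    rw [h1, card_sigma]
    simp only [card_range]
    have h2 : 2 * #s ≤ #(s.biUnion A) := by
      rw [card_biUnion fun i _ j _ h => hd i j h, mul_comm, ← smul_eq_mul]
      exact card_nsmul_le_sum _ _ _ fun i _ => hA i
    have h3 : #(s.biUnion A) ≤ ∑ y ∈ s.biUnion fun i => (A i).image z, d y := by
      rw [card_eq_sum_card_fiberwise (f := z) (t := s.biUnion fun i => (A i).image z)]
      · refine sum_le_sum fun y _ => card_le_card (filter_subset_filter _ ?_)
        exact biUnion_subset.2 fun i _ => hAU i
      · intro v hv
        obtain ⟨i, hi, hv⟩ := mem_biUnion.1 (mem_coe.1 hv)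
        exact mem_coe.2 (mem_biUnion.2 ⟨i, hi, mem_image_of_mem z hv⟩)
    have h4' : ∑ y ∈ s.biUnion (fun i => (A i).image z), d y ≤
        ∑ y ∈ s.biUnion (fun i => (A i).image z), 2 * (d y - 2) := by
      refine sum_le_sum fun y hy => ?_
      obtain ⟨i, -, hy⟩ := mem_biUnion.1 hy
      obtain ⟨v, hv, rfl⟩ := mem_image.1 hy
      have := h4 i v hv
      simp only [d]
      omega
    rw [← mul_sum] at h4'
    omega
  obtain ⟨f, hf, hft⟩ := (all_card_le_biUnion_card_iff_exists_injective t).1 hall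
  have hp : ∀ i, ∃ v ∈ A i, z v = (f i).1 := fun i => mem_image.1 (mem_sigma.1 (hft i)).1
  choose p hpA hpz using hp
  refine ⟨p, hpA, fun y hy => ?_⟩
  have : #(univ.filter fun i => z (p i) = y) ≤ #(range (d y - 2)) := by
    refine card_le_card_of_injOn (fun i => (f i).2) (fun i hi => ?_) fun i hi j hj h => hf ?_
    · have h1 := (mem_filter.1 (mem_coe.1 hi)).2
      have h2 := (mem_sigma.1 (hft i)).2
      rw [← hpz i, h1] at h2
      exact h2
    · have h1 := (mem_filter.1 (mem_coe.1 hi)).2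
      have h2 := (mem_filter.1 (mem_coe.1 hj)).2
      refine Sigma.ext ?_ (heq_of_eq h)
      rw [← hpz i, ← hpz j, h1, h2]
  rw [card_range] at this
  have h5 : d y = #(U.filter fun w => z w = y) := rfl
  omega

/-- A set on which the fibres of `z` are not too large has two parts of at least two elements with
disjoint images. -/
theorem exists_two_groups {S : Finset V} (z : V → V) (h4 : 4 ≤ #S)
    (h : ∀ y, #(S.filter fun v => z v = y) + 2 ≤ #S) : ∃ S0 ⊆ S, ∃ S1 ⊆ S, 2 ≤ #S0 ∧ 2 ≤ #S1 ∧
      ∀ v ∈ S0, ∀ w ∈ S1, z w ≠ z v := by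
  -- A fibre with at least two elements is set against its complement; if there is none, `z` is
  -- injective on `S` and any splitting works.
  by_cases hy : ∃ y, 2 ≤ #(S.filter fun v => z v = y)
  · obtain ⟨y, hy⟩ := hy
    refine ⟨S.filter fun v => z v = y, filter_subset _ _, S.filter fun v => ¬ z v = y,
      filter_subset _ _, hy, ?_, fun v hv w hw => ?_⟩
    · have h1 := card_filter_add_card_filter_not (s := S) (fun v => z v = y)
      have h2 := h y
      omega
    · rw [(mem_filter.1 hv).2]
      exact (mem_filter.1 hw).2
  · push Not at hy
    obtain ⟨S0, hS0, hc⟩ := exists_subset_card_eq (show 2 ≤ #S by omega)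
    refine ⟨S0, hS0, S \ S0, sdiff_subset, hc.ge, ?_, fun v hv w hw heq => ?_⟩
    · rw [card_sdiff_of_subset hS0]
      omega
    · have h1 := hy (z v)
      have h2 : ({v, w} : Finset V) ⊆ S.filter fun u => z u = z v := by
        intro u hu
        rcases mem_insert.1 hu with rfl | hu
        · exact mem_filter.2 ⟨hS0 hv, rfl⟩
        · rw [mem_singleton.1 hu]
          exact mem_filter.2 ⟨(mem_sdiff.1 hw).1, heq⟩
      have h3 := card_le_card h2
      rw [card_pair (by rintro rfl; exact (mem_sdiff.1 hw).2 hv)] at h3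
      omega

variable {G : SimpleGraph V} [DecidableRel G.Adj] {n : ℕ} {L : Finset V}

/-- A second big clique would give at least 2n vertices, hence at least 2n - 2 > n + 1 external
ones. -/
theorem Cluster.eq_bigClique (hL : LowSet G n L) {K Q : Finset V} (hK : Cluster G n L K)
    (hQ : BigClique G n L Q) (hQK : Q ⊆ K) (hext : #(extVerts (extNb G n L) K) ≤ n + 1) :
    K = Q := by
  refine Subset.antisymm (fun w hw => ?_) hQK
  by_contra hwQ
  obtain ⟨Q', hQ', hwQ', hQK'⟩ := hK.closed.exists_subset hw
  have hdis : Disjoint Q Q' := disjoint_left.2 fun v hv hv' => hwQ (by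
    rw [hL.bigClique_eq hQ hQ' hv hv']; exact hwQ')
  have h1 := card_le_card (union_subset hQK hQK')
  rw [card_union_of_disjoint hdis, hQ.2.2, hQ'.2.2] at h1
  have h2 := hK.card_ext hL
  have h3 : (4 : ℝ) ≤ n := by exact_mod_cast hL.four_le
  have h4 : (n : ℝ) + n ≤ #K := by exact_mod_cast h1
  have h5 : (#(extVerts (extNb G n L) K) : ℝ) ≤ n + 1 := by exact_mod_cast hext
  nlinarith

/-- Suppose at most one external vertex misses `y`. If one does, it and a vertex attached to `y`
form a selection for the single cluster `K`: it charges `y` once, while at least three vertices are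
attached. If none does, `K` is one big clique, which `y` extends to a clique on n + 1 vertices. -/
theorem IsATCritical.card_filter_ext (hG : IsATCritical G (n + 1)) (hL : LowSet G n L)
    (hcard : ∀ S : Finset V, G.IsClique (S : Set V) → #S ≤ n) {K : Finset V}
    (hK : Cluster G n L K) {y : V} (hy : G.degree y = n + 1) :
    #((extVerts (extNb G n L) K).filter fun v => extNb G n L v = y) + 2 ≤
      #(extVerts (extNb G n L) K) := by
  by_contra hlt
  have h4 := hK.four_le_card_ext hL
  by_cases hall : ∃ b ∈ extVerts (extNb G n L) K, extNb G n L b ≠ y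
  · obtain ⟨b, hb, hby⟩ := hall
    obtain ⟨a, ha⟩ : ((extVerts (extNb G n L) K).filter fun v => extNb G n L v = y).Nonempty :=
      card_pos.1 (by omega)
    obtain ⟨ha, hay⟩ := mem_filter.1 ha
    refine hG.no_selection hL (𝒜 := {K}) (singleton_nonempty _) (B := {y})
      (by simpa using hK) ?_ ?_ (by simpa using hy) (fun _ => a) (fun _ => b) (by simpa using ha)
      (by simpa using hay) (by simpa using hb) (by simpa [hay] using hby) ?_
    · intro K1 h1 K2 h2 hne
      rw [mem_singleton.1 h1, mem_singleton.1 h2] at hne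
      exact absurd rfl hne
    · intro K1 h1 K2 h2 hne
      rw [mem_singleton.1 h1, mem_singleton.1 h2] at hne
      exact absurd rfl hne
    · intro y' hy'
      rw [mem_singleton.1 hy', singleton_biUnion]
      have h1 := card_filter_le ({K} : Finset (Finset V)) fun _ => extNb G n L a = y
      have h2 : #(({K} : Finset (Finset V)).filter fun _ => extNb G n L b = y) = 0 := by
        rw [filter_false_of_mem fun _ _ => hby, card_empty]
      have h3 : #((extVerts (extNb G n L) K).filter fun v => extNb G n L v = y) ≤
          #((id K).filter fun v => extNb G n L v = y) :=
        card_le_card (filter_subset_filter _ (filter_subset _ _))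
      rw [card_singleton] at h1
      omega
  · push Not at hall
    have h1 : extVerts (extNb G n L) K ⊆ nb G univ y := fun v hv => by
      refine mem_nb.2 ⟨mem_univ _, ?_⟩
      have := hL.adj_extNb (hK.closed.1 (mem_extVerts.1 hv).1)
      rw [hall v hv] at this
      exact this.symm
    have h2 := card_le_card h1
    rw [card_nb_univ, hy] at h2
    obtain ⟨v0, hv0⟩ := hK.nonempty
    obtain ⟨Q, hQ, hvQ, hQK⟩ := hK.closed.exists_subset hv0
    have hKQ := hK.eq_bigClique hL hQ hQK h2
    subst hKQ
    have h3 : ∀ v ∈ K, extNb G n L v ∉ K := fun v hv h =>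
      hL.not_sameClique_extNb (hK.closed.1 hv) ⟨K, hQ, hv, h⟩
    have h5 : ∀ v ∈ K, extNb G n L v = y := fun v hv => hall v (mem_extVerts.2 ⟨hv, h3 v hv⟩)
    have h6 : y ∉ K := h5 v0 hv0 ▸ h3 v0 hv0
    have h7 := hcard (insert y K) (by
      rw [coe_insert, SimpleGraph.isClique_insert]
      refine ⟨hQ.2.1, fun v hv _ => ?_⟩
      have := hL.adj_extNb (hK.closed.1 (mem_coe.1 hv))
      rw [h5 v hv] at this
      exact this.symm)
    rw [card_insert_of_notMem h6, hQ.2.2] at h7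
    omega

/-- Every cluster must select two external vertices with different outer neighbours. A vertex
attached outside `B`, if there is one, serves as one of the two at no charge; otherwise the external
vertices are split into two groups with disjoint images. Hall's theorem then selects from all groups
at once and `no_selection` applies. -/
theorem IsATCritical.no_dense_pair (hG : IsATCritical G (n + 1)) (hL : LowSet G n L)
    (hcard : ∀ S : Finset V, G.IsClique (S : Set V) → #S ≤ n)
    {𝒜 : Finset (Finset V)} (h𝒜 : 𝒜.Nonempty) (hcl : ∀ K ∈ 𝒜, Cluster G n L K)
    (hd : ∀ K ∈ 𝒜, ∀ K' ∈ 𝒜, K ≠ K' → Disjoint K K')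
    (hno : ∀ K ∈ 𝒜, ∀ K' ∈ 𝒜, K ≠ K' → ∀ u ∈ K, ∀ v ∈ K', ¬ G.Adj u v)
    {B : Finset V} (hB : ∀ y ∈ B, G.degree y = n + 1)
    (h4 : ∀ y ∈ B, 4 ≤ #((𝒜.biUnion id).filter fun v => extNb G n L v = y))
    (h2 : ∀ K ∈ 𝒜, 2 ≤ #(K.filter fun v => extNb G n L v ∈ B)) : False := by
  classical
  set z := extNb G n L with hz
  have hLB : ∀ v ∈ L, v ∉ B := fun v hv hvB => by
    have h1 := hL.degree v hv
    have h2 := hB v hvB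
    omega
  have : Nonempty V := by
    obtain ⟨K, hK⟩ := h𝒜
    exact ⟨(hcl K hK).nonempty.choose⟩
  have hgr : ∀ K ∈ 𝒜, ∃ g0 g1 : Finset V, ∃ b0 : V, (∀ v ∈ g0, v ∈ extVerts z K ∧ z v ∈ B) ∧
      2 ≤ #g0 ∧ (((∀ v ∈ g1, v ∈ extVerts z K ∧ z v ∈ B) ∧ 2 ≤ #g1 ∧
        ∀ v ∈ g0, ∀ w ∈ g1, z w ≠ z v) ∨ (g1 = ∅ ∧ b0 ∈ extVerts z K ∧ z b0 ∉ B)) := by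
    intro K hK
    by_cases hopen : ∃ b ∈ extVerts z K, z b ∉ B
    · obtain ⟨b, hb, hbB⟩ := hopen
      refine ⟨K.filter fun v => z v ∈ B, ∅, b, fun v hv => ?_, h2 K hK, Or.inr ⟨rfl, hb, hbB⟩⟩
      obtain ⟨hv, hvB⟩ := mem_filter.1 hv
      refine ⟨mem_extVerts.2 ⟨hv, fun h => hLB _ ?_ hvB⟩, hvB⟩
      exact cliqueVerts_subset ((hcl K hK).closed.1 h)
    · push Not at hopen
      obtain ⟨S0, hS0, S1, hS1, hc0, hc1, hne⟩ := exists_two_groups z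
        ((hcl K hK).four_le_card_ext hL) (fun y => by
          by_cases hy : y ∈ B
          · exact hG.card_filter_ext hL hcard (hcl K hK) (hB y hy)
          · rw [filter_false_of_mem fun v hv h => hy (by rw [← h]; exact hopen v hv),
              card_empty]
            have := (hcl K hK).four_le_card_ext hL
            omega)
      exact ⟨S0, S1, Classical.arbitrary V, fun v hv => ⟨hS0 hv, hopen v (hS0 hv)⟩, hc0,
        Or.inl ⟨fun v hv => ⟨hS1 hv, hopen v (hS1 hv)⟩, hc1, hne⟩⟩
  choose! g0 g1 b0 hg0 hc0 hg1 using hgr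
  let A : Finset V × Bool → Finset V := fun q => if q.2 then g1 q.1 else g0 q.1
  have hAext : ∀ q : Finset V × Bool, q.1 ∈ 𝒜 → ∀ v ∈ A q, v ∈ extVerts z q.1 ∧ z v ∈ B := by
    rintro ⟨K, b⟩ hK v hv
    cases b with
    | false => exact hg0 K hK v hv
    | true =>
      rcases hg1 K hK with h | h
      · exact h.1 v hv
      · simp only [A, if_true, h.1, notMem_empty] at hv
  let ι := {q : Finset V × Bool // q.1 ∈ 𝒜 ∧ (A q).Nonempty}
  obtain ⟨p, hpA, hp⟩ := exists_selection (ι := ι) (fun i => A i.1) (𝒜.biUnion id) z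
    (by
      rintro ⟨⟨K, b⟩, hK, h⟩ ⟨⟨K', b'⟩, hK', h'⟩ hne
      refine disjoint_left.2 fun v hv hv' => ?_
      have hvK := (mem_extVerts.1 (hAext _ hK v hv).1).1
      have hvK' := (mem_extVerts.1 (hAext _ hK' v hv').1).1
      have hKK : K = K' := by
        by_contra hne'
        exact disjoint_left.1 (hd K hK K' hK' hne') hvK hvK'
      subst hKK
      have hdis : v ∈ g0 K → v ∈ g1 K → False := fun h0 h1 => by
        rcases hg1 K hK with h | h
        · exact h.2.2 v h0 v h1 rfl
        · rw [h.1] at h1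
          exact notMem_empty _ h1
      cases b <;> cases b'
      · exact hne rfl
      · exact hdis hv hv'
      · exact hdis hv' hv
      · exact hne rfl)
    (by
      rintro ⟨⟨K, b⟩, hK, h⟩ v hv
      exact mem_biUnion.2 ⟨K, hK, (mem_extVerts.1 (hAext _ hK v hv).1).1⟩)
    (by
      rintro ⟨⟨K, b⟩, hK, h⟩
      cases b with
      | false => exact hc0 K hK
      | true =>
        rcases hg1 K hK with h1 | h1
        · exact h1.2.1
        · simp only [A, if_true, h1.1, Finset.not_nonempty_empty] at h)
    (by
      rintro ⟨⟨K, b⟩, hK, h⟩ v hv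
      exact h4 _ (hAext _ hK v hv).2)
  -- For an empty second group the selected vertex is `b0`, which is attached outside `B`.
  let P : Finset V × Bool → V := fun q => if h : q.1 ∈ 𝒜 ∧ (A q).Nonempty then p ⟨q, h⟩ else b0 q.1
  have hP : ∀ q (h : q.1 ∈ 𝒜 ∧ (A q).Nonempty), P q = p ⟨q, h⟩ := fun q h => dif_pos h
  have hP' : ∀ q, q.1 ∈ 𝒜 → (A q).Nonempty → P q ∈ A q := fun q h h' => by
    rw [hP q ⟨h, h'⟩]
    exact hpA ⟨q, h, h'⟩
  have hne0 : ∀ K ∈ 𝒜, (A (K, false)).Nonempty := fun K hK =>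
    card_pos.1 (lt_of_lt_of_le two_pos (hc0 K hK))
  have hPo : ∀ K ∈ 𝒜, ∀ b, (A (K, b)).Nonempty ∨ (P (K, b) ∈ extVerts z K ∧ z (P (K, b)) ∉ B) := by
    intro K hK b
    by_cases h : (A (K, b)).Nonempty
    · exact Or.inl h
    · right
      have h1 : P (K, b) = b0 K := dif_neg fun h' => h h'.2
      cases b with
      | false => exact absurd (hne0 K hK) h
      | true =>
        rcases hg1 K hK with h2 | h2
        · exact absurd (card_pos.1 (lt_of_lt_of_le two_pos h2.2.1)) h
        · rw [h1]
          exact h2.2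
  have ha := fun K (hK : K ∈ 𝒜) => hP' (K, false) hK (hne0 K hK)
  refine hG.no_selection hL h𝒜 hcl hd hno hB (fun K => P (K, false)) (fun K => P (K, true))
    (fun K hK => (hAext _ hK _ (ha K hK)).1) (fun K hK => (hAext _ hK _ (ha K hK)).2)
    (fun K hK => ?_) (fun K hK => ?_) fun y hy => ?_
  · rcases hPo K hK true with h | h
    · exact (hAext _ hK _ (hP' (K, true) hK h)).1
    · exact h.1
  · rcases hPo K hK true with h | h
    · rcases hg1 K hK with h2 | h2
      · exact h2.2.2 _ (ha K hK) _ (hP' (K, true) hK h)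
      · simp only [A, if_true, h2.1, Finset.not_nonempty_empty] at h
    · intro heq
      apply h.2
      change z _ = z _ at heq
      rw [heq]
      exact (hAext _ hK _ (ha K hK)).2
  · refine le_trans (Nat.add_le_add_right ?_ 2) (hp y (h4 y hy))
    have h5 : #(𝒜.filter fun K => z (P (K, false)) = y) + #(𝒜.filter fun K => z (P (K, true)) = y) =
        #((𝒜 ×ˢ (univ : Finset Bool)).filter fun q => z (P q) = y) := by
      rw [card_filter, card_filter, card_filter, sum_product, ← sum_add_distrib]
      refine sum_congr rfl fun K _ => ?_
      rw [Fintype.sum_bool, add_comm]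
    rw [h5]
    refine (card_le_card (t := (univ.filter fun i : ι => z (p i) = y).image Subtype.val) ?_).trans
      card_image_le
    intro q hq
    obtain ⟨hq, hqy⟩ := mem_filter.1 hq
    have hqA := (mem_product.1 hq).1
    have hne : (A q).Nonempty := by
      rcases hPo q.1 hqA q.2 with h | h
      · exact h
      · exact absurd (hqy ▸ hy) h.2
    refine mem_image.2 ⟨⟨q, hqA, hne⟩, mem_filter.2 ⟨mem_univ _, ?_⟩, rfl⟩
    rw [← hP q ⟨hqA, hne⟩, hqy]

/-- The number of edges between clusters and vertices of the second smallest degree. -/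
theorem IsATCritical.card_edges_le (hG : IsATCritical G (n + 1)) (hL : LowSet G n L)
    (hcard : ∀ S : Finset V, G.IsClique (S : Set V) → #S ≤ n)
    {𝒜 : Finset (Finset V)} (hcl : ∀ K ∈ 𝒜, Cluster G n L K)
    (hd : ∀ K ∈ 𝒜, ∀ K' ∈ 𝒜, K ≠ K' → Disjoint K K')
    (hno : ∀ K ∈ 𝒜, ∀ K' ∈ 𝒜, K ≠ K' → ∀ u ∈ K, ∀ v ∈ K', ¬ G.Adj u v)
    {B : Finset V} (hB : ∀ y ∈ B, G.degree y = n + 1) :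
    #((𝒜.biUnion id).filter fun v => extNb G n L v ∈ B) ≤ #𝒜 + 3 * #B := by
  induction hN : #𝒜 + #B using Nat.strong_induction_on generalizing 𝒜 B with
  | _ N ih =>
  -- The induction deletes a vertex of `B` with at most three attached vertices, or a cluster with
  -- at most one vertex attached to `B`. If neither exists, `no_dense_pair` leaves only the case
  -- without clusters.
  by_cases h1 : ∃ y ∈ B, #((𝒜.biUnion id).filter fun v => extNb G n L v = y) ≤ 3
  · obtain ⟨y, hy, h1⟩ := h1
    have hc := card_erase_add_one hy
    have h2 := ih (#𝒜 + #(B.erase y)) (by omega) hcl hd hno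
      (fun w hw => hB w (mem_of_mem_erase hw)) rfl
    have h3 : ((𝒜.biUnion id).filter fun v => extNb G n L v ∈ B) ⊆
        ((𝒜.biUnion id).filter fun v => extNb G n L v ∈ B.erase y) ∪
        ((𝒜.biUnion id).filter fun v => extNb G n L v = y) := by
      intro v hv
      rw [mem_union, mem_filter, mem_filter, mem_erase]
      have := mem_filter.1 hv
      tauto
    have h4 := (card_le_card h3).trans (card_union_le _ _)
    omega
  by_cases h2 : ∃ K ∈ 𝒜, #(K.filter fun v => extNb G n L v ∈ B) ≤ 1
  · obtain ⟨K, hK, h2⟩ := h2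
    have hc := card_erase_add_one hK
    have h5 := ih (#(𝒜.erase K) + #B) (by omega) (fun K' h => hcl K' (mem_of_mem_erase h))
      (fun K1 h1 K2 h2 => hd K1 (mem_of_mem_erase h1) K2 (mem_of_mem_erase h2))
      (fun K1 h1 K2 h2 => hno K1 (mem_of_mem_erase h1) K2 (mem_of_mem_erase h2)) hB rfl
    have h3 : ((𝒜.biUnion id).filter fun v => extNb G n L v ∈ B) ⊆
        (((𝒜.erase K).biUnion id).filter fun v => extNb G n L v ∈ B) ∪
        (K.filter fun v => extNb G n L v ∈ B) := by
      intro v hv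
      obtain ⟨hv, hvB⟩ := mem_filter.1 hv
      obtain ⟨K', hK', hv⟩ := mem_biUnion.1 hv
      rw [mem_union, mem_filter, mem_filter, mem_biUnion]
      by_cases h : K' = K
      · subst h
        exact Or.inr ⟨hv, hvB⟩
      · exact Or.inl ⟨⟨K', mem_erase.2 ⟨h, hK'⟩, hv⟩, hvB⟩
    have h4 := (card_le_card h3).trans (card_union_le _ _)
    omega
  push Not at h1 h2
  rcases 𝒜.eq_empty_or_nonempty with h𝒜 | h𝒜
  · simp [h𝒜]
  · exact (hG.no_dense_pair hL hcard h𝒜 hcl hd hno hB h1 h2).elim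

end

end AlonTarsi

/-! ### The final count -/

namespace AlonTarsi

open Finset

universe u

section

variable {V : Type u} [Fintype V] [DecidableEq V] {G : SimpleGraph V} [DecidableRel G.Adj]
  {n : ℕ} {L : Finset V}

theorem sum_card_nb_comm (X Y : Finset V) : ∑ v ∈ X, #(nb G Y v) = ∑ y ∈ Y, #(nb G X y) := by
  simp only [nb, card_filter]
  rw [sum_comm]
  simp only [G.adj_comm]

theorem LowSet.card_filter_extNb (hL : LowSet G n L) {S : Finset V}
    (hS : Disjoint S (cliqueVerts G n L)) :
    #((cliqueVerts G n L).filter fun v => extNb G n L v ∈ S) =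
      ∑ v ∈ cliqueVerts G n L, #(nb G S v) := by
  rw [card_filter]
  refine sum_congr rfl fun v hv => ?_
  have h1 : nb G S v = S.filter fun u => u = extNb G n L v := by
    ext u
    rw [mem_nb, mem_filter]
    refine and_congr_right fun hu => ?_
    rw [← hL.eq_extNb_iff hv]
    exact ⟨fun h => ⟨h, fun hs => disjoint_left.1 hS hu hs.symm.mem⟩, fun h => h.1⟩
  rw [h1, filter_eq']
  split_ifs <;> simp

theorem LowSet.cliqueClosed (_ : LowSet G n L) : CliqueClosed G n L (cliqueVerts G n L) :=
  ⟨Subset.refl _, fun _ _ _ h => h.symm.mem⟩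

theorem LowSet.sum_card_ext (hL : LowSet G n L) {𝒦 : Finset (Finset V)}
    (hd : ∀ K ∈ 𝒦, ∀ K' ∈ 𝒦, K ≠ K' → Disjoint K K')
    (hu : 𝒦.biUnion id = cliqueVerts G n L)
    (hno : ∀ K ∈ 𝒦, ∀ K' ∈ 𝒦, K ≠ K' → ∀ u ∈ K, ∀ v ∈ K', ¬ G.Adj u v) :
    ∑ K ∈ 𝒦, #(extVerts (extNb G n L) K) = #(extVerts (extNb G n L) (cliqueVerts G n L)) := by
  rw [← card_biUnion]
  · congr 1
    ext v
    simp only [mem_biUnion, mem_extVerts]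
    constructor
    · rintro ⟨K, hK, hv, hz⟩
      have hvW : v ∈ cliqueVerts G n L := hu ▸ mem_biUnion.2 ⟨K, hK, hv⟩
      refine ⟨hvW, fun h => ?_⟩
      rw [← hu] at h
      obtain ⟨K', hK', hz'⟩ := mem_biUnion.1 h
      refine hno K hK K' hK' ?_ v hv _ hz' (hL.adj_extNb hvW)
      rintro rfl
      exact hz hz'
    · rintro ⟨hv, hz⟩
      have h := hv
      rw [← hu] at h
      obtain ⟨K, hK, hvK⟩ := mem_biUnion.1 h
      exact ⟨K, hK, hvK, fun h' => hz (hu ▸ mem_biUnion.2 ⟨K, hK, h'⟩)⟩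
  · intro K hK K' hK' hne
    exact disjoint_of_subset_left (filter_subset _ _)
      (disjoint_of_subset_right (filter_subset _ _) (hd K hK K' hK' hne))

theorem sum_pairWeight_eq {X Y : Finset V} {c : ℝ}
    (h : ∀ u ∈ X, ∀ v ∈ Y, G.Adj u v → pairWeight G n L u v = c) :
    ∑ u ∈ X, ∑ v ∈ Y, pairWeight G n L u v = (∑ u ∈ X, #(nb G Y u) : ℕ) * c := by
  push_cast
  rw [sum_mul]
  refine sum_congr rfl fun u hu => ?_
  rw [← nsmul_eq_mul, ← sum_const]
  symm
  rw [← sum_subset (nb_subset Y u) fun v hv hv' =>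
    pairWeight_of_not_adj fun hadj => hv' (mem_nb.2 ⟨hv, hadj⟩)]
  exact sum_congr rfl fun v hv => (h u hu v (mem_nb.1 hv).1 (mem_nb.1 hv).2).symm

theorem LowSet.weight_le_mul_card (hL : LowSet G n L) {X : Finset V} (hX : X ⊆ L) :
    weight G n L X ≤ ((n : ℝ) - 1) * #X := by
  have hn : (4 : ℝ) ≤ n := by exact_mod_cast hL.four_le
  rcases X.eq_empty_or_nonempty with rfl | h
  · simp [weight]
  · have := hL.weight_le hX h
    linarith

/-- The bound on the number of low vertices in terms of the edges leaving them. -/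
theorem LowSet.card_le_edges (hL : LowSet G n L) {𝒦 : Finset (Finset V)}
    (hcl : ∀ K ∈ 𝒦, Cluster G n L K) (hd : ∀ K ∈ 𝒦, ∀ K' ∈ 𝒦, K ≠ K' → Disjoint K K')
    (hu : 𝒦.biUnion id = cliqueVerts G n L)
    (hno : ∀ K ∈ 𝒦, ∀ K' ∈ 𝒦, K ≠ K' → ∀ u ∈ K, ∀ v ∈ K', ¬ G.Adj u v) :
    ((n : ℝ) - 2) * #L + 2 * #𝒦 ≤ (n - 2) * (∑ v ∈ L \ cliqueVerts G n L, #(nb G Lᶜ v) : ℕ) +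
      n * (∑ v ∈ cliqueVerts G n L, #(nb G Lᶜ v) : ℕ) := by
  set W := cliqueVerts G n L with hW
  set Z := L \ W with hZ
  have hnN := hL.four_le
  have hn : (4 : ℝ) ≤ n := by exact_mod_cast hL.four_le
  have hWL : W ⊆ L := cliqueVerts_subset
  have hZL : Z ⊆ L := sdiff_subset
  have hZW : Disjoint Z W := sdiff_disjoint
  have hHW : Disjoint Lᶜ W := disjoint_left.2 fun v hv hv' => mem_compl.1 hv (hWL hv')
  set c := ∑ v ∈ W, #(nb G Z v) with hc
  set eW := ∑ v ∈ W, #(nb G Lᶜ v) with heW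
  set eZ := ∑ v ∈ Z, #(nb G Lᶜ v) with heZ
  set D := ∑ v ∈ Z, #(nb G Z v) with hD
  have hnot : ∀ v ∈ Z, v ∉ W := fun v hv => (mem_sdiff.1 hv).2
  have hcardL : (#L : ℝ) = #W + #Z := by
    have := card_sdiff_add_card_eq_card hWL
    rw [add_comm]
    exact_mod_cast this.symm
  have hext : #(extVerts (extNb G n L) W) = c + eW := by
    rw [hc, heW, ← hL.card_filter_extNb hZW, ← hL.card_filter_extNb hHW,
      ← card_union_of_disjoint]
    · congr 1
      ext v
      simp only [mem_extVerts, mem_union, mem_filter, hZ, mem_sdiff, mem_compl]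
      have h1 := @hWL (extNb G n L v)
      tauto
    · refine disjoint_left.2 fun v hv hv' => ?_
      exact mem_compl.1 (mem_filter.1 hv').2 (hZL (mem_filter.1 hv).2)
  have hcardW : ∑ K ∈ 𝒦, (#K : ℝ) = #W := by
    rw [← hu, card_biUnion (s := 𝒦) (t := id) fun K hK K' hK' h => hd K hK K' hK' h]
    push_cast
    rfl
  have F1 : (n : ℝ) * (c + eW) = (n - 2) * #W + 2 * n * #𝒦 := by
    have h1 : ∑ K ∈ 𝒦, (n * (#(extVerts (extNb G n L) K) : ℝ)) =
        ∑ K ∈ 𝒦, (((n : ℝ) - 2) * #K + 2 * n) := sum_congr rfl fun K hK => (hcl K hK).card_ext hL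
    rw [← mul_sum, sum_add_distrib, ← mul_sum, hcardW, sum_const, nsmul_eq_mul] at h1
    have h2 : ∑ K ∈ 𝒦, (#(extVerts (extNb G n L) K) : ℝ) = c + eW := by
      have := hL.sum_card_ext hd hu hno
      rw [← hW, hext] at this
      exact_mod_cast this
    rw [h2] at h1
    linarith
  have F2 := hL.weight_cliqueClosed hL.cliqueClosed
  rw [← hW, hext] at F2
  push_cast at F2
  have F2' : weight G n L W = ((n : ℝ) - 1) * (#W - #𝒦) := by
    have h1 : (n : ℝ) * (weight G n L W - (n - 1) * (#W - #𝒦)) = 0 := by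
      rw [F2]
      field_simp
      linear_combination (-(n : ℝ) + 1) * F1
    rcases mul_eq_zero.1 h1 with h | h <;> linarith
  have hwZ : weight G n L Z = D := by
    rw [weight, sum_pairWeight_eq (c := 1), mul_one]
    exact fun u hu v hv h => pairWeight_of_notMem h (hnot u hu) (hnot v hv)
  have F3 : weight G n L L = weight G n L W + D + (n - 1) * c := by
    have h1 := weight_union (G := G) (n := n) (L := L) hZW.symm
    rw [hZ, union_sdiff_of_subset hWL, ← hZ, sum_pairWeight_eq (c := ((n : ℝ) - 1) / 2)
      (fun u hu v hv h => pairWeight_of_mem h (fun hs => hnot v hv hs.symm.mem) (Or.inl hu)),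
      ← hc, hwZ] at h1
    rw [h1]
    ring
  have F4 := hL.weight_le_mul_card (Subset.refl L)
  have F5 := hL.weight_le_mul_card hZL
  rw [hwZ] at F5
  rw [F3, F2', hcardL] at F4
  have F6 : (n : ℝ) * #Z = D + c + eZ := by
    have h1 : ∑ v ∈ Z, n = D + c + eZ := by
      rw [hc, sum_card_nb_comm W Z, hD, heZ, ← sum_add_distrib, ← sum_add_distrib]
      refine sum_congr rfl fun v hv => ?_
      rw [← hL.degree v (hZL hv), ← card_nb_univ, ← card_union_of_disjoint, ← card_union_of_disjoint]
      · congr 1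
        ext w
        simp only [mem_union, mem_nb, mem_univ, true_and, hZ, mem_sdiff, mem_compl]
        tauto
      · refine disjoint_left.2 fun w hw hw' => ?_
        refine mem_compl.1 (nb_subset _ _ hw') ?_
        rcases mem_union.1 hw with h | h
        · exact hZL (nb_subset _ _ h)
        · exact hWL (nb_subset _ _ h)
      · exact disjoint_of_subset_left (nb_subset _ _) (disjoint_of_subset_right (nb_subset _ _) hZW)
    rw [sum_const, smul_eq_mul] at h1
    have h2 : ((#Z * n : ℕ) : ℝ) = ((D + c + eZ : ℕ) : ℝ) := by rw [h1]
    push_cast at h2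
    linarith
  have hκc : (D : ℝ) ≤ (n - 1) * (#Z + #𝒦 - c) := by linarith
  -- `F5` and `hκc` are combined with weights n - 4 and 2. In this proportion the terms in `c` later
  -- cancel against those of `F1`.
  have F7 : ((n : ℝ) - 2) * D ≤ (n - 2) * (n - 1) * #Z + (2 * n - 2) * (#𝒦 - c) := by
    have h1 : (n - 2 - 2 : ℝ) * D ≤ (n - 2 - 2) * ((n - 1) * #Z) :=
      mul_le_mul_of_nonneg_left F5 (by linarith)
    linarith
  have F8 : ((n : ℝ) - 2) * (n * #Z) = (n - 2) * (D + c + eZ) := by rw [F6]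
  rw [hcardL]
  linarith

theorem IsATCritical.lowSet (hn : 4 ≤ n) (hG : IsATCritical G (n + 1))
    (hcard : ∀ S : Finset V, G.IsClique (S : Set V) → #S ≤ n) :
    LowSet G n (univ.filter fun v => G.degree v = n) := by
  refine ⟨hn, fun v hv => (mem_filter.1 hv).2, ?_, fun S _ hS => hcard S hS⟩
  intro x p m j hp hm hm2 hx h0 h1 hj hxX hpX
  exact hG.no_even (Nat.succ_pos n) hp hm hm2 hx h0 h1 hj (mem_filter.1 hxX).2
    fun i hi => (mem_filter.1 (hpX i hi)).2

/-- The number of vertices is at most nine times the total excess degree. -/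
theorem IsATCritical.card_le_excess (hn : n = 4 ∨ n = 5) (hG : IsATCritical G (n + 1))
    (hcard : ∀ S : Finset V, G.IsClique (S : Set V) → #S ≤ n) :
    (Fintype.card V : ℝ) ≤ 9 * ∑ v, ((G.degree v : ℝ) - n) := by
  have hL := hG.lowSet (by omega) hcard
  set L := univ.filter fun v => G.degree v = n with hLdef
  obtain ⟨𝒦, hcl, hd, hu, hno⟩ := hL.exists_clusters
  have h1 := hL.card_le_edges hcl hd hu hno
  set W := cliqueVerts G n L with hW
  have hWL : W ⊆ L := cliqueVerts_subset
  have hdeg : ∀ v ∈ Lᶜ, n + 1 ≤ G.degree v := by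
    intro v hv
    have h2 := hG.le_degree (Nat.succ_pos n) v
    have h3 : G.degree v ≠ n := fun h => mem_compl.1 hv (mem_filter.2 ⟨mem_univ _, h⟩)
    omega
  set Hk := Lᶜ.filter fun v => G.degree v = n + 1 with hHk
  have h2 := hG.card_edges_le hL hcard hcl hd hno (B := Hk) fun y hy => (mem_filter.1 hy).2
  rw [hu, hL.card_filter_extNb (disjoint_left.2 fun v hv hv' =>
    mem_compl.1 (mem_filter.1 hv).1 (hWL hv')), sum_card_nb_comm] at h2
  rw [sum_card_nb_comm, sum_card_nb_comm W] at h1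
  have h3 : ∀ y, #(nb G (L \ W) y) + #(nb G W y) ≤ G.degree y := by
    intro y
    rw [← card_union_of_disjoint (disjoint_of_subset_left (nb_subset _ _)
      (disjoint_of_subset_right (nb_subset _ _) sdiff_disjoint)), ← card_nb_univ]
    exact card_le_card (union_subset (nb_mono (subset_univ _) y) (nb_mono (subset_univ _) y))
  have h4 : ∑ v, ((G.degree v : ℝ) - n) = ∑ v ∈ Lᶜ, ((G.degree v : ℝ) - n) := by
    symm
    refine sum_subset (subset_univ _) fun v _ hv => ?_
    rw [mem_compl, not_not] at hv
    rw [hL.degree v hv, sub_self]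
  have h5 : (Fintype.card V : ℝ) = #L + ∑ v ∈ Lᶜ, (1 : ℝ) := by
    rw [sum_const, nsmul_eq_mul, mul_one]
    exact_mod_cast (card_add_card_compl L).symm
  have h6 : (∑ y ∈ Hk, (#(nb G W y) : ℝ)) ≤ #𝒦 + ∑ y ∈ Hk, (3 : ℝ) := by
    rw [sum_const, nsmul_eq_mul, mul_comm]
    exact_mod_cast h2
  rw [hHk, sum_filter, sum_filter] at h6
  push_cast at h1
  -- The charge to one vertex that is not low; doubling `h6` cancels 2 #𝒦 in `h1` and gives the two
  -- conditional terms. At degree n + 1 the left side is at most (n - 2)(n + 2) + 6, which equals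
  -- 9(n - 2) exactly for n = 4 and n = 5; hence the constant 9.
  have key : ∀ y ∈ Lᶜ, ((n : ℝ) - 2) + (n - 2) * #(nb G (L \ W) y) + n * #(nb G W y)
      - 2 * (if G.degree y = n + 1 then (#(nb G W y) : ℝ) else 0)
      + 2 * (if G.degree y = n + 1 then (3 : ℝ) else 0) ≤ (n - 2) * 9 * ((G.degree y : ℝ) - n) := by
    intro y hy
    have a1 : (#(nb G (L \ W) y) : ℝ) + #(nb G W y) ≤ G.degree y := by exact_mod_cast h3 y
    have a2 : (0 : ℝ) ≤ #(nb G (L \ W) y) := Nat.cast_nonneg _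
    have a3 : (0 : ℝ) ≤ #(nb G W y) := Nat.cast_nonneg _
    by_cases h : G.degree y = n + 1
    · rw [if_pos h, if_pos h]
      have h' : (G.degree y : ℝ) = n + 1 := by exact_mod_cast h
      rw [h'] at a1 ⊢
      rcases hn with rfl | rfl <;> push_cast at a1 ⊢ <;> linarith
    · rw [if_neg h, if_neg h]
      have h' : (n : ℝ) + 2 ≤ G.degree y := by
        have := hdeg y hy
        exact_mod_cast (show n + 2 ≤ G.degree y by omega)
      rcases hn with rfl | rfl <;> push_cast at a1 h' ⊢ <;> linarith
  have h7 := sum_le_sum key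
  simp only [sum_add_distrib, sum_sub_distrib, ← mul_sum] at h7
  rw [h4, h5]
  simp only [sum_add_distrib, sum_sub_distrib, ← mul_sum] at h1 h6 ⊢
  have h8 : ∀ r : ℝ, ∑ y ∈ Lᶜ, r = r * ∑ v ∈ Lᶜ, (1 : ℝ) := fun r => by
    rw [mul_sum, mul_one]
  rw [h8 n, h8 2] at h7
  rw [h8 n]
  rcases hn with rfl | rfl <;> push_cast at h1 h7 ⊢ <;> linarith

end

end AlonTarsi

theorem mainTheorem2 {V : Type*} [Fintype V] (G : SimpleGraph V) [DecidableRel G.Adj]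
    (k : ℕ) (hk : k = 5 ∨ k = 6) (hG : AlonTarsi.IsATCritical G k)
    (hne : ¬ Nonempty (G ≃g (⊤ : SimpleGraph (Fin k)))) :
    (k : ℝ) - 1 + ((k : ℝ) - 3) * (2 * (k : ℝ) - 5)
        / ((k : ℝ) ^ 3 + 2 * (k : ℝ) ^ 2 - 18 * (k : ℝ) + 15)
      ≤ AlonTarsi.averageDegree G := by
  classical
  obtain ⟨n, rfl⟩ : ∃ n, k = n + 1 := ⟨k - 1, by omega⟩
  have hn : n = 4 ∨ n = 5 := by omega
  have hmain := hG.card_le_excess hn fun S hS =>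
    Nat.lt_succ_iff.1 (hG.card_clique_lt (Nat.succ_pos n) hne hS)
  rw [Finset.sum_sub_distrib, Finset.sum_const, nsmul_eq_mul, Finset.card_univ] at hmain
  -- A graph without vertices meets every bound and so cannot be critical; this allows division by
  -- the number of vertices.
  have hV : Nonempty V := by
    by_contra hV
    rw [not_nonempty_iff] at hV
    obtain ⟨l, hl⟩ := AlonTarsi.exists_isAT_const G
    exact hG.not_isAT (Nat.succ_pos n) (hl.mono fun v => hV.elim v)
  have hpos : (0 : ℝ) < Fintype.card V := by exact_mod_cast Fintype.card_pos
  rw [AlonTarsi.averageDegree, le_div_iff₀ hpos]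
  -- The required excess is 1/10 for k = 5 and 7/65 for k = 6, both below the 1/9 given by `hmain`.
  rcases hn with rfl | rfl <;> norm_num at hmain ⊢ <;> linarith
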